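/- For an integer $n\ge 1$ let $$K_n=(S^1)^n/\big((z_1,\ldots,z_{n-1},z_n)\sim(\bar z_1,\ldots,\bar z_{n-1},-z_n)\big),$$ where $S^1$ is the unit circle in $\mathbb C$, with the quotient topology. For $m\ge 0$ let $M^{m+2}(2)=S^{m+1}\cup_2 e^{m+2}$ be the mod-2 Moore space, obtained by attaching a closed $(m+2)$-ball to $S^{m+1}$ along a map of degree $2$ from its boundary sphere to $S^{m+1}$. Then for every $n\ge 1$ and every choice of basepoint of $K_n$, the reduced suspension of $K_n$ is (pointed) homotopy equivalent to a wedge of spheres and Moore spaces: $$\Sigma K_n\simeq S^2\vee\bigvee_{i>0\text{ even}}\tbinom{n-1}{i}\,(S^{i+1}\vee S^{i+2})\vee\bigvee_{i>0\text{ odd}}\tbinom{n-1}{i}\,M^{i+2}(2),$$ where $\binom{n-1}{i}X$ denotes the wedge of $\binom{n-1}{i}$ copies of $X$ (a point if $\binom{n-1}{i}=0$). -/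

import Mathlib

noncomputable section

namespace HigherKlein

/-- A topological space with a basepoint. -/
structure PointedSpace where
  carrier : Type
  [top : TopologicalSpace carrier]
  pt : carrier

instance : CoeSort PointedSpace Type := ⟨PointedSpace.carrier⟩

instance (X : PointedSpace) : TopologicalSpace X := X.top

/-- `X` and `Y` are homotopy equivalent as pointed spaces: the maps in both directions and both
homotopies preserve the basepoint. -/
def PointedHomotopyEquivalent (X Y : PointedSpace) : Prop :=
  ∃ (f : C(X, Y)) (g : C(Y, X)), f X.pt = Y.pt ∧ g Y.pt = X.pt ∧
    (g.comp f).HomotopicRel (ContinuousMap.id X) {X.pt} ∧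
    (f.comp g).HomotopicRel (ContinuousMap.id Y) {Y.pt}

/-- The equivalence relation that identifies all points of `A` with one another. -/
def collapseSetoid {X : Type} (A : Set X) : Setoid X where
  r x y := x = y ∨ (x ∈ A ∧ y ∈ A)
  iseqv :=
    { refl := fun _ => Or.inl rfl
      symm := by
        rintro x y (h | h)
        · exact Or.inl h.symm
        · exact Or.inr ⟨h.2, h.1⟩
      trans := by
        rintro x y z (rfl | h) (rfl | h')
        · exact Or.inl rfl
        · exact Or.inr h'
        · exact Or.inr h
        · exact Or.inr ⟨h.1, h'.2⟩ }

/-- The quotient space `X / A`, with the quotient topology, pointed by the class of `a`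
(used only with `a ∈ A`). -/
def collapse {X : Type} [TopologicalSpace X] (A : Set X) (a : X) : PointedSpace where
  carrier := Quotient (collapseSetoid A)
  pt := Quotient.mk (collapseSetoid A) a

/-- The reduced suspension `X × [0,1] / (X × {0} ∪ X × {1} ∪ {pt} × [0,1])`. -/
def reducedSuspension (X : PointedSpace) : PointedSpace :=
  collapse {p : X × unitInterval | p.2 = 0 ∨ p.2 = 1 ∨ p.1 = X.pt} (X.pt, 0)

/-- The wedge `X ∨ Y` of two pointed spaces. -/
def wedge (X Y : PointedSpace) : PointedSpace :=
  collapse ({Sum.inl X.pt, Sum.inr Y.pt} : Set (X ⊕ Y)) (Sum.inl X.pt)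

/-- The wedge of a family of pointed spaces: the quotient of the disjoint union of the family and
a one-point space that identifies all basepoints. The wedge of the empty family is a point. -/
def bigWedge {ι : Type} (X : ι → PointedSpace) : PointedSpace :=
  collapse ({Sum.inl ()} ∪ Set.range (fun i => Sum.inr ⟨i, (X i).pt⟩) :
    Set (Unit ⊕ (Σ i, X i))) (Sum.inl ())

/-- The unit sphere `S^k` in Euclidean space of dimension `k + 1`, pointed by `(1, 0, …, 0)`. -/
def sphere (k : ℕ) : PointedSpace where
  carrier := Metric.sphere (0 : EuclideanSpace ℝ (Fin (k + 1))) 1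
  pt := ⟨EuclideanSpace.single 0 1, by simp⟩

/-- The map `(z, y) ↦ (z ^ 2 / ‖z‖, y)` of `ℂ × ℝ^m = ℝ^(m+2)`, with value `(0, y)` at `z = 0`;
that is, the angle in the plane of the first two coordinates is doubled. -/
def angleDouble (m : ℕ) (x : EuclideanSpace ℝ (Fin (m + 2))) : EuclideanSpace ℝ (Fin (m + 2)) :=
  WithLp.toLp 2 (Fin.cons ((x 0 ^ 2 - x 1 ^ 2) / √(x 0 ^ 2 + x 1 ^ 2))
    (Fin.cons (2 * x 0 * x 1 / √(x 0 ^ 2 + x 1 ^ 2)) (fun j : Fin m => x j.succ.succ)))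

theorem norm_angleDouble (m : ℕ) (x : EuclideanSpace ℝ (Fin (m + 2))) :
    ‖angleDouble m x‖ = ‖x‖ := by
  rw [EuclideanSpace.norm_eq, EuclideanSpace.norm_eq]
  congr 1
  simp only [angleDouble, Fin.sum_univ_succ, Real.norm_eq_abs, sq_abs, Fin.cons_zero,
    Fin.cons_succ, Fin.succ_zero_eq_one]
  rw [← add_assoc, ← add_assoc]
  congr 1
  have hr : 0 ≤ x 0 ^ 2 + x 1 ^ 2 := by positivity
  rw [div_pow, div_pow, Real.sq_sqrt hr]
  rcases hr.eq_or_lt with h | h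
  · rw [← h]
    simp
  · field_simp
    ring

theorem continuous_angleDouble (m : ℕ) : Continuous (angleDouble m) := by
  have key : ∀ P : ℝ → ℝ → ℝ, Continuous (fun p : ℝ × ℝ => P p.1 p.2) →
      (∀ a b, |P a b| ≤ a ^ 2 + b ^ 2) →
      Continuous (fun x : EuclideanSpace ℝ (Fin (m + 2)) =>
        P (x 0) (x 1) / √(x 0 ^ 2 + x 1 ^ 2)) := by
    intro P hP hb
    have h0 : Continuous (fun x : EuclideanSpace ℝ (Fin (m + 2)) => x 0) := by fun_prop
    have h1 : Continuous (fun x : EuclideanSpace ℝ (Fin (m + 2)) => x 1) := by fun_prop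
    have hs : Continuous (fun x : EuclideanSpace ℝ (Fin (m + 2)) => √(x 0 ^ 2 + x 1 ^ 2)) := by
      fun_prop
    rw [continuous_iff_continuousAt]
    intro y
    by_cases hy : √(y 0 ^ 2 + y 1 ^ 2) = 0
    · have hle : ∀ x : EuclideanSpace ℝ (Fin (m + 2)),
          ‖P (x 0) (x 1) / √(x 0 ^ 2 + x 1 ^ 2)‖ ≤ √(x 0 ^ 2 + x 1 ^ 2) := by
        intro x
        rw [Real.norm_eq_abs, abs_div, abs_of_nonneg (Real.sqrt_nonneg _)]
        refine div_le_of_le_mul₀ (Real.sqrt_nonneg _) (Real.sqrt_nonneg _) ?_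
        rw [Real.mul_self_sqrt (by positivity)]
        exact hb _ _
      have ht := hs.tendsto y
      rw [hy] at ht
      have h := squeeze_zero_norm hle ht
      rw [ContinuousAt, hy, div_zero]
      exact h
    · exact ((hP.comp (h0.prodMk h1)).continuousAt).div hs.continuousAt hy
  refine (PiLp.continuous_toLp 2 _).comp (continuous_pi fun j => ?_)
  refine Fin.cases ?_ (fun j => Fin.cases ?_ (fun j => ?_) j) j
  · refine key (fun a b => a ^ 2 - b ^ 2) (by fun_prop) fun a b => ?_
    rw [abs_le]
    constructor <;> nlinarith [sq_nonneg a, sq_nonneg b]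
  · refine key (fun a b => 2 * a * b) (by fun_prop) fun a b => ?_
    rw [abs_le]
    constructor <;> nlinarith [sq_nonneg (a + b), sq_nonneg (a - b)]
  · simp only [Fin.cons_succ]
    fun_prop

/-- The standard self-map of degree two of the sphere `S^(m+1)`. -/
def degreeTwo (m : ℕ) : C(sphere (m + 1), sphere (m + 1)) where
  toFun x := ⟨angleDouble m x.1, by
    have h := x.2
    rw [mem_sphere_zero_iff_norm] at h ⊢
    rw [norm_angleDouble, h]⟩
  continuous_toFun :=
    ((continuous_angleDouble m).comp continuous_subtype_val).subtype_mk _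

/-- The mod-2 Moore space `M^(m+2)(2) = S^(m+1) ∪_2 e^(m+2)`: the closed unit ball of `ℝ^(m+2)` is
attached to `S^(m+1)` along the map of degree two on its boundary sphere. -/
def moore (m : ℕ) : PointedSpace where
  carrier := Quot (fun (a b : sphere (m + 1) ⊕
      Metric.closedBall (0 : EuclideanSpace ℝ (Fin (m + 2))) 1) =>
    ∃ x : sphere (m + 1), a = Sum.inr ⟨x.1, Metric.sphere_subset_closedBall x.2⟩ ∧
      b = Sum.inl (degreeTwo m x))
  pt := Quot.mk _ (Sum.inl (sphere (m + 1)).pt)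

/-- The map `(z_1, …, z_{n-1}, z_n) ↦ (z̄_1, …, z̄_{n-1}, -z_n)` of the `n`-torus; on the unit circle
the conjugate is the inverse. -/
def torusInvolution (n : ℕ) (z : Fin n → Circle) : Fin n → Circle :=
  fun j => if (j : ℕ) + 1 = n then -z j else (z j)⁻¹

/-- The `n`-dimensional Klein bottle
`K_n = (S^1)^n / (z_1, …, z_{n-1}, z_n) ∼ (z̄_1, …, z̄_{n-1}, -z_n)`, for `n ≥ 1`. -/
def Klein (n : ℕ) : Type :=
  Quot (fun z w : Fin n → Circle => w = torusInvolution n z)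

instance (n : ℕ) : TopologicalSpace (Klein n) :=
  inferInstanceAs (TopologicalSpace (Quot _))

end HigherKlein

end

open HigherKlein

open Topology Set
open scoped unitInterval

noncomputable section

namespace HigherKlein

/-! ### Quotient maps -/

section Quotient

variable {E X Y Z : Type*} [TopologicalSpace E] [TopologicalSpace X] [TopologicalSpace Y]
  [TopologicalSpace Z] {π : E → X}

/-! Write `n = k + 1` and keep the last circle apart. Setting one of the first `k` coordinates to
`1` commutes with the involution, so a Klein bottle retracts onto a smaller one. More generally,
`Torus.quotient J S` is the Klein bottle on the coordinates in `J`, with all points collapsed at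
which a coordinate in `S` is `1`. For `j ∈ J \ S` it retracts onto `Torus.quotient (J.erase j) S`,
and the quotient by this retract is `Torus.quotient J (insert j S)`. A suspension splits along such
a retract, `ΣX ≃ ΣA ∨ Σ(X/A)` (`FibrewiseRetract.equivalent`). Iteration yields one summand `Σ
(Torus.quotient K K)` for each set `K` of coordinates (`susp_klein`), whence the binomial
coefficients.

To identify a summand with `K ≠ ∅`, the Cayley transform turns the circle without `1` into `ℝ` and
conjugation into negation. Hence `Torus.quotient K K` is the one-point compactification of `(ℝ^K ×
S¹)/±1`, the Thom space of `|K|` copies of the Möbius line bundle over the circle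
(`Torus.quotient_full`). Two copies of that bundle are trivialised by `(w, v) ↦ (w², w v)`, with `v`
complex.

If `|K| = 2b`, the total space is `S¹ × ℂ^b`. Its compactification is a half-smash product of the
circle with a sphere, which splits after one suspension into spheres of dimensions `|K| + 1` and
`|K| + 2`. If `|K| = 2b + 1`, the total space is `ℂ^b × Möbius`, and suspending adds a factor `ℝ`.
The same compactification arises from the Moore space (`moore_onePt`): a contractible half-sphere of
its bottom sphere is collapsed, and what remains of the ball is `ℝ^m × (ℝ × [-1, 1])` with the two
edges of the strip glued by a Möbius twist. The set `K = ∅` contributes the suspension of a circle.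

Spaces are compared, and most maps and homotopies are written, on a space that covers the quotient
in question; the work lies in checking compatibility with the identifications. -/

theorem isQuotientMap_prodMap_id [LocallyCompactSpace Y] (hπ : IsQuotientMap π) :
    IsQuotientMap (Prod.map π (id : Y → Y)) := by
  refine isQuotientMap_iff_isClosed.2 ⟨hπ.surjective.prodMap Function.surjective_id,
    fun s => ⟨fun h => h.preimage (hπ.continuous.prodMap continuous_id), fun h => ?_⟩⟩
  -- Openness is continuity of a map to the Sierpiński space `Prop`, so the lifting property for
  -- products with a locally compact factor applies.
  have : Continuous fun p : X × Y => p ∈ sᶜ :=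
    hπ.continuous_lift_prod_left (continuous_Prop.2 h.isOpen_compl)
  exact isOpen_compl_iff.1 (continuous_Prop.1 this)

/-- The continuous map on the target of a quotient map that is induced by a compatible map on the
source. -/
def descend (hπ : IsQuotientMap π) (F : E → Z) (hF : Continuous F)
    (hc : ∀ e e', π e = π e' → F e = F e') : C(X, Z) where
  toFun x := F (Function.surjInv hπ.surjective x)
  continuous_toFun := hπ.continuous_iff.2 <| by
    convert hF using 1
    ext e
    exact hc _ _ (Function.surjInv_eq hπ.surjective _)

@[simp]
theorem descend_apply (hπ : IsQuotientMap π) (F : E → Z) (hF : Continuous F)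
    (hc : ∀ e e', π e = π e' → F e = F e') (e : E) : descend hπ F hF hc (π e) = F e :=
  hc _ _ (Function.surjInv_eq hπ.surjective _)

/-- The map `Y × X → Z` that is induced by a compatible map `Y × E → Z`. -/
def descendProd [LocallyCompactSpace Y] (hπ : IsQuotientMap π) (F : Y × E → Z) (hF : Continuous F)
    (hc : ∀ e e', π e = π e' → ∀ t, F (t, e) = F (t, e')) : C(Y × X, Z) where
  toFun p := F (p.1, Function.surjInv hπ.surjective p.2)
  continuous_toFun := hπ.continuous_lift_prod_right <| by
    convert hF using 1
    ext p
    exact hc _ _ (Function.surjInv_eq hπ.surjective _) _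

@[simp]
theorem descendProd_apply [LocallyCompactSpace Y] (hπ : IsQuotientMap π) (F : Y × E → Z)
    (hF : Continuous F) (hc : ∀ e e', π e = π e' → ∀ t, F (t, e) = F (t, e')) (t : Y) (e : E) :
    descendProd hπ F hF hc (t, π e) = F (t, e) :=
  hc _ _ (Function.surjInv_eq hπ.surjective _) _

/-- Since `I` is locally compact, `I × E → I × X` is again a quotient map, so a homotopy may be
written on `E`. -/
theorem homotopicRel_of_cover (hπ : IsQuotientMap π) {f g : C(X, Z)} {e₀ : E} {x₀ : X}
    (hx₀ : π e₀ = x₀) (H : I × E → Z) (hH : Continuous H)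
    (hc : ∀ e e', π e = π e' → ∀ t, H (t, e) = H (t, e'))
    (h0 : ∀ e, H (0, e) = f (π e)) (h1 : ∀ e, H (1, e) = g (π e))
    (hb : ∀ t, H (t, e₀) = f x₀) : f.HomotopicRel g {x₀} := by
  refine ⟨⟨⟨descendProd hπ H hH hc, ?_, ?_⟩, ?_⟩⟩
  · intro x
    obtain ⟨e, rfl⟩ := hπ.surjective x
    exact (descendProd_apply ..).trans (h0 e)
  · intro x
    obtain ⟨e, rfl⟩ := hπ.surjective x
    exact (descendProd_apply ..).trans (h1 e)
  · rintro t _ rfl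
    subst hx₀
    exact (descendProd_apply hπ H hH hc t e₀).trans (hb t)

theorem homotopicRel_of_homotopy {f g : C(X, Z)} {x₀ : X} (H : I × X → Z) (hH : Continuous H)
    (h0 : ∀ e, H (0, e) = f e) (h1 : ∀ e, H (1, e) = g e)
    (hb : ∀ t, H (t, x₀) = f x₀) : f.HomotopicRel g {x₀} :=
  homotopicRel_of_cover IsQuotientMap.id rfl H hH (fun _ _ h t => congrArg (fun e => H (t, e)) h)
    h0 h1 hb

end Quotient

/-! ### Pointed homotopy equivalences -/

namespace PointedHomotopyEquivalent

variable {X Y Z : PointedSpace}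

theorem refl (X : PointedSpace) : PointedHomotopyEquivalent X X :=
  ⟨ContinuousMap.id X, ContinuousMap.id X, rfl, rfl, .refl _, .refl _⟩

theorem symm (h : PointedHomotopyEquivalent X Y) : PointedHomotopyEquivalent Y X := by
  obtain ⟨f, g, hf, hg, h1, h2⟩ := h
  exact ⟨g, f, hg, hf, h2, h1⟩

/-- The inner round trip is contracted first, by whiskering its homotopy with `f` and `g`. -/
theorem comp_aux {f : C(X, Y)} {g : C(Y, X)} {f' : C(Y, Z)} {g' : C(Z, Y)} (hf : f X.pt = Y.pt)
    (h1 : (g.comp f).HomotopicRel (ContinuousMap.id X) {X.pt})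
    (h2 : (g'.comp f').HomotopicRel (ContinuousMap.id Y) {Y.pt}) :
    ((g.comp g').comp (f'.comp f)).HomotopicRel (ContinuousMap.id X) {X.pt} := by
  refine ContinuousMap.HomotopicRel.trans (g := g.comp f) ?_ h1
  obtain ⟨F⟩ := h2
  refine homotopicRel_of_homotopy (fun p => g (F (p.1, f p.2))) (by fun_prop) ?_ ?_ ?_
  · intro e
    simp
  · intro e
    simp
  · intro t
    rw [F.eq_fst t (by simp [hf])]
    simp

theorem trans (h : PointedHomotopyEquivalent X Y) (h' : PointedHomotopyEquivalent Y Z) :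
    PointedHomotopyEquivalent X Z := by
  obtain ⟨f, g, hf, hg, h1, h2⟩ := h
  obtain ⟨f', g', hf', hg', h1', h2'⟩ := h'
  exact ⟨f'.comp f, g.comp g', by simp [hf, hf'], by simp [hg, hg'], comp_aux hf h1 h1',
    comp_aux hg' h2' h2⟩

theorem of_inverse (f : C(X, Y)) (g : C(Y, X)) (hf : f X.pt = Y.pt) (h1 : ∀ x, g (f x) = x)
    (h2 : ∀ y, f (g y) = y) : PointedHomotopyEquivalent X Y := by
  refine ⟨f, g, hf, by rw [← hf, h1], ?_, ?_⟩
  · convert ContinuousMap.HomotopicRel.refl _ using 1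
    ext x
    simp [h1]
  · convert ContinuousMap.HomotopicRel.refl _ using 1
    ext x
    simp [h2]

/-- Two quotients of the same space by the same relation are equivalent. -/
theorem of_covers {E : Type*} [TopologicalSpace E] {π : E → X} {ρ : E → Y}
    (hπ : IsQuotientMap π) (hρ : IsQuotientMap ρ) (h : ∀ e e', π e = π e' ↔ ρ e = ρ e') {e₀ : E}
    (hX : π e₀ = X.pt) (hY : ρ e₀ = Y.pt) : PointedHomotopyEquivalent X Y := by
  refine of_inverse (descend hπ ρ hρ.continuous fun e e' => (h e e').1)
    (descend hρ π hπ.continuous fun e e' => (h e e').2) ?_ ?_ ?_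
  · rw [← hX, descend_apply, hY]
  · intro x
    obtain ⟨e, rfl⟩ := hπ.surjective x
    simp
  · intro x
    obtain ⟨e, rfl⟩ := hρ.surjective x
    simp

/-- Two compact quotients that are separated by maps with the same image in a Hausdorff space are
equivalent. -/
theorem of_same_range {C D Z : Type*} [TopologicalSpace C] [TopologicalSpace D]
    [TopologicalSpace Z] [CompactSpace C] [CompactSpace D] [T2Space Z] {π : C → X} {ρ : D → Y}
    (hπ : IsQuotientMap π) (hρ : IsQuotientMap ρ) {F : C → Z} {G : D → Z} (hF : Continuous F)
    (hG : Continuous G) (hπF : ∀ e e', π e = π e' ↔ F e = F e')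
    (hρG : ∀ e e', ρ e = ρ e' ↔ G e = G e') (hr : range F = range G) {c : C} {d : D}
    (hc : π c = X.pt) (hd : ρ d = Y.pt) (hcd : F c = G d) : PointedHomotopyEquivalent X Y := by
  -- A continuous surjection from a compact space onto a Hausdorff space is a quotient map. Both `X`
  -- and `Y` are therefore homeomorphic to the common range.
  have hu : IsQuotientMap fun c => (⟨F c, hr ▸ mem_range_self c⟩ : range G) := by
    refine Topology.IsQuotientMap.of_surjective_continuous ?_ (by fun_prop)
    rintro ⟨z, hz⟩
    obtain ⟨c, rfl⟩ := hr.symm ▸ hz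
    exact ⟨c, rfl⟩
  have hv : IsQuotientMap fun d => (⟨G d, mem_range_self d⟩ : range G) :=
    Topology.IsQuotientMap.of_surjective_continuous
      (fun ⟨z, hz⟩ => by obtain ⟨d, rfl⟩ := hz; exact ⟨d, rfl⟩) (by fun_prop)
  have hx : ∃ x : C(X, range G), ∃ x' : C(range G, X), (∀ z, x (x' z) = z) ∧
      (∀ z, x' (x z) = z) ∧ x (π c) = ⟨F c, hr ▸ mem_range_self c⟩ := by
    refine ⟨descend hπ _ hu.continuous ?_, descend hu π hπ.continuous ?_, ?_, ?_, ?_⟩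
    · intro e e' h
      simpa using (hπF e e').1 h
    · intro e e' h
      exact (hπF e e').2 (by simpa using h)
    · intro z
      obtain ⟨e, rfl⟩ := hu.surjective z
      rw [descend_apply hu, descend_apply hπ]
    · intro z
      obtain ⟨e, rfl⟩ := hπ.surjective z
      rw [descend_apply hπ, descend_apply hu]
    · rw [descend_apply]
  have hy : ∃ x : C(Y, range G), ∃ x' : C(range G, Y), (∀ z, x (x' z) = z) ∧
      (∀ z, x' (x z) = z) ∧ x (ρ d) = ⟨G d, mem_range_self d⟩ := by
    refine ⟨descend hρ _ hv.continuous ?_, descend hv ρ hρ.continuous ?_, ?_, ?_, ?_⟩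
    · intro e e' h
      simpa using (hρG e e').1 h
    · intro e e' h
      exact (hρG e e').2 (by simpa using h)
    · intro z
      obtain ⟨e, rfl⟩ := hv.surjective z
      rw [descend_apply hv, descend_apply hρ]
    · intro z
      obtain ⟨e, rfl⟩ := hρ.surjective z
      rw [descend_apply hρ, descend_apply hv]
    · rw [descend_apply]
  obtain ⟨x, x', h1, h2, h3⟩ := hx
  obtain ⟨y, y', h1', h2', h3'⟩ := hy
  refine of_inverse (y'.comp x) (x'.comp y) ?_ ?_ ?_
  · rw [← hc, ← hd, ContinuousMap.comp_apply, h3, ← h2' (ρ d), h3']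
    simp only [hcd]
  · intro z
    simp [h1', h2]
  · intro z
    simp [h1, h2']

end PointedHomotopyEquivalent

/-! ### Collapsing a subset -/

section Collapse

variable {X : Type} [TopologicalSpace X] {A : Set X} {a : X}

/-- The quotient map `X → X / A`. -/
def collapseMk (A : Set X) (a : X) : C(X, collapse A a) where
  toFun := Quotient.mk (collapseSetoid A)
  continuous_toFun := continuous_quotient_mk'

theorem isQuotientMap_collapseMk : IsQuotientMap (collapseMk A a) := isQuotientMap_quotient_mk'

theorem collapseMk_eq_iff {x y : X} :
    collapseMk A a x = collapseMk A a y ↔ x = y ∨ (x ∈ A ∧ y ∈ A) := Quotient.eq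

theorem collapseMk_eq_pt (ha : a ∈ A) {x : X} (hx : x ∈ A) :
    collapseMk A a x = (collapse A a).pt := collapseMk_eq_iff.2 (Or.inr ⟨hx, ha⟩)

/-- The map from `X / A` that is induced by a map from `X` that is constant on `A`. -/
def collapseLift {Z : Type*} [TopologicalSpace Z] (f : C(X, Z)) (z : Z) (hf : ∀ x ∈ A, f x = z) :
    C(collapse A a, Z) :=
  descend isQuotientMap_collapseMk f f.continuous fun e e' h => by
    rcases collapseMk_eq_iff.1 h with rfl | h
    · rfl
    · rw [hf _ h.1, hf _ h.2]

@[simp]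
theorem collapseLift_mk {Z : Type*} [TopologicalSpace Z] (f : C(X, Z)) (z : Z)
    (hf : ∀ x ∈ A, f x = z) (x : X) : collapseLift (a := a) f z hf (collapseMk A a x) = f x :=
  descend_apply ..

/-- A subspace that contracts to the basepoint inside itself by a homotopy of the whole space may
be collapsed. -/
theorem PointedHomotopyEquivalent.collapse_of_homotopy (X : PointedSpace) (A : Set X)
    (H : I × X → X) (hH : Continuous H) (h0 : ∀ x, H (0, x) = x)
    (hHA : ∀ t, ∀ x ∈ A, H (t, x) ∈ A) (h1 : ∀ x ∈ A, H (1, x) = X.pt)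
    (hpt : ∀ t, H (t, X.pt) = X.pt) : PointedHomotopyEquivalent X (collapse A X.pt) := by
  -- The inverse is the end map of `H`, which is constant on `A`. The homotopy `H` serves both round
  -- trips, because it preserves `A` and so descends to the quotient.
  refine ⟨collapseMk A X.pt, collapseLift ⟨fun x => H (1, x), by fun_prop⟩ X.pt h1, rfl, ?_, ?_,
    ?_⟩
  · exact (collapseLift_mk _ _ h1 _).trans (hpt 1)
  · refine ContinuousMap.HomotopicRel.symm ?_
    refine homotopicRel_of_homotopy H hH h0 (fun e => ?_) hpt
    exact (collapseLift_mk (a := X.pt) ⟨fun x => H (1, x), by fun_prop⟩ X.pt h1 e).symm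
  · refine ContinuousMap.HomotopicRel.symm ?_
    refine homotopicRel_of_cover (isQuotientMap_collapseMk) (e₀ := X.pt) rfl
      (fun p => collapseMk A X.pt (H p)) (by fun_prop) ?_ ?_ ?_ ?_
    · intro e e' h t
      rcases collapseMk_eq_iff.1 h with rfl | h
      · rfl
      · exact collapseMk_eq_iff.2 (Or.inr ⟨hHA _ _ h.1, hHA _ _ h.2⟩)
    · intro e
      simp [h0]
    · intro e
      simp
    · intro t
      simp [hpt]
      rfl

end Collapse

/-! ### Reduced suspensions -/

section Suspension

variable {X Y : PointedSpace}

/-- The point of the reduced suspension at height `s` over `x`; heights outside `[0, 1]` give the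
basepoint. -/
def suspPoint (X : PointedSpace) : C(X × ℝ, reducedSuspension X) :=
  (collapseMk {p : X × I | p.2 = 0 ∨ p.2 = 1 ∨ p.1 = X.pt} (X.pt, 0)).comp
    ⟨fun p : X × ℝ => (p.1, projIcc 0 1 zero_le_one p.2), by fun_prop⟩

theorem suspPoint_eq_pt {x : X} {s : ℝ} (h : s ≤ 0 ∨ 1 ≤ s ∨ x = X.pt) :
    suspPoint X (x, s) = (reducedSuspension X).pt := by
  refine collapseMk_eq_pt (by simp) ?_
  rcases h with h | h | h
  · exact Or.inl (projIcc_of_le_left zero_le_one h)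
  · exact Or.inr (Or.inl (projIcc_of_right_le zero_le_one h))
  · exact Or.inr (Or.inr h)

theorem suspPoint_coe (x : X) (s : I) :
    suspPoint X (x, s) = collapseMk {p : X × I | p.2 = 0 ∨ p.2 = 1 ∨ p.1 = X.pt} (X.pt, 0) (x, s) :=
  congrArg (fun s => collapseMk _ _ (x, s)) (projIcc_val zero_le_one s)

theorem suspPoint_eq_iff {x y : X} {s t : I} :
    suspPoint X (x, s) = suspPoint X (y, t) ↔ (x = y ∧ s = t) ∨
      ((s = 0 ∨ s = 1 ∨ x = X.pt) ∧ (t = 0 ∨ t = 1 ∨ y = X.pt)) := by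
  have h := collapseMk_eq_iff (A := {p : X × I | p.2 = 0 ∨ p.2 = 1 ∨ p.1 = X.pt})
    (a := (X.pt, 0)) (x := (x, s)) (y := (y, t))
  rw [Prod.mk.injEq] at h
  exact ⟨fun e => h.1 ((suspPoint_coe x s).symm.trans (e.trans (suspPoint_coe y t))),
    fun e => (suspPoint_coe x s).trans ((h.2 e).trans (suspPoint_coe y t).symm)⟩

theorem isQuotientMap_suspPoint {E : Type*} [TopologicalSpace E] {π : E → X}
    (hπ : IsQuotientMap π) : IsQuotientMap fun p : E × I => suspPoint X (π p.1, p.2) := by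
  have := (isQuotientMap_collapseMk (A := {p : X × I | p.2 = 0 ∨ p.2 = 1 ∨ p.1 = X.pt})
    (a := (X.pt, 0))).comp (isQuotientMap_prodMap_id (Y := I) hπ)
  have he : (fun p : E × I => suspPoint X (π p.1, p.2)) = collapseMk _ _ ∘ Prod.map π id :=
    funext fun p => suspPoint_coe _ _
  rw [he]
  exact this

theorem suspPoint_base (X : PointedSpace) (s : ℝ) :
    suspPoint X (X.pt, s) = (reducedSuspension X).pt := suspPoint_eq_pt (by simp)

/-- The map induced from the suspension by a map on `E × [0, 1]`, where `E` covers `X`. -/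
def suspLift {E Z : Type*} [TopologicalSpace E] [TopologicalSpace Z] {π : E → X}
    (hπ : IsQuotientMap π) (z : Z) (F : E × I → Z) (hF : Continuous F)
    (hc : ∀ e e', π e = π e' → ∀ s, F (e, s) = F (e', s)) (h0 : ∀ e, F (e, 0) = z)
    (h1 : ∀ e, F (e, 1) = z) (hpt : ∀ e, π e = X.pt → ∀ s, F (e, s) = z) :
    C(reducedSuspension X, Z) :=
  descend (isQuotientMap_suspPoint hπ) F hF <| by
    have key : ∀ e s, (s = 0 ∨ s = 1 ∨ π e = X.pt) → F (e, s) = z := by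
      rintro e s (rfl | rfl | h)
      exacts [h0 e, h1 e, hpt e h s]
    rintro ⟨e, s⟩ ⟨e', s'⟩ h
    rcases suspPoint_eq_iff.1 h with ⟨h, h'⟩ | ⟨h, h'⟩
    · dsimp at h'
      subst h'
      exact hc _ _ h _
    · exact (key _ _ h).trans (key _ _ h').symm

@[simp]
theorem suspLift_apply {E Z : Type*} [TopologicalSpace E] [TopologicalSpace Z] {π : E → X}
    (hπ : IsQuotientMap π) (z : Z) (F : E × I → Z) (hF : Continuous F)
    (hc : ∀ e e', π e = π e' → ∀ s, F (e, s) = F (e', s)) (h0 : ∀ e, F (e, 0) = z)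
    (h1 : ∀ e, F (e, 1) = z) (hpt : ∀ e, π e = X.pt → ∀ s, F (e, s) = z) (e : E) (s : I) :
    suspLift hπ z F hF hc h0 h1 hpt (suspPoint X (π e, s)) = F (e, s) :=
  descend_apply (isQuotientMap_suspPoint hπ) F hF _ (e, s)

theorem homotopicRel_of_susp {E Z : Type*} [TopologicalSpace E] [TopologicalSpace Z] {π : E → X}
    (hπ : IsQuotientMap π) {f g : C(reducedSuspension X, Z)} {z : Z}
    (hz : f (reducedSuspension X).pt = z) (H : I × E × I → Z) (hH : Continuous H)
    (hc : ∀ e e', π e = π e' → ∀ t s, H (t, e, s) = H (t, e', s)) (h0 : ∀ t e, H (t, e, 0) = z)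
    (h1 : ∀ t e, H (t, e, 1) = z) (hpt : ∀ e, π e = X.pt → ∀ t s, H (t, e, s) = z)
    (hf : ∀ e s, H (0, e, s) = f (suspPoint X (π e, s)))
    (hg : ∀ e s, H (1, e, s) = g (suspPoint X (π e, s))) :
    f.HomotopicRel g {(reducedSuspension X).pt} := by
  have key : ∀ t e s, (s = 0 ∨ s = 1 ∨ π e = X.pt) → H (t, e, s) = z := by
    rintro t e s (rfl | rfl | h)
    exacts [h0 t e, h1 t e, hpt e h t s]
  obtain ⟨e₀, he₀⟩ := hπ.surjective X.pt
  refine homotopicRel_of_cover (isQuotientMap_suspPoint hπ) (e₀ := (e₀, 0)) (by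
    simp only [he₀]
    exact suspPoint_base X _) H hH ?_ (fun e => hf _ _)
    (fun e => hg _ _) fun t => (h0 t e₀).trans hz.symm
  rintro ⟨e, s⟩ ⟨e', s'⟩ h t
  rcases suspPoint_eq_iff.1 h with ⟨h, h'⟩ | ⟨h, h'⟩
  · dsimp at h'
    subst h'
    exact hc _ _ h _ _
  · exact (key _ _ _ h).trans (key _ _ _ h').symm

/-- The suspension of a pointed map. -/
def suspMap (f : C(X, Y)) (hf : f X.pt = Y.pt) : C(reducedSuspension X, reducedSuspension Y) :=
  suspLift IsQuotientMap.id (reducedSuspension Y).pt (fun p => suspPoint Y (f p.1, p.2))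
    (by fun_prop) (fun e e' h s => by rw [show e = e' from h])
    (fun e => suspPoint_eq_pt (by simp)) (fun e => suspPoint_eq_pt (by simp))
    (fun e h s => by
      rw [show e = X.pt from h, hf]
      exact suspPoint_base _ _)

theorem suspPoint_projIcc (x : X) (s : ℝ) :
    suspPoint X (x, (projIcc 0 1 zero_le_one s : I)) = suspPoint X (x, s) := by
  rw [suspPoint_coe]
  rfl

@[simp]
theorem suspMap_apply (f : C(X, Y)) (hf : f X.pt = Y.pt) (x : X) (s : ℝ) :
    suspMap f hf (suspPoint X (x, s)) = suspPoint Y (f x, s) := by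
  rw [← suspPoint_projIcc]
  exact (suspLift_apply (X := X) IsQuotientMap.id _ _ _ _ _ _ _ x _).trans (suspPoint_projIcc _ _)

theorem suspMap_pt (f : C(X, Y)) (hf : f X.pt = Y.pt) :
    suspMap f hf (reducedSuspension X).pt = (reducedSuspension Y).pt := by
  rw [← suspPoint_base X 0, suspMap_apply, hf, suspPoint_base]

theorem suspMap_homotopicRel {f : C(X, Y)} {g : C(Y, X)} (hf : f X.pt = Y.pt) (hg : g Y.pt = X.pt)
    (h : (g.comp f).HomotopicRel (ContinuousMap.id X) {X.pt}) :
    ((suspMap g hg).comp (suspMap f hf)).HomotopicRel (ContinuousMap.id _)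
      {(reducedSuspension X).pt} := by
  obtain ⟨F⟩ := h
  refine homotopicRel_of_susp IsQuotientMap.id
    (z := (reducedSuspension X).pt) (by simp [suspMap_pt])
    (fun p => suspPoint X (F (p.1, p.2.1), p.2.2)) (by fun_prop) ?_ ?_ ?_ ?_ ?_ ?_
  · rintro e _ rfl t s
    rfl
  · intro t e
    exact suspPoint_eq_pt (by simp)
  · intro t e
    exact suspPoint_eq_pt (by simp)
  · rintro e h t s
    refine suspPoint_eq_pt (Or.inr (Or.inr ?_))
    rw [show e = X.pt from h]
    exact (F.eq_snd t rfl).trans rfl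
  · intro e s
    simp
  · intro e s
    simp

theorem PointedHomotopyEquivalent.susp (h : PointedHomotopyEquivalent X Y) :
    PointedHomotopyEquivalent (reducedSuspension X) (reducedSuspension Y) := by
  obtain ⟨f, g, hf, hg, h1, h2⟩ := h
  exact ⟨suspMap f hf, suspMap g hg, suspMap_pt f hf, suspMap_pt g hg,
    suspMap_homotopicRel hf hg h1, suspMap_homotopicRel hg hf h2⟩

end Suspension

/-! ### Wedges -/

section Wedge

variable {X Y X' Y' Z : PointedSpace}

/-- The inclusion of the first summand. -/
def wedgeInl (X Y : PointedSpace) : C(X, wedge X Y) :=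
  (collapseMk {Sum.inl X.pt, Sum.inr Y.pt} (Sum.inl X.pt)).comp ⟨Sum.inl, continuous_inl⟩

/-- The inclusion of the second summand. -/
def wedgeInr (X Y : PointedSpace) : C(Y, wedge X Y) :=
  (collapseMk {Sum.inl X.pt, Sum.inr Y.pt} (Sum.inl X.pt)).comp ⟨Sum.inr, continuous_inr⟩

theorem wedgeInl_pt : wedgeInl X Y X.pt = (wedge X Y).pt := rfl

theorem wedgeInr_pt : wedgeInr X Y Y.pt = (wedge X Y).pt :=
  collapseMk_eq_pt (by simp) (by simp)

theorem wedge_cases {p : wedge X Y → Prop} (hl : ∀ x, p (wedgeInl X Y x))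
    (hr : ∀ y, p (wedgeInr X Y y)) (w : wedge X Y) : p w := by
  obtain ⟨x | y, rfl⟩ := (isQuotientMap_collapseMk
    (A := ({Sum.inl X.pt, Sum.inr Y.pt} : Set (X ⊕ Y)))).surjective w
  exacts [hl x, hr y]

/-- The map out of a wedge that is given by pointed maps on the summands. -/
def wedgeLift {Z : Type*} [TopologicalSpace Z] (f : C(X, Z)) (g : C(Y, Z))
    (h : f X.pt = g Y.pt) : C(wedge X Y, Z) :=
  collapseLift ⟨Sum.elim f g, by fun_prop⟩ (f X.pt) (by simp [h])

@[simp]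
theorem wedgeLift_inl {Z : Type*} [TopologicalSpace Z] (f : C(X, Z)) (g : C(Y, Z))
    (h : f X.pt = g Y.pt) (x : X) : wedgeLift f g h (wedgeInl X Y x) = f x :=
  collapseLift_mk ..

@[simp]
theorem wedgeLift_inr {Z : Type*} [TopologicalSpace Z] (f : C(X, Z)) (g : C(Y, Z))
    (h : f X.pt = g Y.pt) (y : Y) : wedgeLift f g h (wedgeInr X Y y) = g y :=
  collapseLift_mk ..

@[simp]
theorem wedgeLift_pt {Z : Type*} [TopologicalSpace Z] (f : C(X, Z)) (g : C(Y, Z))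
    (h : f X.pt = g Y.pt) : wedgeLift f g h (wedge X Y).pt = f X.pt := by
  rw [← wedgeInl_pt, wedgeLift_inl]

theorem wedge_homotopicRel {Z : Type*} [TopologicalSpace Z] {f g : C(wedge X Y, Z)}
    (hl : (f.comp (wedgeInl X Y)).HomotopicRel (g.comp (wedgeInl X Y)) {X.pt})
    (hr : (f.comp (wedgeInr X Y)).HomotopicRel (g.comp (wedgeInr X Y)) {Y.pt}) :
    f.HomotopicRel g {(wedge X Y).pt} := by
  obtain ⟨F⟩ := hl
  obtain ⟨G⟩ := hr
  -- Curried into maps to the path space, the two homotopies glue over the disjoint union without a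
  -- product with `I` in the source.
  let F' : C(X, C(I, Z)) := ContinuousMap.curry ⟨fun p : X × I => F (p.2, p.1), by fun_prop⟩
  let G' : C(Y, C(I, Z)) := ContinuousMap.curry ⟨fun p : Y × I => G (p.2, p.1), by fun_prop⟩
  have hK : Continuous (Sum.elim F' G') := by fun_prop
  have hF : ∀ t, F (t, X.pt) = f (wedge X Y).pt := fun t => F.eq_fst t rfl
  have hG : ∀ t, G (t, Y.pt) = f (wedge X Y).pt := fun t =>
    (G.eq_fst t rfl).trans (congrArg f wedgeInr_pt)
  have hb : ∀ e ∈ ({Sum.inl X.pt, Sum.inr Y.pt} : Set (X ⊕ Y)), ∀ t,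
      Sum.elim F' G' e t = f (wedge X Y).pt := by
    rintro e (rfl | rfl) t
    exacts [hF t, hG t]
  refine homotopicRel_of_cover (isQuotientMap_collapseMk) (e₀ := Sum.inl X.pt) rfl
    (fun p => Sum.elim F' G' p.2 p.1) (by fun_prop) ?_ ?_ ?_ (fun t => hb _ (by simp) _)
  · intro e e' h t
    rcases collapseMk_eq_iff.1 h with rfl | h
    · rfl
    · exact (hb _ h.1 t).trans (hb _ h.2 t).symm
  · rintro (x | y)
    exacts [F.apply_zero x, G.apply_zero y]
  · rintro (x | y)
    exacts [F.apply_one x, G.apply_one y]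

theorem PointedHomotopyEquivalent.wedge (h : PointedHomotopyEquivalent X X')
    (h' : PointedHomotopyEquivalent Y Y') :
    PointedHomotopyEquivalent (wedge X Y) (wedge X' Y') := by
  have key : ∀ {X Y X' Y' : PointedSpace} {f : C(X, X')} {g : C(X', X)} {f' : C(Y, Y')}
      {g' : C(Y', Y)} (hf : f X.pt = X'.pt) (hg : g X'.pt = X.pt) (hf' : f' Y.pt = Y'.pt)
      (hg' : g' Y'.pt = Y.pt)
      (_ : (g.comp f).HomotopicRel (ContinuousMap.id X) {X.pt})
      (_ : (g'.comp f').HomotopicRel (ContinuousMap.id Y) {Y.pt}),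
      ((wedgeLift ((wedgeInl X Y).comp g) ((wedgeInr X Y).comp g')
        (by simp [hg, hg', wedgeInl_pt, wedgeInr_pt])).comp
      (wedgeLift ((wedgeInl X' Y').comp f) ((wedgeInr X' Y').comp f')
        (by simp [hf, hf', wedgeInl_pt, wedgeInr_pt]))).HomotopicRel
        (ContinuousMap.id _) {(HigherKlein.wedge X Y).pt} := by
    intro X Y X' Y' f g f' g' hf hg hf' hg' h h'
    refine wedge_homotopicRel ?_ ?_
    · convert h.comp_continuousMap (wedgeInl X Y) using 1
      · ext x
        simp
      · rfl
    · convert h'.comp_continuousMap (wedgeInr X Y) using 1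
      · ext x
        simp
      · rfl
  obtain ⟨f, g, hf, hg, h1, h2⟩ := h
  obtain ⟨f', g', hf', hg', h1', h2'⟩ := h'
  refine ⟨_, _, ?_, ?_, key hf hg hf' hg' h1 h1', key hg hf hg' hf' h2 h2'⟩
  · simp [hf, wedgeInl_pt]
  · simp [hg, wedgeInl_pt]

end Wedge

/-! ### Wedges of families -/

section BigWedge

variable {ι κ : Type} {X : ι → PointedSpace} {Y : κ → PointedSpace}

/-- The quotient map from the disjoint union onto the wedge. -/
def bigWedgeMk (X : ι → PointedSpace) : C(Unit ⊕ (Σ i, X i), bigWedge X) :=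
  collapseMk ({Sum.inl ()} ∪ range (fun i => Sum.inr ⟨i, (X i).pt⟩) : Set (Unit ⊕ (Σ i, X i)))
    (Sum.inl ())

/-- The inclusion of a summand. -/
def bigWedgeIn (X : ι → PointedSpace) (i : ι) : C(X i, bigWedge X) :=
  (bigWedgeMk X).comp ⟨fun x => Sum.inr ⟨i, x⟩, continuous_inr.comp continuous_sigmaMk⟩

theorem bigWedgeIn_pt (i : ι) : bigWedgeIn X i (X i).pt = (bigWedge X).pt :=
  collapseMk_eq_pt (by simp) (by simp)

theorem bigWedge_cases {p : bigWedge X → Prop} (h0 : p (bigWedge X).pt)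
    (h : ∀ i x, p (bigWedgeIn X i x)) (w : bigWedge X) : p w := by
  obtain ⟨x | ⟨i, x⟩, rfl⟩ := (isQuotientMap_collapseMk
    (A := ({Sum.inl ()} ∪ range (fun i => Sum.inr ⟨i, (X i).pt⟩) :
      Set (Unit ⊕ (Σ i, X i)))) (a := Sum.inl ())).surjective w
  exacts [h0, h i x]

/-- The map out of a wedge that is given by pointed maps on the summands. -/
def bigWedgeLift {Z : Type*} [TopologicalSpace Z] (z : Z) (f : ∀ i, C(X i, Z))
    (h : ∀ i, f i (X i).pt = z) : C(bigWedge X, Z) :=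
  collapseLift ⟨Sum.elim (fun _ => z) (fun p => f p.1 p.2), by
    exact continuous_const.sumElim (continuous_sigma fun i => (f i).continuous)⟩ z (by
    rintro _ (rfl | ⟨i, rfl⟩)
    exacts [rfl, h i])

@[simp]
theorem bigWedgeLift_in {Z : Type*} [TopologicalSpace Z] (z : Z) (f : ∀ i, C(X i, Z))
    (h : ∀ i, f i (X i).pt = z) (i : ι) (x : X i) :
    bigWedgeLift z f h (bigWedgeIn X i x) = f i x :=
  collapseLift_mk ..

@[simp]
theorem bigWedgeLift_pt {Z : Type*} [TopologicalSpace Z] (z : Z) (f : ∀ i, C(X i, Z))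
    (h : ∀ i, f i (X i).pt = z) : bigWedgeLift z f h (bigWedge X).pt = z :=
  collapseLift_mk ..

theorem bigWedge_homotopicRel {Z : Type*} [TopologicalSpace Z] {f g : C(bigWedge X, Z)}
    (hpt : f (bigWedge X).pt = g (bigWedge X).pt)
    (h : ∀ i, (f.comp (bigWedgeIn X i)).HomotopicRel (g.comp (bigWedgeIn X i)) {(X i).pt}) :
    f.HomotopicRel g {(bigWedge X).pt} := by
  let F := fun i => (h i).some
  let F' : ∀ i, C(X i, C(I, Z)) := fun i =>
    ContinuousMap.curry ⟨fun p : X i × I => F i (p.2, p.1), by fun_prop⟩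
  let K : (Unit ⊕ Σ i, X i) → C(I, Z) :=
    Sum.elim (fun _ => ContinuousMap.const I (f (bigWedge X).pt)) (fun p => F' p.1 p.2)
  have hK : Continuous K := by
    exact continuous_const.sumElim (continuous_sigma fun i => (F' i).continuous)
  have hb : ∀ e ∈ ({Sum.inl ()} ∪ range (fun i => Sum.inr ⟨i, (X i).pt⟩) :
      Set (Unit ⊕ (Σ i, X i))), ∀ t, K e t = f (bigWedge X).pt := by
    rintro e (rfl | ⟨i, rfl⟩) t
    · rfl
    · exact ((F i).eq_fst t rfl).trans (congrArg f (bigWedgeIn_pt i))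
  refine homotopicRel_of_cover (isQuotientMap_collapseMk) (e₀ := Sum.inl ()) rfl
    (fun p => K p.2 p.1) (by fun_prop) ?_ ?_ ?_ (fun t => hb _ (by simp) _)
  · intro e e' h t
    rcases collapseMk_eq_iff.1 h with rfl | h
    · rfl
    · exact (hb _ h.1 t).trans (hb _ h.2 t).symm
  · rintro (_ | ⟨i, x⟩)
    exacts [rfl, (F i).apply_zero x]
  · rintro (_ | ⟨i, x⟩)
    exacts [hpt, (F i).apply_one x]

namespace PointedHomotopyEquivalent

theorem bigWedge_congr {X' : ι → PointedSpace} (h : ∀ i, PointedHomotopyEquivalent (X i) (X' i)) :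
    PointedHomotopyEquivalent (bigWedge X) (bigWedge X') := by
  have key : ∀ {X X' : ι → PointedSpace} (f : ∀ i, C(X i, X' i)) (g : ∀ i, C(X' i, X i))
      (hf : ∀ i, f i (X i).pt = (X' i).pt) (hg : ∀ i, g i (X' i).pt = (X i).pt)
      (_ : ∀ i, ((g i).comp (f i)).HomotopicRel (ContinuousMap.id (X i)) {(X i).pt}),
      ((bigWedgeLift (bigWedge X).pt (fun i => (bigWedgeIn X i).comp (g i))
          (fun i => by simp [hg, bigWedgeIn_pt])).comp
        (bigWedgeLift (bigWedge X').pt (fun i => (bigWedgeIn X' i).comp (f i))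
          (fun i => by simp [hf, bigWedgeIn_pt]))).HomotopicRel
        (ContinuousMap.id _) {(bigWedge X).pt} := by
    intro X X' f g hf hg h
    refine bigWedge_homotopicRel (by simp) fun i => ?_
    convert (h i).comp_continuousMap (bigWedgeIn X i) using 1
    · ext x
      simp
    · rfl
  choose f g hf hg h1 h2 using h
  refine ⟨_, _, ?_, ?_, key f g hf hg h1, key g f hg hf h2⟩
  · simp
  · simp

theorem bigWedge_reindex (e : ι ≃ κ) :
    PointedHomotopyEquivalent (bigWedge fun i => Y (e i)) (bigWedge Y) := by
  -- The inverse has to transport from `Y j` to `Y (e (e.symm j))`, along an equality of indices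
  -- that need not hold by definition.
  have hcast : ∀ {i j : κ} (h : i = j), Continuous (fun y : Y i => h ▸ y : Y i → Y j) := by
    rintro i _ rfl
    exact continuous_id
  have hpt : ∀ {i j : κ} (h : i = j), (h ▸ (Y i).pt : Y j) = (Y j).pt := by
    rintro i _ rfl
    rfl
  refine of_inverse
    (bigWedgeLift (bigWedge Y).pt (fun i => bigWedgeIn Y (e i)) (fun i => bigWedgeIn_pt _))
    (bigWedgeLift (bigWedge _).pt (fun j => (bigWedgeIn (fun i => Y (e i)) (e.symm j)).comp
      ⟨fun y => (e.apply_symm_apply j).symm ▸ y, hcast _⟩) (fun j => ?_)) ?_ ?_ ?_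
  · simp [hpt, bigWedgeIn_pt (X := fun i => Y (e i))]
  · simp
  · refine bigWedge_cases (by simp) fun i x => ?_
    simp only [bigWedgeLift_in, ContinuousMap.comp_apply, ContinuousMap.coe_mk]
    have : ∀ i' (h : i' = i), bigWedgeIn (fun i => Y (e i)) i' ((congrArg e h).symm ▸ x) =
        bigWedgeIn (fun i => Y (e i)) i x := by
      rintro _ rfl
      rfl
    exact this _ (e.symm_apply_apply i)
  · refine bigWedge_cases (by simp) fun i x => ?_
    simp only [bigWedgeLift_in, ContinuousMap.comp_apply, ContinuousMap.coe_mk]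
    have : ∀ i' (h : i' = i), bigWedgeIn Y i' (h.symm ▸ x) = bigWedgeIn Y i x := by
      rintro _ rfl
      rfl
    exact this _ (e.apply_symm_apply i)

theorem bigWedge_sum (X : ι ⊕ κ → PointedSpace) : PointedHomotopyEquivalent (bigWedge X)
    (HigherKlein.wedge (bigWedge fun i => X (Sum.inl i)) (bigWedge fun j => X (Sum.inr j))) := by
  refine of_inverse
    (bigWedgeLift (HigherKlein.wedge _ _).pt (Sum.rec
      (fun i => (wedgeInl _ _).comp (bigWedgeIn (fun i => X (Sum.inl i)) i))
      (fun j => (wedgeInr _ _).comp (bigWedgeIn (fun j => X (Sum.inr j)) j))) ?_)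
    (wedgeLift
      (bigWedgeLift (bigWedge X).pt (fun i => bigWedgeIn X (Sum.inl i)) fun i => bigWedgeIn_pt _)
      (bigWedgeLift (bigWedge X).pt (fun j => bigWedgeIn X (Sum.inr j)) fun i => bigWedgeIn_pt _)
      (by simp)) ?_ ?_ ?_
  · rintro (i | i)
    · simp [bigWedgeIn_pt (X := fun i => X (Sum.inl i)), wedgeInl_pt]
    · simp [bigWedgeIn_pt (X := fun i => X (Sum.inr i)), wedgeInr_pt]
  · simp
  · refine bigWedge_cases (by simp) ?_
    rintro (i | i) x <;> simp
  · refine wedge_cases (bigWedge_cases ?_ ?_) (bigWedge_cases ?_ ?_)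
    · simp [wedgeInl_pt]
    · simp
    · simp [wedgeInr_pt]
    · simp

theorem bigWedge_unique [Unique ι] : PointedHomotopyEquivalent (bigWedge X) (X default) := by
  have key : ∀ X : PointedSpace, PointedHomotopyEquivalent (bigWedge fun _ : Unit => X) X := by
    intro X
    have hX : ∀ _ : Unit, ContinuousMap.id X X.pt = X.pt := fun _ => rfl
    refine of_inverse (bigWedgeLift X.pt (fun _ => ContinuousMap.id X) hX)
      (bigWedgeIn (fun _ => X) ()) (bigWedgeLift_pt ..) (bigWedge_cases ?_ fun i x => ?_)
      fun x => ?_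
    · rw [bigWedgeLift_pt]
      exact bigWedgeIn_pt (X := fun _ => X) ()
    · rw [bigWedgeLift_in]
      rfl
    · rw [bigWedgeLift_in]
      rfl
  refine (bigWedge_reindex (Equiv.ofUnique Unit ι)).symm.trans (trans ?_ (key _))
  refine bigWedge_congr fun i => ?_
  rw [Subsingleton.elim (Equiv.ofUnique Unit ι i) default]
  exact refl _

end PointedHomotopyEquivalent

end BigWedge

/-! ### Splitting the suspension of a space with a retract -/

/-- A retract `A` of `X` with a fibrewise deformation `h` of `X` that fixes `A` and whose end map
sends a neighbourhood of `A` into `A`. The neighbourhood is given by the function `l` on a space `E`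
that covers `X`. -/
structure FibrewiseRetract (X A : PointedSpace) (E : Type) [TopologicalSpace E] where
  i : C(A, X)
  r : C(X, A)
  h : C(I × X, X)
  π : E → X
  l : C(E, I)
  i_pt : i A.pt = X.pt
  r_i : ∀ a, r (i a) = a
  h_zero : ∀ x, h (0, x) = x
  h_i : ∀ t a, h (t, i a) = i a
  r_h : ∀ t x, r (h (t, x)) = r x
  quot : IsQuotientMap π
  -- Over the basepoint `l` may take several values, since collapsing identifies points at different
  -- distances from `A`. This is why `l` lives on `E` and not on `X`.
  l_eq : ∀ e e', π e = π e' → π e = X.pt ∨ l e = l e'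
  l_i : ∀ e a, π e = i a → π e = X.pt ∨ l e = 0
  h_one : ∀ e, l e ≠ 1 → h (1, π e) = i (r (π e))

namespace FibrewiseRetract

variable {X A : PointedSpace} {E : Type} [TopologicalSpace E] (D : FibrewiseRetract X A E)

/-- The quotient `X / A`. -/
abbrev cof : PointedSpace := collapse (range D.i) X.pt

/-- The quotient map `X → X / A`. -/
abbrev q : C(X, D.cof) := collapseMk (range D.i) X.pt

theorem r_pt : D.r X.pt = A.pt := by rw [← D.i_pt, D.r_i]

theorem h_pt (t : I) : D.h (t, X.pt) = X.pt := by rw [← D.i_pt, D.h_i]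

theorem q_i (a : A) : D.q (D.i a) = D.cof.pt :=
  collapseMk_eq_pt (A := range D.i) ⟨A.pt, D.i_pt⟩ (mem_range_self a)

theorem q_pt : D.q X.pt = D.cof.pt := rfl

theorem continuous_π : Continuous D.π := D.quot.continuous

theorem quot_cof : IsQuotientMap fun e => D.q (D.π e) :=
  isQuotientMap_collapseMk.comp D.quot

/-- The function `l` is well defined on `X` except at the basepoint, so an expression in `x` and `l`
descends as soon as it ignores `l` there. -/
theorem compat {β : Type*} (z : β) (G : X → I → β) (h0 : ∀ s, G X.pt s = z) (e e' : E)
    (h : D.π e = D.π e') : G (D.π e) (D.l e) = G (D.π e') (D.l e') := by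
  rcases D.l_eq e e' h with h' | h'
  · rw [← h, h', h0, h0]
  · rw [h, h']

/-- To descend further to `X / A` the expression must be constant on `A`, where `l` vanishes away
from the basepoint. -/
theorem compat_cof {β : Type*} (z : β) (G : X → I → β) (h0 : ∀ s, G X.pt s = z)
    (hi : ∀ a, G (D.i a) 0 = z) (e e' : E)
    (h : D.q (D.π e) = D.q (D.π e')) : G (D.π e) (D.l e) = G (D.π e') (D.l e') := by
  have key : ∀ e, D.π e ∈ range D.i → G (D.π e) (D.l e) = z := by
    rintro e ⟨a, ha⟩
    rcases D.l_i e a ha.symm with h' | h'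
    · rw [h', h0]
    · rw [h', ← ha, hi]
  rcases collapseMk_eq_iff.1 h with h | h
  · exact D.compat z G h0 e e' h
  · rw [key _ h.1, key _ h.2]

theorem eq_of_cof_pt {β : Type*} (z : β) (G : X → I → β) (h0 : ∀ s, G X.pt s = z)
    (hi : ∀ a, G (D.i a) 0 = z) (e : E) (h : D.q (D.π e) = D.cof.pt) :
    G (D.π e) (D.l e) = z := by
  obtain ⟨e₀, he₀⟩ := D.quot.surjective X.pt
  rw [D.compat_cof z G h0 hi e e₀ (by rw [h, he₀]; rfl), he₀, h0]

/-- Below `l = 1` the deformation has reached `A`; at `l = 1` both points are at the top of the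
suspension. This glues the two halves of `joinFun`. -/
theorem suspPoint_h_one (e : E) :
    suspPoint X (D.h (1, D.π e), D.l e) = suspPoint X (D.i (D.r (D.π e)), D.l e) := by
  by_cases h : D.l e = 1
  · rw [h, suspPoint_eq_pt (by simp), suspPoint_eq_pt (by simp)]
  · rw [D.h_one e h]

/-- The comparison map, on `X` with a height. -/
def splitFun (t : ℝ) (x : X) (p : ℝ) : wedge (reducedSuspension A) (reducedSuspension D.cof) :=
  -- The comparison map, at `t = 0`, is the pinch map followed by `q` on the lower half and `r` on
  -- the upper half. The parameter `t` pushes the component in `ΣA` down to the basepoint.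
  if p ≤ 1 / 2 then wedgeInr _ _ (suspPoint D.cof (D.q x, 2 * p))
  else wedgeInl _ _ (suspPoint A (D.r x, (1 - t) * (2 * p - 1)))

theorem wedgeInl_base {X Y : PointedSpace} {x : X} {s : ℝ} (h : s ≤ 0 ∨ 1 ≤ s ∨ x = X.pt) :
    wedgeInl (reducedSuspension X) Y (suspPoint X (x, s)) = (wedge (reducedSuspension X) Y).pt := by
  rw [suspPoint_eq_pt h, wedgeInl_pt]

theorem wedgeInr_base {X Y : PointedSpace} {y : Y} {s : ℝ} (h : s ≤ 0 ∨ 1 ≤ s ∨ y = Y.pt) :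
    wedgeInr X (reducedSuspension Y) (suspPoint Y (y, s)) = (wedge X (reducedSuspension Y)).pt := by
  rw [suspPoint_eq_pt h, wedgeInr_pt]

@[fun_prop]
theorem continuous_splitFun {W : Type*} [TopologicalSpace W] {t : W → ℝ} {x : W → X} {p : W → ℝ}
    (ht : Continuous t) (hx : Continuous x) (hp : Continuous p) :
    Continuous fun w => D.splitFun (t w) (x w) (p w) := by
  refine Continuous.if_le (by fun_prop) (by fun_prop) hp continuous_const fun w hw => ?_
  rw [wedgeInl_base (by simp [hw]), wedgeInr_base (by simp [hw])]

theorem splitFun_eq_pt {t : ℝ} {x : X} {p : ℝ} (h : p ≤ 0 ∨ x = X.pt) :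
    D.splitFun t x p = (wedge _ _).pt := by
  unfold splitFun
  rcases h with h | rfl
  · rw [if_pos (by linarith), wedgeInr_base (by left; linarith)]
  · rw [wedgeInl_base (Or.inr (Or.inr D.r_pt)), wedgeInr_base (Or.inr (Or.inr D.q_pt)), ite_self]

/-- At `p = 1` the height over `A` is `1 - t`, so for intermediate `t` the top need not go to the
basepoint; the comparison map is defined with `t = 0`. -/
theorem splitFun_zero_eq_pt {x : X} {p : ℝ} (h : 1 ≤ p) :
    D.splitFun 0 x p = (wedge _ _).pt := by
  unfold splitFun
  rw [if_neg (by linarith), wedgeInl_base (by right; left; linarith)]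

/-- The comparison map `ΣX → ΣA ∨ Σ(X / A)`. -/
def split : C(reducedSuspension X, wedge (reducedSuspension A) (reducedSuspension D.cof)) :=
  suspLift IsQuotientMap.id (wedge _ _).pt (fun p : X × I => D.splitFun 0 p.1 p.2)
    (by fun_prop) (fun e e' h s => by rw [show e = e' from h])
    (fun e => D.splitFun_eq_pt (by simp)) (fun e => D.splitFun_zero_eq_pt (by simp))
    (fun e h s => D.splitFun_eq_pt (Or.inr h))

@[simp]
theorem split_suspPoint (x : X) (p : ℝ) : D.split (suspPoint X (x, p)) = D.splitFun 0 x p := by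
  have hI : ∀ p : I, D.split (suspPoint X (x, p)) = D.splitFun 0 x p := fun p =>
    suspLift_apply (X := X) IsQuotientMap.id _ _ _ _ _ _ _ x p
  rcases le_total p 0 with h | h
  · rw [D.splitFun_eq_pt (Or.inl h), suspPoint_eq_pt (Or.inl h),
      ← suspPoint_eq_pt (X := X) (x := x) (s := (0 : I)) (by simp), hI, D.splitFun_eq_pt (by simp)]
  · rcases le_total 1 p with h' | h'
    · rw [D.splitFun_zero_eq_pt h', suspPoint_eq_pt (Or.inr (Or.inl h')),
        ← suspPoint_eq_pt (X := X) (x := x) (s := (0 : I)) (by simp), hI,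
        D.splitFun_eq_pt (by simp)]
    · exact hI ⟨p, h, h'⟩

/-- The map `Σ(X / A) → ΣX` on `E` with a height. -/
def joinFun (x : X) (l : I) (s : ℝ) : reducedSuspension X :=
  -- The loop climbs over `h (1, x)` to height `l` and descends over `i (r x)`: it is the difference
  -- of the end map of the deformation and the retraction. Cutting off at height `l` makes it
  -- constant on `A`, where `l = 0`.
  if s ≤ 1 / 2 then suspPoint X (D.h (1, x), 2 * s * l)
  else suspPoint X (D.i (D.r x), (2 - 2 * s) * l)

theorem joinFun_eq_pt {x : X} {l : I} {s : ℝ} (h : s = 0 ∨ s = 1 ∨ x = X.pt ∨ l = 0) :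
    D.joinFun x l s = (reducedSuspension X).pt := by
  unfold joinFun
  split_ifs with hs
  · rcases h with h | h | h | h
    · exact suspPoint_eq_pt (by simp [h])
    · norm_num [h] at hs
    · exact suspPoint_eq_pt (by simp [h, D.h_pt])
    · exact suspPoint_eq_pt (by simp [h])
  · rcases h with h | h | h | h
    · norm_num [h] at hs
    · exact suspPoint_eq_pt (by simp [h])
    · exact suspPoint_eq_pt (by simp [h, D.r_pt, D.i_pt])
    · exact suspPoint_eq_pt (by simp [h])

/-- The map `Σ(X / A) → ΣX`. -/
def join : C(reducedSuspension D.cof, reducedSuspension X) :=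
  suspLift D.quot_cof (reducedSuspension X).pt (fun p => D.joinFun (D.π p.1) (D.l p.1) p.2)
    (by
      have := D.continuous_π
      refine Continuous.if_le (by fun_prop) (by fun_prop) (by fun_prop) continuous_const
        fun w hw => ?_
      rw [hw]
      norm_num
      exact D.suspPoint_h_one _)
    (fun e e' h s => D.compat_cof _ (fun x l => D.joinFun x l s)
      (fun _ => D.joinFun_eq_pt (by simp)) (fun _ => D.joinFun_eq_pt (by simp)) e e' h)
    (fun e => D.joinFun_eq_pt (by simp)) (fun e => D.joinFun_eq_pt (by simp))
    (fun e h s => D.eq_of_cof_pt _ (fun x l => D.joinFun x l s)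
      (fun _ => D.joinFun_eq_pt (by simp)) (fun _ => D.joinFun_eq_pt (by simp)) e h)

theorem join_suspPoint (e : E) {s : ℝ} (h0 : 0 ≤ s) (h1 : s ≤ 1) :
    D.join (suspPoint D.cof (D.q (D.π e), s)) = D.joinFun (D.π e) (D.l e) s :=
  suspLift_apply D.quot_cof _ _ _ _ _ _ _ e ⟨s, h0, h1⟩

theorem join_pt : D.join (reducedSuspension D.cof).pt = (reducedSuspension X).pt := by
  obtain ⟨e, -⟩ := D.quot.surjective X.pt
  rw [← suspPoint_eq_pt (X := D.cof) (x := D.q (D.π e)) (s := 0) (by simp),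
    D.join_suspPoint e le_rfl zero_le_one, D.joinFun_eq_pt (by simp)]

/-- The inverse of the comparison map. -/
def unsplit : C(wedge (reducedSuspension A) (reducedSuspension D.cof), reducedSuspension X) :=
  wedgeLift (suspMap D.i D.i_pt) D.join (by rw [suspMap_pt, join_pt])

/-- A reparametrisation of heights. -/
def height (l s : ℝ) : ℝ := l * min (4 * s) 1 + (1 - l) * max 0 ((4 * s - 1) / 3)

theorem height_zero (l : ℝ) : height l 0 = 0 := by norm_num [height]

theorem height_one (l : ℝ) : height l 1 = 1 := by norm_num [height]

@[fun_prop]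
theorem continuous_height {W : Type*} [TopologicalSpace W] {l s : W → ℝ} (hl : Continuous l)
    (hs : Continuous s) : Continuous fun w => height (l w) (s w) := by
  unfold height
  fun_prop

/-- The end map of the deformation with reparametrised heights. -/
def middle : C(reducedSuspension X, reducedSuspension X) :=
  suspLift D.quot (reducedSuspension X).pt
    (fun p => suspPoint X (D.h (1, D.π p.1), height (D.l p.1) p.2))
    (by
      have := D.continuous_π
      fun_prop)
    (fun e e' h s => D.compat (reducedSuspension X).pt
      (fun x l => suspPoint X (D.h (1, x), height l s))
      (fun s => suspPoint_eq_pt (by simp [D.h_pt])) e e' h)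
    (fun e => suspPoint_eq_pt (by simp [height_zero]))
    (fun e => suspPoint_eq_pt (by simp [height_one]))
    (fun e h s => suspPoint_eq_pt (by simp [h, D.h_pt]))

/-- The homotopy from the round trip to `middle`. -/
def roundTrip (t : ℝ) (x : X) (l : I) (s : ℝ) : reducedSuspension X :=
  -- At `t = 0` the part over `i (r x)` descends from `l` to `0` and climbs to `1`; at `t = 1` it
  -- climbs directly from `l` to `1`. The homotopy between them is linear in the height.
  if s ≤ 1 / 4 then suspPoint X (D.h (1, x), 4 * s * l)
  else suspPoint X (D.i (D.r x), (1 - t) * (l * max (2 - 4 * s) 0 + max (2 * s - 1) 0) +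
    t * (l + (1 - l) * ((4 * s - 1) / 3)))

theorem roundTrip_pt (t : ℝ) (l : I) (s : ℝ) :
    D.roundTrip t X.pt l s = (reducedSuspension X).pt := by
  unfold roundTrip
  rw [D.h_pt, D.r_pt, D.i_pt, suspPoint_base, suspPoint_base, ite_self]

/-- The round trip climbs over `h (1, x)` to `l`, descends over `i (r x)`, then climbs over `i (r
x)`. Cancelling the last two parts below `l` leaves a path that lies over `h (1, x)` throughout:
above height `l < 1` the two base points agree, and for `l = 1` nothing remains above. This path is
`middle`, and running `h` backwards while straightening heights leads to the identity. -/
theorem unsplit_split : (D.unsplit.comp D.split).HomotopicRel (ContinuousMap.id _)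
    {(reducedSuspension X).pt} := by
  have hπ := D.continuous_π
  have hpt : D.unsplit.comp D.split (reducedSuspension X).pt = (reducedSuspension X).pt := by
    rw [← suspPoint_base X 0, ContinuousMap.comp_apply, split_suspPoint,
      D.splitFun_eq_pt (by simp), unsplit, wedgeLift_pt, suspMap_pt, suspPoint_base]
  refine ContinuousMap.HomotopicRel.trans (g := D.middle) ?_ ?_
  · refine homotopicRel_of_susp D.quot hpt
      (fun p => D.roundTrip p.1 (D.π p.2.1) (D.l p.2.1) p.2.2) ?_ ?_ ?_ ?_ ?_ ?_ ?_
    · refine Continuous.if_le (by fun_prop) (by fun_prop) (by fun_prop) continuous_const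
        fun w hw => ?_
      rw [hw]
      norm_num
      convert D.suspPoint_h_one _ using 3
      ring
    · exact fun e e' h t s => D.compat _ (fun x l => D.roundTrip t x l s)
        (fun l => D.roundTrip_pt t l s) e e' h
    · intro t e
      simp only [roundTrip]
      rw [if_pos (by simp)]
      exact suspPoint_eq_pt (by simp)
    · intro t e
      simp only [roundTrip]
      rw [if_neg (by norm_num)]
      refine suspPoint_eq_pt (Or.inr (Or.inl (le_of_eq ?_)))
      norm_num
    · intro e h t s
      rw [h, D.roundTrip_pt]
    · intro e s
      have h0 := s.2.1
      have h1 := s.2.2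
      simp only [roundTrip, ContinuousMap.comp_apply, split_suspPoint, splitFun, unsplit]
      by_cases hs : (s : ℝ) ≤ 1 / 2
      · rw [if_pos hs, wedgeLift_inr, D.join_suspPoint e (by linarith) (by linarith), joinFun]
        by_cases hs' : (s : ℝ) ≤ 1 / 4
        · rw [if_pos hs', if_pos (by linarith)]
          ring_nf
        · rw [if_neg hs', if_neg (by linarith), max_eq_left (by linarith),
            max_eq_right (by linarith)]
          congr 2
          simp only [Icc.coe_zero]
          ring
      · rw [if_neg hs, if_neg (by linarith), wedgeLift_inl, suspMap_apply,
          max_eq_right (by linarith), max_eq_left (by linarith)]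
        congr 2
        simp only [Icc.coe_zero]
        ring
    · intro e s
      have h0 := s.2.1
      have h1 := s.2.2
      rw [middle, suspLift_apply, roundTrip, height]
      dsimp only
      by_cases hs' : (s : ℝ) ≤ 1 / 4
      · rw [if_pos hs', min_eq_left (by linarith),
          max_eq_left (by linarith)]
        ring_nf
      · rw [if_neg hs', min_eq_right (by linarith),
          max_eq_right (show (0 : ℝ) ≤ (4 * s - 1) / 3 by linarith)]
        -- For `l = 1` the first quarter already reaches the top, and the rest of the path is
        -- constant.
        by_cases hl : D.l e = 1
        · rw [suspPoint_eq_pt (by simp [hl]), suspPoint_eq_pt (by simp [hl])]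
        · rw [D.h_one e hl]
          congr 2
          simp only [Icc.coe_one]
          ring
  · have hpt : D.middle (reducedSuspension X).pt = (reducedSuspension X).pt := by
      obtain ⟨e, -⟩ := D.quot.surjective X.pt
      rw [← suspPoint_eq_pt (X := X) (x := D.π e) (s := (0 : I)) (by simp), middle,
        suspLift_apply, suspPoint_eq_pt (by simp [height_zero]), suspPoint_eq_pt (by simp)]
    refine homotopicRel_of_susp D.quot hpt
      (fun p => suspPoint X (D.h (σ p.1, D.π p.2.1),
        (1 - p.1) * height (D.l p.2.1) p.2.2 + p.1 * p.2.2)) (by fun_prop) ?_ ?_ ?_ ?_ ?_ ?_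
    · exact fun e e' h t s => D.compat (reducedSuspension X).pt
        (fun x l => suspPoint X (D.h (σ t, x), (1 - t) * height l s + t * s))
        (fun s => suspPoint_eq_pt (by simp [D.h_pt])) e e' h
    · intro t e
      exact suspPoint_eq_pt (by simp [height_zero])
    · intro t e
      exact suspPoint_eq_pt (by simp [height_one])
    · intro e h t s
      exact suspPoint_eq_pt (by simp [h, D.h_pt])
    · intro e s
      simp [middle]
    · intro e s
      simp [D.h_zero]

/-- The homotopy of the round trip on the second summand. -/
def roundTrip' (t : ℝ) (x : X) (l : I) (s : ℝ) :
    wedge (reducedSuspension A) (reducedSuspension D.cof) :=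
  -- On the way down `q` kills `i (r x)`, so only the component in `ΣA` is left. That component
  -- climbs and returns over the same point `r x`, and the factor `1 - t` contracts it.
  if s ≤ 1 / 2 then D.splitFun t (D.h (1, x)) (2 * s * l)
  else wedgeInl _ _ (suspPoint A (D.r x, (1 - t) * ((4 - 4 * s) * l - 1)))

theorem roundTrip'_eq_pt {t : I} {x : X} {l : I} {s : ℝ}
    (h : s = 0 ∨ s = 1 ∨ x = X.pt ∨ l = 0) : D.roundTrip' t x l s = (wedge _ _).pt := by
  have ht : (t : ℝ) ≤ 1 := t.2.2
  unfold roundTrip'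
  split_ifs with hs
  · rcases h with h | h | h | h
    · exact D.splitFun_eq_pt (by simp [h])
    · norm_num [h] at hs
    · exact D.splitFun_eq_pt (by simp [h, D.h_pt])
    · exact D.splitFun_eq_pt (by simp [h])
  · rcases h with h | h | h | h
    · norm_num [h] at hs
    · exact wedgeInl_base (by simp [h, ht])
    · exact wedgeInl_base (by simp [h, D.r_pt])
    · exact wedgeInl_base (by simp [h, ht])

/-- The two branches of `roundTrip'` meet at `s = 1 / 2`. If `l ≤ 1 / 2`, the deformed point lies in
`A` and is killed by `q`, while the other branch has a nonpositive height. -/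
theorem splitFun_h_one (t : I) (e : E) : D.splitFun t (D.h (1, D.π e)) (2 * (1 / 2) * D.l e) =
    wedgeInl _ _ (suspPoint A (D.r (D.π e), (1 - t) * ((4 - 4 * (1 / 2)) * D.l e - 1))) := by
  have ht := t.2.2
  rw [splitFun, D.r_h]
  split_ifs with h
  · have hl : D.l e ≠ 1 := by
      intro hl
      norm_num [hl] at h
    rw [D.h_one e hl, wedgeInr_base (Or.inr (Or.inr (D.q_i _))), wedgeInl_base]
    left
    exact mul_nonpos_of_nonneg_of_nonpos (by linarith) (by linarith)
  · congr 3
    ring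

/-- Only points with `l = 1` matter at the end: for the others `h (1, ·)` lands in `A`, and both
sides are the basepoint. So `l` disappears from the formula. -/
theorem roundTrip'_one (e : E) (s : I) : D.roundTrip' (1 : I) (D.π e) (D.l e) s =
    wedgeInr _ _ (suspPoint D.cof (D.q (D.h (1, D.π e)), 4 * s)) := by
  have h0 := s.2.1
  have h1 := s.2.2
  by_cases hl : D.l e = 1
  · rw [roundTrip', hl, splitFun]
    split_ifs with hs hs'
    · congr 3
      simp only [Icc.coe_one]
      ring
    · rw [wedgeInl_base (by simp), wedgeInr_base]
      right; left
      simp only [Icc.coe_one] at hs'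
      linarith
    · rw [wedgeInl_base (by simp), wedgeInr_base]
      right; left
      linarith
  · rw [roundTrip', D.h_one e hl, splitFun, wedgeInl_base (by simp), wedgeInl_base (by simp),
      wedgeInr_base (Or.inr (Or.inr (D.q_i _))), wedgeInr_base (Or.inr (Or.inr (D.q_i _))),
      ite_self, ite_self]

/-- The deformation of the second summand at the end. -/
def middle' : C(reducedSuspension D.cof, wedge (reducedSuspension A) (reducedSuspension D.cof)) :=
  suspLift D.quot_cof (wedge _ _).pt
    (fun p => wedgeInr _ _ (suspPoint D.cof (D.q (D.h (1, D.π p.1)), 4 * p.2)))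
    (by
      have := D.continuous_π
      fun_prop)
    (fun e e' h s => D.compat_cof (wedge (reducedSuspension A) (reducedSuspension D.cof)).pt
      (fun x l => wedgeInr _ _ (suspPoint D.cof (D.q (D.h (1, x)), 4 * s)))
      (fun _ => wedgeInr_base (by simp [D.h_pt, D.q_pt]))
      (fun _ => wedgeInr_base (by simp [D.h_i, D.q_i])) e e' h)
    (fun e => wedgeInr_base (by simp)) (fun e => wedgeInr_base (by norm_num))
    (fun e h s => D.eq_of_cof_pt (wedge (reducedSuspension A) (reducedSuspension D.cof)).pt
      (fun x l => wedgeInr _ _ (suspPoint D.cof (D.q (D.h (1, x)), 4 * s)))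
      (fun _ => wedgeInr_base (by simp [D.h_pt, D.q_pt]))
      (fun _ => wedgeInr_base (by simp [D.h_i, D.q_i])) e h)

/-- On `ΣA` the round trip is the identity with heights reparametrised. On `Σ(X / A)` the component
in `ΣA` cancels against itself, because `r` does not see the deformation; what is left is `q ∘ h (1,
·)`, which `h` run backwards joins to the identity. -/
theorem split_unsplit : (D.split.comp D.unsplit).HomotopicRel (ContinuousMap.id _)
    {(wedge (reducedSuspension A) (reducedSuspension D.cof)).pt} := by
  have hπ := D.continuous_π
  have hpt : D.split (reducedSuspension X).pt = (wedge _ _).pt := by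
    rw [← suspPoint_base X 0, split_suspPoint, D.splitFun_eq_pt (by simp)]
  refine wedge_homotopicRel ?_ ?_
  · refine homotopicRel_of_susp IsQuotientMap.id
      (z := (wedge (reducedSuspension A) (reducedSuspension D.cof)).pt) ?_
      (fun p => wedgeInl _ _ (suspPoint A (p.2.1, (1 - p.1) * (2 * p.2.2 - 1) + p.1 * p.2.2)))
      (by fun_prop) ?_ ?_ ?_ ?_ ?_ ?_
    · simp [unsplit, suspMap_pt, hpt]
    · rintro e _ rfl t s
      rfl
    · intro t e
      have := t.2.2
      exact wedgeInl_base (by simp [this])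
    · intro t e
      exact wedgeInl_base (Or.inr (Or.inl (le_of_eq (by norm_num))))
    · intro e h t s
      exact wedgeInl_base (Or.inr (Or.inr h))
    · intro e s
      simp only [unsplit, ContinuousMap.comp_apply, wedgeLift_inl, suspMap_apply, split_suspPoint,
        splitFun, D.q_i, D.r_i, id]
      split_ifs with hs
      · rw [wedgeInl_base, wedgeInr_base (by simp)]
        left
        norm_num
        linarith
      · simp
    · intro e s
      simp
  · refine ContinuousMap.HomotopicRel.trans (g := D.middle') ?_ ?_
    · refine homotopicRel_of_susp D.quot_cof
        (z := (wedge (reducedSuspension A) (reducedSuspension D.cof)).pt) ?_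
        (fun p => D.roundTrip' p.1 (D.π p.2.1) (D.l p.2.1) p.2.2) ?_ ?_ ?_ ?_ ?_ ?_ ?_
      · simp [unsplit, D.join_pt, hpt]
      · refine Continuous.if_le (by fun_prop) (by fun_prop) (by fun_prop) continuous_const
          fun w hw => ?_
        rw [hw]
        exact D.splitFun_h_one _ _
      · exact fun e e' h t s => D.compat_cof _ (fun x l => D.roundTrip' t x l s)
          (fun _ => D.roundTrip'_eq_pt (by simp)) (fun _ => D.roundTrip'_eq_pt (by simp)) e e' h
      · exact fun t e => D.roundTrip'_eq_pt (by simp)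
      · exact fun t e => D.roundTrip'_eq_pt (by simp)
      · exact fun e h t s => D.eq_of_cof_pt _ (fun x l => D.roundTrip' t x l s)
          (fun _ => D.roundTrip'_eq_pt (by simp)) (fun _ => D.roundTrip'_eq_pt (by simp)) e h
      · intro e s
        simp only [unsplit, ContinuousMap.comp_apply, wedgeLift_inr,
          D.join_suspPoint e s.2.1 s.2.2, joinFun, roundTrip']
        split_ifs with hs
        · simp
        · rw [split_suspPoint, splitFun]
          split_ifs with hs'
          · rw [wedgeInl_base, wedgeInr_base (by simp [D.q_i])]
            left
            norm_num
            linarith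
          · rw [D.r_i]
            congr 3
            simp only [Icc.coe_zero]
            ring
      · intro e s
        rw [middle', suspLift_apply]
        exact D.roundTrip'_one e s
    · refine homotopicRel_of_susp D.quot_cof
        (z := (wedge (reducedSuspension A) (reducedSuspension D.cof)).pt) ?_
        (fun p => wedgeInr _ _ (suspPoint D.cof (D.q (D.h (σ p.1, D.π p.2.1)),
          (1 - p.1) * (4 * p.2.2) + p.1 * p.2.2))) (by fun_prop) ?_ ?_ ?_ ?_ ?_ ?_
      · obtain ⟨e, -⟩ := D.quot.surjective X.pt
        rw [← suspPoint_eq_pt (X := D.cof) (x := D.q (D.π e)) (s := (0 : I)) (by simp), middle',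
          suspLift_apply, wedgeInr_base (by simp)]
      · exact fun e e' h t s => D.compat_cof
          (wedge (reducedSuspension A) (reducedSuspension D.cof)).pt
          (fun x l => wedgeInr _ _ (suspPoint D.cof (D.q (D.h (σ t, x)),
            (1 - t) * (4 * s) + t * s)))
          (fun _ => wedgeInr_base (by simp [D.h_pt, D.q_pt]))
          (fun _ => wedgeInr_base (by simp [D.h_i, D.q_i])) e e' h
      · exact fun t e => wedgeInr_base (by simp)
      · intro t e
        have := t.2.2
        refine wedgeInr_base (Or.inr (Or.inl ?_))
        norm_num
        linarith
      · exact fun e h t s => D.eq_of_cof_pt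
          (wedge (reducedSuspension A) (reducedSuspension D.cof)).pt
          (fun x l => wedgeInr _ _ (suspPoint D.cof (D.q (D.h (σ t, x)),
            (1 - t) * (4 * s) + t * s)))
          (fun _ => wedgeInr_base (by simp [D.h_pt, D.q_pt]))
          (fun _ => wedgeInr_base (by simp [D.h_i, D.q_i])) e h
      · intro e s
        simp [middle']
      · intro e s
        simp [D.h_zero]

theorem equivalent : PointedHomotopyEquivalent (reducedSuspension X)
    (wedge (reducedSuspension A) (reducedSuspension D.cof)) := by
  refine ⟨D.split, D.unsplit, ?_, ?_, D.unsplit_split, D.split_unsplit⟩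
  · rw [← suspPoint_base X 0, split_suspPoint, D.splitFun_eq_pt (by simp)]
  · rw [unsplit, wedgeLift_pt, suspMap_pt]

end FibrewiseRetract

/-! ### Contracting a hemisphere -/

section Shrink

variable {F : Type*} [NormedAddCommGroup F] [InnerProductSpace ℝ F]

/-- The unnormalised contraction of the unit sphere towards `e`. -/
def shrinkVec (e : F) (t : ℝ) (v : F) : F :=
  (inner ℝ e v + t * (1 - |inner ℝ e v|)) • e +
    ((1 - t) + t * max 0 (-inner ℝ e v)) • (v - inner ℝ e v • e)

/-- The contraction of the unit sphere towards `e`. At time one, the hemisphere around `e` is sent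
to `e`. -/
def shrink (e : F) (t : ℝ) (v : F) : F := ‖shrinkVec e t v‖⁻¹ • shrinkVec e t v

/-- The vector is split into its component along `e` and the orthogonal one. The orthogonal part
vanishes only if `v = ±e`, or if `t = 1` and `v` lies in the hemisphere around `e`; in these cases
the component along `e` is nonzero. -/
theorem shrinkVec_ne_zero {e v : F} (he : ‖e‖ = 1) (hv : ‖v‖ = 1) (t : I) :
    shrinkVec e t v ≠ 0 := by
  intro h
  have h0 := t.2.1
  have h1 := t.2.2
  set x : ℝ := inner ℝ e v with hx
  have hee : inner ℝ e e = (1 : ℝ) := by rw [real_inner_self_eq_norm_sq, he, one_pow]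
  have hp : inner ℝ e (v - x • e) = (0 : ℝ) := by
    rw [inner_sub_right, inner_smul_right, hee, mul_one, sub_self]
  have ha : x + t * (1 - |x|) = 0 := by
    have := congrArg (inner ℝ e) h
    rw [shrinkVec, ← hx, inner_add_right, inner_smul_right, inner_smul_right, hp, hee,
      inner_zero_right] at this
    linarith
  rw [shrinkVec, ← hx, ha, zero_smul, zero_add, smul_eq_zero] at h
  rcases h with h | h
  · have hm : 0 ≤ max 0 (-x) := le_max_left _ _
    have ht : (t : ℝ) = 1 := by
      have := mul_nonneg h0 hm
      linarith
    have hm0 : max 0 (-x) = 0 := by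
      rw [ht] at h
      linarith
    have hx0 : 0 ≤ x := by
      have := le_max_right 0 (-x)
      linarith
    rw [abs_of_nonneg hx0, ht] at ha
    linarith
  · have hvx : v = x • e := sub_eq_zero.1 h
    have : |x| = 1 := by
      rw [hvx, norm_smul, he, mul_one] at hv
      exact hv
    rw [this] at ha
    have : x = 0 := by linarith
    rw [this] at hvx
    rw [hvx] at hv
    simp at hv

theorem norm_shrink {e v : F} (he : ‖e‖ = 1) (hv : ‖v‖ = 1) (t : I) : ‖shrink e t v‖ = 1 := by
  rw [shrink, norm_smul, norm_inv, norm_norm]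
  exact inv_mul_cancel₀ (norm_ne_zero_iff.2 (shrinkVec_ne_zero he hv t))

theorem shrink_zero {e v : F} (hv : ‖v‖ = 1) : shrink e 0 v = v := by
  have : shrinkVec e 0 v = v := by simp [shrinkVec]
  rw [shrink, this, hv, inv_one, one_smul]

theorem shrink_self {e : F} (he : ‖e‖ = 1) (t : ℝ) : shrink e t e = e := by
  have : shrinkVec e t e = e := by simp [shrinkVec, he]
  rw [shrink, this, he, inv_one, one_smul]

theorem shrink_one {e v : F} (he : ‖e‖ = 1) (hx : 0 ≤ inner ℝ e v) : shrink e 1 v = e := by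
  have : shrinkVec e 1 v = e := by simp [shrinkVec, hx, abs_of_nonneg]
  rw [shrink, this, he, inv_one, one_smul]

/-- The contraction is built from `e` and the inner product alone. Applied to complex conjugation,
this makes it commute with the involution of the torus. -/
theorem shrink_map {e v : F} (φ : F →ₗᵢ[ℝ] F) (hφ : φ e = e) (t : ℝ) :
    shrink e t (φ v) = φ (shrink e t v) := by
  have hi : inner ℝ e (φ v) = inner ℝ e v := by
    conv_lhs => rw [← hφ]
    exact φ.inner_map_map e v
  have : shrinkVec e t (φ v) = φ (shrinkVec e t v) := by
    simp only [shrinkVec, hi, map_add, map_smul, map_sub, hφ]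
  rw [shrink, shrink, this, φ.norm_map, map_smul]

theorem continuous_shrink {W : Type*} [TopologicalSpace W] {e : F} (he : ‖e‖ = 1) {t : W → I}
    {v : W → F} (ht : Continuous t) (hv : Continuous v) (hv1 : ∀ w, ‖v w‖ = 1) :
    Continuous fun w => shrink e (t w) (v w) := by
  have : Continuous fun w => shrinkVec e (t w) (v w) := by
    unfold shrinkVec
    fun_prop
  exact (this.norm.inv₀ fun w => norm_ne_zero_iff.2 (shrinkVec_ne_zero he (hv1 w) (t w))).smul this

end Shrink

/-- The contraction of the circle towards `1`. -/
def circleShrink (t : I) (z : Circle) : Circle :=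
  ⟨shrink (1 : ℂ) t z, mem_sphere_zero_iff_norm.2 (norm_shrink (by simp) z.norm_coe t)⟩

theorem continuous_circleShrink {W : Type*} [TopologicalSpace W] {t : W → I} {z : W → Circle}
    (ht : Continuous t) (hz : Continuous z) : Continuous fun w => circleShrink (t w) (z w) :=
  (continuous_shrink (by simp) ht (continuous_subtype_val.comp hz)
    fun w => (z w).norm_coe).subtype_mk _

theorem circleShrink_zero (z : Circle) : circleShrink 0 z = z :=
  Circle.ext (shrink_zero z.norm_coe)

theorem circleShrink_apply_one (t : I) : circleShrink t 1 = 1 :=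
  Circle.ext (shrink_self (by simp) _)

theorem circleShrink_one {z : Circle} (hz : 0 ≤ (z : ℂ).re) : circleShrink 1 z = 1 :=
  Circle.ext (shrink_one (by simp) (by simpa using hz))

theorem circleShrink_inv (t : I) (z : Circle) : circleShrink t z⁻¹ = (circleShrink t z)⁻¹ := by
  refine Circle.ext ?_
  rw [Circle.coe_inv_eq_conj]
  change shrink (1 : ℂ) t (z⁻¹ : Circle) = _
  rw [Circle.coe_inv_eq_conj]
  exact shrink_map Complex.conjLIE.toLinearIsometry (by simp) t

/-- The distance of a point of the circle to the point `1`, cut off at the opposite hemisphere. -/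
def circleDist (z : Circle) : I := projIcc 0 1 zero_le_one (1 - (z : ℂ).re)

@[fun_prop]
theorem continuous_circleDist : Continuous circleDist :=
  continuous_projIcc.comp (by fun_prop)

theorem circleDist_one : circleDist 1 = 0 := by
  simp [circleDist]

theorem circleDist_inv (z : Circle) : circleDist z⁻¹ = circleDist z := by
  simp [circleDist]

theorem circleShrink_of_circleDist {z : Circle} (hz : circleDist z ≠ 1) :
    circleShrink 1 z = 1 := by
  refine circleShrink_one ?_
  by_contra! h
  exact hz (projIcc_of_right_le zero_le_one (by linarith))

/-! ### The quotients of the torus -/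

/-- The torus, with the last coordinate kept apart. -/
abbrev Torus (k : ℕ) : Type := (Fin k → Circle) × Circle

namespace Torus

variable {k : ℕ}

/-- The involution that conjugates all coordinates but the last, which changes sign. -/
def flip (x : Torus k) : Torus k := (x.1⁻¹, -x.2)

/-- Replaces the coordinates outside `J` by `1`. -/
def restr (J : Finset (Fin k)) (x : Torus k) : Torus k := (fun j => if j ∈ J then x.1 j else 1, x.2)

/-- The subset to be collapsed: some coordinate in `S` is `1`, or the point lies over the
basepoint. -/
def Fat (S : Finset (Fin k)) (x : Torus k) : Prop :=
  (∃ i ∈ S, x.1 i = 1) ∨ (x.1 = 1 ∧ (x.2 = 1 ∨ x.2 = -1))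

/-- Applies `f` to the coordinate `j`. -/
def upd (j : Fin k) (f : Circle → Circle) (x : Torus k) : Torus k :=
  (Function.update x.1 j (f (x.1 j)), x.2)

theorem flip_flip (x : Torus k) : flip (flip x) = x := by simp [flip]

theorem flip_restr (J : Finset (Fin k)) (x : Torus k) : flip (restr J x) = restr J (flip x) := by
  ext j
  · by_cases h : j ∈ J <;> simp [flip, restr, h]
  · rfl

theorem Fat.flip {S : Finset (Fin k)} {x : Torus k} (h : Fat S x) : Fat S x.flip := by
  rcases h with ⟨i, hi, h⟩ | ⟨h1, h2⟩
  · exact Or.inl ⟨i, hi, by simp [Torus.flip, h]⟩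
  · refine Or.inr ⟨by simp [Torus.flip, h1], ?_⟩
    rcases h2 with h2 | h2
    · exact Or.inr (by simp [Torus.flip, h2])
    · exact Or.inl (by simp [Torus.flip, h2])

theorem flip_upd {j : Fin k} {f : Circle → Circle} (hf : ∀ z, f z⁻¹ = (f z)⁻¹) (x : Torus k) :
    flip (upd j f x) = upd j f (flip x) := by
  ext i
  · by_cases h : i = j
    · subst h
      simp [flip, upd, hf]
    · simp [flip, upd, h]
  · rfl

theorem Fat.upd {S : Finset (Fin k)} {x : Torus k} {j : Fin k} (hj : j ∉ S) {f : Circle → Circle}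
    (hf : f 1 = 1) (h : Fat S x) : Fat S (x.upd j f) := by
  rcases h with ⟨i, hi, h⟩ | ⟨h1, h2⟩
  · have : i ≠ j := fun h => hj (h ▸ hi)
    exact Or.inl ⟨i, hi, by simp [Torus.upd, h, this]⟩
  · refine Or.inr ⟨?_, h2⟩
    simp only [Torus.upd, h1, Pi.one_apply, hf]
    exact Function.update_eq_self j 1

theorem fat_one (S : Finset (Fin k)) : Fat S 1 := Or.inr ⟨rfl, Or.inl rfl⟩

theorem restr_one (J : Finset (Fin k)) : restr J 1 = 1 := by
  ext j <;> simp [restr]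

/-- The relation on the torus that identifies the orbits of the involution and collapses a
subset. -/
def Rel (S : Finset (Fin k)) (x y : Torus k) : Prop := (Fat S x ∧ Fat S y) ∨ x = y ∨ x = flip y

/-- Both the retraction (`f` constant) and the contraction of the half-circle descend to the
quotients for this one reason. -/
theorem Rel.upd {S : Finset (Fin k)} {x y : Torus k} {j : Fin k} (hj : j ∉ S) {f : Circle → Circle}
    (hf : f 1 = 1) (hf' : ∀ z, f z⁻¹ = (f z)⁻¹) (h : Rel S x y) :
    Rel S (x.upd j f) (y.upd j f) := by
  rcases h with h | h | h
  · exact Or.inl ⟨h.1.upd hj hf, h.2.upd hj hf⟩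
  · exact Or.inr (Or.inl (by rw [h]))
  · exact Or.inr (Or.inr (by rw [h, flip_upd hf']))

/-- The relation `Rel` on the coordinates in `J`. -/
def setoid (J S : Finset (Fin k)) : Setoid (Torus k) where
  r x y := Rel S (restr J x) (restr J y)
  iseqv :=
    { refl := fun _ => Or.inr (Or.inl rfl)
      symm := by
        rintro x y (h | h | h)
        · exact Or.inl h.symm
        · exact Or.inr (Or.inl h.symm)
        · exact Or.inr (Or.inr (by rw [h, flip_flip]))
      trans := by
        rintro x y z (h | h | h) (h' | h' | h')
        · exact Or.inl ⟨h.1, h'.2⟩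
        · exact Or.inl ⟨h.1, h' ▸ h.2⟩
        · refine Or.inl ⟨h.1, ?_⟩
          rw [← flip_flip (restr J z), ← h']
          exact h.2.flip
        · exact Or.inl ⟨h ▸ h'.1, h'.2⟩
        · exact Or.inr (Or.inl (h.trans h'))
        · exact Or.inr (Or.inr (h.trans h'))
        · exact Or.inl ⟨h ▸ h'.1.flip, h'.2⟩
        · exact Or.inr (Or.inr (h' ▸ h))
        · refine Or.inr (Or.inl ?_)
          rw [h, h', flip_flip] }

/-- The quotient of the subtorus with coordinates in `J` by the involution and the subset with some
coordinate in `S` equal to `1`. -/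
def quotient (J S : Finset (Fin k)) : PointedSpace where
  carrier := Quotient (setoid J S)
  pt := Quotient.mk _ 1

/-- The quotient map. -/
def mk (J S : Finset (Fin k)) : C(Torus k, quotient J S) where
  toFun := Quotient.mk (setoid J S)
  continuous_toFun := continuous_quotient_mk'

theorem isQuotientMap_mk (J S : Finset (Fin k)) : IsQuotientMap (mk J S) :=
  isQuotientMap_quotient_mk'

theorem mk_eq_iff {J S : Finset (Fin k)} {x y : Torus k} :
    mk J S x = mk J S y ↔ Rel S (restr J x) (restr J y) := Quotient.eq

theorem mk_one (J S : Finset (Fin k)) : mk J S 1 = (quotient J S).pt := rfl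

theorem mk_eq_pt {J S : Finset (Fin k)} {x : Torus k} (h : Fat S (restr J x)) :
    mk J S x = (quotient J S).pt := by
  rw [← mk_one, mk_eq_iff]
  exact Or.inl ⟨h, by simpa only [restr_one] using fat_one S⟩

theorem restr_upd {J : Finset (Fin k)} {j : Fin k} (hj : j ∈ J) (f : Circle → Circle)
    (x : Torus k) : restr J (upd j f x) = upd j f (restr J x) := by
  ext i
  · by_cases h : i = j
    · subst h
      simp [restr, upd, hj]
    · simp [restr, upd, h]
  · rfl

theorem restr_erase {J : Finset (Fin k)} {j : Fin k} (x : Torus k) :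
    restr (J.erase j) x = upd j (fun _ => 1) (restr J x) := by
  ext i
  · by_cases h : i = j
    · subst h
      simp [restr, upd]
    · simp [restr, upd, h]
  · rfl

theorem upd_upd (j : Fin k) (f g : Circle → Circle) (x : Torus k) :
    upd j f (upd j g x) = upd j (f ∘ g) x := by
  simp [upd]

theorem continuous_upd (j : Fin k) {W : Type*} [TopologicalSpace W] {f : W → Circle → Circle}
    {x : W → Torus k} (hx : Continuous x) (hf : Continuous fun w => f w ((x w).1 j)) :
    Continuous fun w => upd j (f w) (x w) := by
  unfold upd
  exact (hx.fst.update j hf).prodMk hx.snd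

theorem upd_circleShrink_zero (j : Fin k) (x : Torus k) : upd j (circleShrink 0) x = x := by
  simp [upd, circleShrink_zero]

variable (J S : Finset (Fin k)) (j : Fin k) (hJ : j ∈ J) (hI : j ∉ S)

/-- The inclusion of the subtorus on which the coordinate `j` is `1`. -/
def incl : C(quotient (J.erase j) S, quotient J S) :=
  descend (isQuotientMap_mk _ _) (fun x => mk J S (upd j (fun _ => 1) x))
    ((mk J S).continuous.comp (continuous_upd j continuous_id continuous_const)) fun x y h => by
      rw [mk_eq_iff] at h ⊢
      rwa [restr_upd hJ, restr_upd hJ, ← restr_erase, ← restr_erase]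

theorem incl_mk (x : Torus k) :
    incl J S j hJ (mk _ _ x) = mk J S (upd j (fun _ => 1) x) := descend_apply ..

/-- The retraction that sets the coordinate `j` to `1`. -/
def retr : C(quotient J S, quotient (J.erase j) S) :=
  descend (isQuotientMap_mk _ _) (mk _ _) (mk _ _).continuous fun x y h => by
    rw [mk_eq_iff] at h ⊢
    rw [restr_erase, restr_erase]
    exact h.upd hI rfl (by simp)

theorem retr_mk (x : Torus k) : retr J S j hI (mk _ _ x) = mk _ _ x := descend_apply ..

theorem continuous_upd_circleShrink :
    Continuous fun p : unitInterval × Torus k => upd j (circleShrink p.1) p.2 := by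
  have h' : Continuous fun p : unitInterval × Torus k => circleShrink p.1 (p.2.1 j) :=
    continuous_circleShrink (by fun_prop) (by fun_prop)
  exact continuous_upd j continuous_snd h'

/-- The deformation that contracts a half-circle in the coordinate `j`. -/
def deform : C(unitInterval × quotient J S, quotient J S) :=
  descendProd (isQuotientMap_mk _ _) (fun p => mk J S (upd j (circleShrink p.1) p.2))
    ((mk J S).continuous.comp (continuous_upd_circleShrink j)) fun x y h t => by
      rw [mk_eq_iff] at h ⊢
      rw [restr_upd hJ, restr_upd hJ]
      exact h.upd hI (circleShrink_apply_one t) (circleShrink_inv t)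

theorem deform_mk (t : unitInterval) (x : Torus k) :
    deform J S j hJ hI (t, mk _ _ x) = mk _ _ (upd j (circleShrink t) x) :=
  descendProd_apply ..

/-- The fibrewise retraction that sets the coordinate `j` to `1`. -/
def retract : FibrewiseRetract (quotient J S) (quotient (J.erase j) S) (Torus k) where
  i := incl J S j hJ
  r := retr J S j hI
  h := deform J S j hJ hI
  π := mk J S
  l := ⟨fun x => circleDist (x.1 j), by fun_prop⟩
  i_pt := by
    rw [← mk_one, incl_mk, ← mk_one]
    congr 1
    ext i
    · by_cases h : i = j
      · subst h
        simp [upd]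
      · simp [upd]
    · rfl
  r_i a := by
    obtain ⟨x, rfl⟩ := (isQuotientMap_mk _ _).surjective a
    rw [incl_mk, retr_mk, mk_eq_iff, restr_erase, restr_upd hJ, upd_upd, restr_erase]
    exact Or.inr (Or.inl rfl)
  h_zero x := by
    obtain ⟨x, rfl⟩ := (isQuotientMap_mk _ _).surjective x
    rw [deform_mk, upd_circleShrink_zero]
  h_i t a := by
    obtain ⟨x, rfl⟩ := (isQuotientMap_mk _ _).surjective a
    rw [incl_mk, deform_mk, upd_upd]
    congr 2
    ext1 z
    exact circleShrink_apply_one t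
  r_h t x := by
    obtain ⟨x, rfl⟩ := (isQuotientMap_mk _ _).surjective x
    rw [deform_mk, retr_mk, retr_mk, mk_eq_iff, restr_erase, restr_upd hJ,
      upd_upd, restr_erase]
    exact Or.inr (Or.inl rfl)
  quot := isQuotientMap_mk _ _
  -- Collapsed points may have different `j`-th coordinates, but they lie over the basepoint. The
  -- involution conjugates the coordinate, which does not change its distance to `1`.
  l_eq x y h := by
    rw [mk_eq_iff] at h
    rcases h with h | h | h
    · exact Or.inl (mk_eq_pt h.1)
    · right
      have := congrFun (congrArg Prod.fst h) j
      simp only [restr, hJ, if_true] at this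
      simp [this]
    · right
      have := congrFun (congrArg Prod.fst h) j
      simp only [restr, hJ, if_true, flip, Pi.inv_apply] at this
      simp [this, circleDist_inv]
  l_i x a h := by
    obtain ⟨y, rfl⟩ := (isQuotientMap_mk _ _).surjective a
    rw [incl_mk, mk_eq_iff, restr_upd hJ] at h
    rcases h with h | h | h
    · exact Or.inl (mk_eq_pt h.1)
    · right
      have := congrFun (congrArg Prod.fst h) j
      simp only [restr, hJ, if_true, upd, Function.update_self] at this
      simp [this, circleDist_one]
    · right
      have := congrFun (congrArg Prod.fst h) j
      simp only [restr, hJ, if_true, flip, upd, Function.update_self, Pi.inv_apply, inv_one] at this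
      simp [this, circleDist_one]
  h_one x h := by
    rw [deform_mk, retr_mk, incl_mk]
    congr 1
    simp only [upd]
    rw [circleShrink_of_circleDist h]

theorem retract_i (J S : Finset (Fin k)) (j : Fin k) (hJ : j ∈ J) (hI : j ∉ S) (x : Torus k) :
    (retract J S j hJ hI).i (mk _ _ x) = mk J S (upd j (fun _ => 1) x) :=
  incl_mk J S j hJ x

theorem mk_mem_range_i (x : Torus k) :
    mk J S x ∈ range (retract J S j hJ hI).i ↔ Fat (insert j S) (restr J x) := by
  have key : Fat (insert j S) (restr J x) ↔ x.1 j = 1 ∨ Fat S (restr J x) := by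
    unfold Fat
    rw [Finset.exists_mem_insert, or_assoc]
    simp [restr, hJ]
  rw [key]
  constructor
  · rintro ⟨a, ha⟩
    obtain ⟨y, rfl⟩ := (isQuotientMap_mk _ _).surjective a
    rw [retract_i, eq_comm, mk_eq_iff, restr_upd hJ] at ha
    rcases ha with h | h | h
    · exact Or.inr h.1
    · left
      have := congrFun (congrArg Prod.fst h) j
      simpa only [restr, hJ, if_true, upd, Function.update_self] using this
    · left
      have := congrFun (congrArg Prod.fst h) j
      simpa only [restr, hJ, if_true, flip, upd, Function.update_self, Pi.inv_apply,
        inv_one] using this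
  · rintro (h | h)
    · refine ⟨mk _ _ x, ?_⟩
      rw [retract_i]
      congr 1
      simp only [upd]
      rw [← h, Function.update_eq_self]
    · rw [mk_eq_pt h]
      exact ⟨_, (retract J S j hJ hI).i_pt⟩

/-- The retract consists of the classes whose coordinate `j` can be taken to be `1`, together with
the basepoint. Collapsing it therefore enlarges the collapsed set by the condition for `j`. -/
theorem cof_retract :
    PointedHomotopyEquivalent (retract J S j hJ hI).cof (quotient J (insert j S)) := by
  refine .of_covers (retract J S j hJ hI).quot_cof (isQuotientMap_mk J (insert j S)) (fun x y => ?_)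
    (e₀ := 1) rfl (mk_one _ _)
  rw [collapseMk_eq_iff]
  change mk J S x = mk J S y ∨ mk J S x ∈ _ ∧ mk J S y ∈ _ ↔ _
  rw [mk_mem_range_i, mk_mem_range_i, mk_eq_iff, mk_eq_iff]
  have hF : ∀ z, Fat S z → Fat (insert j S) z := by
    rintro z (⟨i, hi, h⟩ | h)
    · exact Or.inl ⟨i, Finset.mem_insert_of_mem hi, h⟩
    · exact Or.inr h
  constructor
  · rintro ((h | h) | h)
    · exact Or.inl ⟨hF _ h.1, hF _ h.2⟩
    · exact Or.inr h
    · exact Or.inl h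
  · rintro (h | h)
    · exact Or.inr h
    · exact Or.inl (Or.inr h)

theorem susp_quotient_split (hJ : j ∈ J) (hI : j ∉ S) :
    PointedHomotopyEquivalent (reducedSuspension (quotient J S))
      (wedge (reducedSuspension (quotient (J.erase j) S))
        (reducedSuspension (quotient J (insert j S)))) :=
  (retract J S j hJ hI).equivalent.trans ((PointedHomotopyEquivalent.refl _).wedge
    (cof_retract J S j hJ hI).susp)

/-- Each splitting decides whether a coordinate `j ∈ J \ S` is dropped or added to `S`. After all
decisions `S = J = K`, and every `K` between `S` and `J` occurs once. -/
theorem susp_quotient (h : S ⊆ J) :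
    PointedHomotopyEquivalent (reducedSuspension (quotient J S))
      (bigWedge fun K : {K : Finset (Fin k) // S ⊆ K ∧ K ⊆ J} =>
        reducedSuspension (quotient K.1 K.1)) := by
  induction hn : (J \ S).card generalizing S J with
  | zero =>
    obtain rfl : S = J := h.antisymm (Finset.sdiff_eq_empty_iff_subset.1 (Finset.card_eq_zero.1 hn))
    let _ : Unique {K : Finset (Fin k) // S ⊆ K ∧ K ⊆ S} :=
      { default := ⟨S, subset_rfl, subset_rfl⟩
        uniq := fun K => Subtype.ext (K.2.2.antisymm K.2.1) }
    exact (PointedHomotopyEquivalent.bigWedge_unique (X := fun K : {K : Finset (Fin k) //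
      S ⊆ K ∧ K ⊆ S} => reducedSuspension (quotient K.1 K.1))).symm
  | succ n ih =>
    obtain ⟨j, hj⟩ : (J \ S).Nonempty := Finset.card_pos.1 (by omega)
    obtain ⟨hJ, hI⟩ := Finset.mem_sdiff.1 hj
    have hc1 : (J.erase j \ S).card = n := by
      rw [Finset.erase_sdiff_comm, Finset.card_erase_of_mem hj, hn]
      rfl
    have hc2 : (J \ insert j S).card = n := by
      rw [Finset.sdiff_insert, Finset.card_erase_of_mem hj, hn]
      rfl
    have hs1 : S ⊆ J.erase j := Finset.subset_erase.2 ⟨h, hI⟩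
    have hs2 : insert j S ⊆ J := Finset.insert_subset hJ h
    -- The sets `K` between `S` and `J` are sorted by whether they contain `j`.
    let e : {K : Finset (Fin k) // S ⊆ K ∧ K ⊆ J.erase j} ⊕
        {K : Finset (Fin k) // insert j S ⊆ K ∧ K ⊆ J} ≃ {K : Finset (Fin k) // S ⊆ K ∧ K ⊆ J} :=
      Equiv.ofBijective (Sum.elim
        (fun K => ⟨K.1, K.2.1, K.2.2.trans (Finset.erase_subset _ _)⟩)
        (fun K => ⟨K.1, (Finset.subset_insert _ _).trans K.2.1, K.2.2⟩)) (by
      constructor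
      · rintro (⟨K, hK⟩ | ⟨K, hK⟩) (⟨K', hK'⟩ | ⟨K', hK'⟩) h
        · simpa using h
        · simp only [Sum.elim_inl, Sum.elim_inr, Subtype.mk.injEq] at h
          subst h
          exact absurd (hK.2 (hK'.1 (Finset.mem_insert_self _ _))) (Finset.notMem_erase _ _)
        · simp only [Sum.elim_inl, Sum.elim_inr, Subtype.mk.injEq] at h
          subst h
          exact absurd (hK'.2 (hK.1 (Finset.mem_insert_self _ _))) (Finset.notMem_erase _ _)
        · simpa using h
      · rintro ⟨K, hK⟩
        by_cases hj : j ∈ K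
        · exact ⟨Sum.inr ⟨K, Finset.insert_subset hj hK.1, hK.2⟩, rfl⟩
        · exact ⟨Sum.inl ⟨K, hK.1, Finset.subset_erase.2 ⟨hK.2, hj⟩⟩, rfl⟩)
    refine (susp_quotient_split J S j hJ hI).trans ?_
    refine ((ih _ _ hs1 hc1).wedge (ih _ _ hs2 hc2)).trans ?_
    exact (PointedHomotopyEquivalent.bigWedge_sum _).symm.trans
      (PointedHomotopyEquivalent.bigWedge_reindex (Y := fun K : {K : Finset (Fin k) //
        S ⊆ K ∧ K ⊆ J} => reducedSuspension (quotient K.1 K.1)) e)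

end Torus

/-! ### Klein bottles as quotients of the torus -/

section Klein

variable {k : ℕ}

theorem torusInvolution_torusInvolution (n : ℕ) (z : Fin n → Circle) :
    torusInvolution n (torusInvolution n z) = z := by
  ext j
  by_cases h : (j : ℕ) + 1 = n <;> simp [torusInvolution, h]

/-- The defining relation is only the graph of the involution. Since that map has order two, the
generated equivalence has its orbits as classes. -/
theorem klein_mk_eq_iff {n : ℕ} {z w : Fin n → Circle} :
    Quot.mk (fun z w : Fin n → Circle => w = torusInvolution n z) z = Quot.mk _ w ↔
      z = w ∨ z = torusInvolution n w := by
  have key : ∀ z w : Fin n → Circle,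
      Relation.EqvGen (fun z w : Fin n → Circle => w = torusInvolution n z) z w →
        z = w ∨ z = torusInvolution n w := by
    intro z w h
    induction h with
    | rel x y h => exact Or.inr (by rw [h, torusInvolution_torusInvolution])
    | refl x => exact Or.inl rfl
    | symm x y _ ih =>
      rcases ih with h | h
      · exact Or.inl h.symm
      · exact Or.inr (by rw [h, torusInvolution_torusInvolution])
    | trans x y z _ _ ih ih' =>
      rcases ih with rfl | h <;> rcases ih' with rfl | h'
      · exact Or.inl rfl
      · exact Or.inr h'
      · exact Or.inr h
      · exact Or.inl (by rw [h, h', torusInvolution_torusInvolution])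
  refine ⟨fun h => key _ _ (Quot.eqvGen_exact h), ?_⟩
  rintro (rfl | h)
  · rfl
  · exact Eq.symm (Quot.sound (r := fun z w : Fin n → Circle => w = torusInvolution n z) h)

/-- The homeomorphism of the torus onto the product of `k + 1` circles that commutes with the
involutions and sends the point `1` to the point with coordinates `exp (θ j)` and `b`. -/
def torusHomeo (θ : Fin k → ℝ) (b : Circle) : Torus k ≃ₜ (Fin (k + 1) → Circle) where
  -- The rotation angle `θ j * Re x.2` equals `θ j` at `x.2 = 1` and changes sign with `x.2`.
  -- Conjugating the coordinate reverses the rotation, so the map commutes with the involutions.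
  toFun x := Fin.snoc (α := fun _ => Circle)
    (fun j => x.1 j * Circle.exp (θ j * (x.2 : ℂ).re)) (x.2 * b)
  invFun y := (fun j => y j.castSucc *
      Circle.exp (-(θ j * ((y (Fin.last k) * b⁻¹ : Circle) : ℂ).re)),
    y (Fin.last k) * b⁻¹)
  left_inv x := by
    ext j
    · simp [mul_assoc]
    · simp
  right_inv y := by
    ext j
    refine Fin.lastCases ?_ (fun j => ?_) j
    · simp
    · simp [mul_assoc]
  continuous_toFun := by
    refine continuous_pi fun j => Fin.lastCases ?_ (fun j => ?_) j
    · simp only [Fin.snoc_last]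
      fun_prop
    · simp only [Fin.snoc_castSucc]
      fun_prop
  continuous_invFun := by fun_prop

theorem torusHomeo_flip (θ : Fin k → ℝ) (b : Circle) (x : Torus k) :
    torusHomeo θ b x.flip = torusInvolution (k + 1) (torusHomeo θ b x) := by
  ext j
  refine Fin.lastCases ?_ (fun j => ?_) j
  · simp [torusHomeo, torusInvolution, Torus.flip]
  · have : (j : ℕ) ≠ k := j.2.ne
    simp [torusHomeo, torusInvolution, Torus.flip, this, mul_comm]

/-- An equivariant homeomorphism moves the point `1` to a representative of the chosen basepoint, so
all basepoints are equally good. -/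
theorem klein_equivalent (x₀ : Klein (k + 1)) :
    PointedHomotopyEquivalent { carrier := Klein (k + 1), pt := x₀ }
      (Torus.quotient (Finset.univ : Finset (Fin k)) ∅) := by
  obtain ⟨y, rfl⟩ := Quot.exists_rep x₀
  have hθ : ∀ j : Fin k, ∃ θ : ℝ, Circle.exp θ = y j.castSucc := fun j =>
    ⟨_, Circle.exp_arg _⟩
  choose θ hθ using hθ
  have hQ : IsQuotientMap fun x : Torus k =>
      (Quot.mk _ (torusHomeo θ (y (Fin.last k)) x) : Klein (k + 1)) :=
    isQuotientMap_quot_mk.comp (torusHomeo θ (y (Fin.last k))).isQuotientMap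
  refine .of_covers (Y := Torus.quotient (Finset.univ : Finset (Fin k)) ∅) hQ
    (Torus.isQuotientMap_mk _ _) (fun x x' => ?_) (e₀ := 1) ?_ (Torus.mk_one _ _)
  · refine klein_mk_eq_iff.trans ?_
    rw [← torusHomeo_flip, (torusHomeo θ _).injective.eq_iff, (torusHomeo θ _).injective.eq_iff,
      Torus.mk_eq_iff]
    have : ∀ x : Torus k, Torus.restr Finset.univ x = x := fun x => by simp [Torus.restr]
    rw [this, this]
    refine ⟨Or.inr, ?_⟩
    rintro (⟨h, h'⟩ | h)
    -- For `S = ∅` the collapsed set is the single orbit of `1`, so nothing new is identified.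
    · simp only [Torus.Fat, Finset.notMem_empty, false_and, exists_false, false_or] at h h'
      rcases h with ⟨h, h2⟩
      rcases h' with ⟨h', h2'⟩
      rcases h2 with h2 | h2 <;> rcases h2' with h2' | h2'
      · exact Or.inl (Prod.ext (h.trans h'.symm) (h2.trans h2'.symm))
      · exact Or.inr (Prod.ext (by simp [Torus.flip, h, h']) (by simp [Torus.flip, h2, h2']))
      · exact Or.inr (Prod.ext (by simp [Torus.flip, h, h']) (by simp [Torus.flip, h2, h2']))
      · exact Or.inl (Prod.ext (h.trans h'.symm) (h2.trans h2'.symm))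
    · exact h
  · change Quot.mk _ _ = Quot.mk _ _
    congr 1
    ext j
    refine Fin.lastCases ?_ (fun j => ?_) j
    · simp [torusHomeo]
    · simp [torusHomeo, hθ]

theorem susp_klein (x₀ : Klein (k + 1)) :
    PointedHomotopyEquivalent (reducedSuspension { carrier := Klein (k + 1), pt := x₀ })
      (bigWedge fun K : Finset (Fin k) => reducedSuspension (Torus.quotient K K)) := by
  refine (klein_equivalent x₀).susp.trans
    ((Torus.susp_quotient Finset.univ ∅ (Finset.empty_subset _)).trans ?_)
  exact PointedHomotopyEquivalent.bigWedge_reindex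
    (Y := fun K : Finset (Fin k) => reducedSuspension (Torus.quotient K K))
    (Equiv.subtypeUnivEquiv fun K => ⟨Finset.empty_subset _, Finset.subset_univ _⟩)

end Klein

/-! ### One-point compactifications -/

section OnePoint

open OnePoint

/-- The one-point compactification, pointed by the point at infinity. -/
def onePt (V : Type) [TopologicalSpace V] : PointedSpace where
  carrier := OnePoint V
  pt := ∞

instance (V : Type) [TopologicalSpace V] : CompactSpace (onePt V) :=
  inferInstanceAs (CompactSpace (OnePoint V))

variable {P W : Type*} {e : W → P}

open Classical in
/-- The map to the one-point compactification of an open subset that sends the complement of the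
subset to the point at infinity. -/
def collapseOnto (e : W → P) (p : P) : OnePoint W :=
  if h : ∃ w, e w = p then (h.choose : OnePoint W) else ∞

theorem collapseOnto_apply (he : Function.Injective e) (w : W) : collapseOnto e (e w) = w := by
  have h : ∃ w', e w' = e w := ⟨w, rfl⟩
  rw [collapseOnto, dif_pos h, he h.choose_spec]

theorem collapseOnto_of_notMem {p : P} (h : p ∉ range e) : collapseOnto e p = ∞ := dif_neg h

/-- This is the Pontryagin–Thom collapse. At a point outside the subset, continuity holds because
the image of a compact set is closed in `P`. -/
theorem continuous_collapseOnto [TopologicalSpace P] [TopologicalSpace W] [T2Space P] [T2Space W]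
    (he : IsOpenEmbedding e) :
    Continuous (collapseOnto e) := by
  rw [continuous_iff_continuousAt]
  intro p
  by_cases hp : p ∈ range e
  · obtain ⟨w, rfl⟩ := hp
    rw [he.continuousAt_iff.symm]
    have : collapseOnto e ∘ e = ((↑) : W → OnePoint W) :=
      funext fun w : W => collapseOnto_apply he.injective w
    rw [this]
    exact continuous_coe.continuousAt
  · rw [ContinuousAt, collapseOnto_of_notMem hp, hasBasis_nhds_infty.tendsto_right_iff]
    rintro s ⟨-, hs⟩
    have hc : IsClosed (e '' s) := (hs.image he.continuous).isClosed
    have hp' : p ∉ e '' s := fun h => hp (image_subset_range _ _ h)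
    filter_upwards [hc.isOpen_compl.mem_nhds hp'] with q hq
    by_cases hq' : q ∈ range e
    · obtain ⟨w, rfl⟩ := hq'
      rw [collapseOnto_apply he.injective]
      exact Or.inl ⟨w, fun h => hq ⟨w, h, rfl⟩, rfl⟩
    · rw [collapseOnto_of_notMem hq']
      exact Or.inr rfl

theorem continuous_map_of_isProperMap {V : Type*} [TopologicalSpace W] [TopologicalSpace V]
    [T2Space V] [T2Space W] [WeaklyLocallyCompactSpace V] {f : W → V} (hf : IsProperMap f) :
    Continuous (OnePoint.map f) := by
  refine continuous_map hf.continuous ?_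
  rw [Filter.coclosedCompact_eq_cocompact, Filter.coclosedCompact_eq_cocompact]
  exact (isProperMap_iff_tendsto_cocompact.1 hf).2

/-- The recognition principle for all the compactifications below: a quotient of a compact space is
`V ∪ {∞}` if it identifies all points outside an open part and identifies inside points exactly as a
proper surjection to `V` does. The map to `OnePoint V` is the collapse followed by the extension of
`f`. -/
theorem PointedHomotopyEquivalent.onePt_of_cover {Y : PointedSpace} {C P W : Type*} {V : Type}
    [TopologicalSpace C]
    [CompactSpace C] [TopologicalSpace P] [T2Space P] [TopologicalSpace W] [T2Space W]
    [TopologicalSpace V] [T2Space V] [WeaklyLocallyCompactSpace V] {π : C → Y}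
    (hπ : IsQuotientMap π) {ρ : C → P} (hρ : Continuous ρ) (hρs : Function.Surjective ρ)
    {e : W → P} (he : IsOpenEmbedding e) {f : W → V} (hf : IsProperMap f)
    (hfs : Function.Surjective f) {c₀ : C} (h₀ : π c₀ = Y.pt) (h₀' : ρ c₀ ∉ range e)
    (hout : ∀ c c', ρ c ∉ range e → (π c = π c' ↔ ρ c' ∉ range e))
    (hin : ∀ c c' w w', ρ c = e w → ρ c' = e w' → (π c = π c' ↔ f w = f w')) :
    PointedHomotopyEquivalent Y (onePt V) := by
  have hFe : ∀ c w, ρ c = e w → OnePoint.map f (collapseOnto e (ρ c)) = f w := by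
    intro c w h
    rw [h, collapseOnto_apply he.injective, OnePoint.map_some]
  have hF0 : ∀ c, ρ c ∉ range e → OnePoint.map f (collapseOnto e (ρ c)) = ∞ := by
    intro c h
    rw [collapseOnto_of_notMem h, OnePoint.map_infty]
  refine of_same_range (Y := onePt V) (Z := OnePoint V) hπ (ρ := id) IsQuotientMap.id
    (F := fun c => OnePoint.map f (collapseOnto e (ρ c))) (G := id) (c := c₀) (d := ∞)
    ((continuous_map_of_isProperMap hf).comp ((continuous_collapseOnto he).comp hρ))
    continuous_id ?_ (fun _ _ => Iff.rfl) ?_ h₀ rfl (hF0 _ h₀')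
  · intro c c'
    by_cases h : ρ c ∈ range e <;> by_cases h' : ρ c' ∈ range e
    · obtain ⟨w, hw⟩ := h
      obtain ⟨w', hw'⟩ := h'
      rw [hFe c w hw.symm, hFe c' w' hw'.symm, hin c c' w w' hw.symm hw'.symm, coe_eq_coe]
    · obtain ⟨w, hw⟩ := id h
      rw [hFe c w hw.symm, hF0 c' h', eq_comm, hout c' c h']
      simp [h]
    · obtain ⟨w, hw⟩ := id h'
      rw [hFe c' w hw.symm, hF0 c h, hout c c' h]
      simp [h']
    · rw [hF0 c h, hF0 c' h', hout c c' h]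
      simp [h']
  · refine Eq.trans (Function.Surjective.range_eq ?_) range_id.symm
    intro z
    induction z using OnePoint.rec with
    | infty => exact ⟨c₀, hF0 _ h₀'⟩
    | coe v =>
      obtain ⟨w, rfl⟩ := hfs v
      obtain ⟨c, hc⟩ := hρs (e w)
      exact ⟨c, hFe c w hc⟩

theorem IsOpenEmbedding.of_leftInverse {W P : Type*} [TopologicalSpace W] [TopologicalSpace P]
    {e : W → P} (he : Continuous e) (hr : IsOpen (range e)) (g : P → W)
    (hg : ContinuousOn g (range e)) (hge : ∀ w, g (e w) = w) : IsOpenEmbedding e :=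
  OpenPartialHomeomorph.isOpenEmbedding
    { toFun := e
      invFun := g
      source := univ
      target := range e
      map_source' := fun w _ => mem_range_self w
      map_target' := fun _ _ => mem_univ _
      left_inv' := fun w _ => hge w
      right_inv' := by
        rintro _ ⟨w, rfl⟩
        rw [hge]
      open_source := isOpen_univ
      open_target := hr
      continuousOn_toFun := he.continuousOn
      continuousOn_invFun := hg } rfl

theorem isOpenEmbedding_sigmoid : IsOpenEmbedding unitInterval.sigmoid :=
  ⟨isEmbedding_sigmoid, by rw [unitInterval.range_sigmoid]; exact isOpen_Ioo⟩

theorem mem_range_sigmoid {s : I} : s ∈ range unitInterval.sigmoid ↔ ¬(s = 0 ∨ s = 1) := by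
  rw [unitInterval.range_sigmoid, mem_Ioo, not_or, unitInterval.pos_iff_ne_zero,
    unitInterval.lt_one_iff_ne_one]

/-- The suspension without its basepoint is `V × (0, 1)`, and the sigmoid identifies `ℝ` with `(0,
1)`. -/
theorem susp_onePt (V : Type) [TopologicalSpace V] [T2Space V] [LocallyCompactSpace V] :
    PointedHomotopyEquivalent (reducedSuspension (onePt V)) (onePt (V × ℝ)) := by
  have hr : ∀ c : OnePoint V × I, c ∉ range (Prod.map ((↑) : V → OnePoint V) unitInterval.sigmoid) ↔
      (c.2 = 0 ∨ c.2 = 1 ∨ c.1 = ∞) := by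
    rintro ⟨y, s⟩
    rw [range_prodMap, mem_prod, mem_range_sigmoid, ← compl_infty, mem_compl_singleton_iff]
    tauto
  refine .onePt_of_cover (C := OnePoint V × I) (isQuotientMap_suspPoint (X := onePt V)
    IsQuotientMap.id) continuous_id Function.surjective_id
    (isOpenEmbedding_coe.prodMap isOpenEmbedding_sigmoid) isProperMap_id Function.surjective_id
    (c₀ := (∞, 0)) (suspPoint_eq_pt (by simp)) ?_ ?_ ?_
  · rw [id, hr]
    simp
  · rintro c c' h
    rw [id, hr] at h ⊢
    refine suspPoint_eq_iff.trans ⟨?_, fun h' => Or.inr ⟨h, h'⟩⟩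
    rintro (⟨h1, h2⟩ | h')
    · change c.1 = c'.1 at h1
      rwa [h1, h2] at h
    · exact h'.2
  · rintro c c' w w' hw hw'
    have hw0 : c ∈ range _ := ⟨w, hw.symm⟩
    rw [← not_not (a := _ ∈ _), hr] at hw0
    refine suspPoint_eq_iff.trans ⟨?_, ?_⟩
    · rintro (⟨h1, h2⟩ | h')
      · refine (isOpenEmbedding_coe.prodMap isOpenEmbedding_sigmoid).injective ?_
        exact hw.symm.trans ((Prod.ext h1 h2 : c = c').trans hw')
      · exact absurd h'.1 hw0
    · intro h
      have : c = c' := hw.trans ((congrArg _ h).trans hw'.symm)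
      rw [this]
      exact Or.inl ⟨rfl, rfl⟩

theorem onePt_congr {V W : Type} [TopologicalSpace V] [TopologicalSpace W] (h : V ≃ₜ W) :
    PointedHomotopyEquivalent (onePt V) (onePt W) :=
  .of_inverse (X := onePt V) (Y := onePt W) ⟨h.onePointCongr, h.onePointCongr.continuous⟩
    ⟨h.onePointCongr.symm, h.onePointCongr.symm.continuous⟩ rfl
    (fun x => h.onePointCongr.symm_apply_apply x) (fun x => h.onePointCongr.apply_symm_apply x)

theorem onePt_sphere (V : Type) [AddCommGroup V] [Module ℝ V] [FiniteDimensional ℝ V]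
    [TopologicalSpace V] [IsTopologicalAddGroup V] [ContinuousSMul ℝ V] [T2Space V] (k : ℕ)
    (h : Module.finrank ℝ V = k) : PointedHomotopyEquivalent (onePt V) (sphere k) := by
  let v : EuclideanSpace ℝ (Fin (k + 1)) := EuclideanSpace.single 0 1
  have hv : ‖v‖ = 1 := by simp [v]
  have hv₀ : v ≠ 0 := fun h => by simp [h] at hv
  have : Fact (Module.finrank ℝ (EuclideanSpace ℝ (Fin (k + 1))) = k + 1) := ⟨by simp⟩
  -- Stereographic projection from `v` needs the hyperplane orthogonal to `v`. The point at infinity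
  -- goes to `v`, the basepoint of the sphere.
  have hV : Module.finrank ℝ V = Module.finrank ℝ (Submodule.span ℝ {v})ᗮ :=
    h.trans (Submodule.finrank_orthogonal_span_singleton hv₀).symm
  obtain ⟨e⟩ := FiniteDimensional.nonempty_continuousLinearEquiv_of_finrank_eq hV
  refine (onePt_congr e.toHomeomorph).trans ?_
  let f := onePointHyperplaneHomeoUnitSphere hv
  exact .of_inverse (X := onePt _) (Y := sphere k) ⟨f, f.continuous⟩ ⟨f.symm, f.symm.continuous⟩ rfl
    (fun x => f.symm_apply_apply x) (fun x => f.apply_symm_apply x)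

end OnePoint

/-! ### The circle as a one-point compactification -/

/-- The Cayley transform `a ↦ (a + i) / (a - i)`. -/
def cayley (a : ℝ) : Circle :=
  ⟨⟨(a ^ 2 - 1) / (a ^ 2 + 1), 2 * a / (a ^ 2 + 1)⟩, by
    have : a ^ 2 + 1 ≠ 0 := by positivity
    refine mem_sphere_zero_iff_norm.2 ?_
    rw [← sq_eq_sq₀ (norm_nonneg _) zero_le_one, Complex.sq_norm, Complex.normSq_mk]
    field_simp
    ring⟩

theorem cayley_re (a : ℝ) : (cayley a : ℂ).re = (a ^ 2 - 1) / (a ^ 2 + 1) := rfl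

theorem cayley_im (a : ℝ) : (cayley a : ℂ).im = 2 * a / (a ^ 2 + 1) := rfl

theorem circle_ext_re_im {z w : Circle} (hr : (z : ℂ).re = (w : ℂ).re)
    (hi : (z : ℂ).im = (w : ℂ).im) : z = w := Circle.ext (Complex.ext hr hi)

theorem circle_re_sq_add_im_sq (z : Circle) : (z : ℂ).re ^ 2 + (z : ℂ).im ^ 2 = 1 := by
  have := Circle.normSq_coe z
  rw [Complex.normSq_apply] at this
  linarith

theorem circle_re_ne_one {z : Circle} (hz : z ≠ 1) : 1 - (z : ℂ).re ≠ 0 := by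
  intro h
  have h1 := circle_re_sq_add_im_sq z
  have h2 : (z : ℂ).re = 1 := by linarith
  rw [h2] at h1
  refine hz (circle_ext_re_im (by simp [h2]) ?_)
  have : (z : ℂ).im ^ 2 = 0 := by linarith
  simpa using this

/-- This turns the involution of the torus into the antipodal map of `ℝ^K × S¹`. -/
theorem cayley_neg (a : ℝ) : cayley (-a) = (cayley a)⁻¹ := by
  refine circle_ext_re_im ?_ ?_
  · rw [Circle.coe_inv_eq_conj, Complex.conj_re, cayley_re, cayley_re, neg_sq]
  · rw [Circle.coe_inv_eq_conj, Complex.conj_im, cayley_im, cayley_im, neg_sq]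
    ring

theorem continuous_cayley : Continuous cayley := by
  have h : ∀ a : ℝ, a ^ 2 + 1 ≠ 0 := fun a => by positivity
  refine Continuous.subtype_mk ?_ _
  refine Complex.equivRealProdCLM.symm.continuous.comp
    (f := fun a : ℝ => ((a ^ 2 - 1) / (a ^ 2 + 1), 2 * a / (a ^ 2 + 1))) ?_
  exact (Continuous.div (by fun_prop) (by fun_prop) h).prodMk
    (Continuous.div (by fun_prop) (by fun_prop) h)

theorem range_cayley : range cayley = {1}ᶜ := by
  ext z
  rw [mem_compl_singleton_iff]
  constructor
  · rintro ⟨a, rfl⟩ h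
    have := congrArg (fun z : Circle => (z : ℂ).re) h
    simp only [cayley_re, Circle.coe_one, Complex.one_re] at this
    rw [div_eq_one_iff_eq (by positivity)] at this
    linarith
  · intro hz
    have h := circle_re_ne_one hz
    have h1 := circle_re_sq_add_im_sq z
    -- Stereographic projection from the point `1`.
    refine ⟨(z : ℂ).im / (1 - (z : ℂ).re), ?_⟩
    have h2 : ((z : ℂ).im / (1 - (z : ℂ).re)) ^ 2 + 1 = 2 / (1 - (z : ℂ).re) := by
      field_simp
      linear_combination h1
    refine circle_ext_re_im ?_ ?_
    · rw [cayley_re, h2, show ((z : ℂ).im / (1 - (z : ℂ).re)) ^ 2 - 1 =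
        2 / (1 - (z : ℂ).re) - 2 by linarith]
      field_simp
      ring
    · rw [cayley_im, h2]
      field_simp

theorem mem_range_cayley {z : Circle} : z ∈ range cayley ↔ z ≠ 1 := by
  rw [range_cayley, mem_compl_singleton_iff]

theorem isOpenEmbedding_cayley : IsOpenEmbedding cayley := by
  refine IsOpenEmbedding.of_leftInverse continuous_cayley (by
    rw [range_cayley]
    exact isOpen_compl_singleton) (fun z => (z : ℂ).im / (1 - (z : ℂ).re)) ?_ fun a => ?_
  · refine ContinuousOn.div (by fun_prop) (by fun_prop) fun z hz => circle_re_ne_one ?_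
    exact mem_range_cayley.1 hz
  · rw [cayley_re, cayley_im]
    have : a ^ 2 + 1 ≠ 0 := by positivity
    have h : 1 - (a ^ 2 - 1) / (a ^ 2 + 1) = 2 / (a ^ 2 + 1) := by
      field_simp
      ring
    rw [h]
    field_simp

theorem circle_sq_eq_iff {z w : Circle} : z ^ 2 = w ^ 2 ↔ z = w ∨ z = -w := by
  rw [← Circle.coe_inj, ← Circle.coe_inj, ← Circle.coe_inj]
  simpa using sq_eq_sq_iff_eq_or_eq_neg (a := (z : ℂ)) (b := w)

theorem circle_exists_sq (z : Circle) : ∃ w : Circle, w ^ 2 = z :=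
  ⟨Circle.exp ((z : ℂ).arg / 2), by
    rw [sq, ← Circle.exp_add, add_halves, Circle.exp_arg]⟩

/-! ### Compactifications and the torus -/

section Models

variable {k : ℕ}

namespace Torus

/-- With no coordinates left the involution is `w ↦ -w` on the last circle, and squaring is the
quotient map by it. -/
theorem mk_empty_eq_iff {x y : Torus k} : mk ∅ ∅ x = mk ∅ ∅ y ↔ x.2 ^ 2 = y.2 ^ 2 := by
  have h : ∀ x : Torus k, restr ∅ x = (1, x.2) := fun x => by
    ext j <;> simp [restr]
  have hf : ∀ x : Torus k, flip (restr ∅ x) = (1, -x.2) := fun x => by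
    rw [h]
    simp [flip]
  have hF : ∀ x : Torus k, Fat ∅ (restr ∅ x) ↔ x.2 ^ 2 = 1 := fun x => by
    have := circle_sq_eq_iff (z := x.2) (w := 1)
    rw [one_pow] at this
    rw [this, h]
    simp [Fat]
  rw [mk_eq_iff, Rel, hF, hF, hf, h, h, Prod.mk.injEq, Prod.mk.injEq, circle_sq_eq_iff]
  constructor
  · rintro (⟨h, h'⟩ | h | h)
    · exact circle_sq_eq_iff.1 (h.trans h'.symm)
    · exact Or.inl h.2
    · exact Or.inr h.2
  · rintro (h | h)
    · exact Or.inr (Or.inl ⟨rfl, h⟩)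
    · exact Or.inr (Or.inr ⟨rfl, h⟩)

theorem quotient_empty :
    PointedHomotopyEquivalent (quotient (∅ : Finset (Fin k)) ∅) (onePt ℝ) := by
  refine .onePt_of_cover (C := Torus k) (isQuotientMap_mk _ _) (ρ := fun x => x.2 ^ 2)
    (by fun_prop) ?_ isOpenEmbedding_cayley isProperMap_id Function.surjective_id (c₀ := 1)
    (mk_one _ _) ?_ ?_ ?_
  · intro z
    obtain ⟨w, hw⟩ := circle_exists_sq z
    exact ⟨(1, w), hw⟩
  · rw [mem_range_cayley]
    simp
  · intro x y h
    rw [mem_range_cayley, not_not] at h ⊢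
    rw [mk_empty_eq_iff, h, eq_comm]
  · intro x y a b ha hb
    rw [mk_empty_eq_iff, ha, hb, isOpenEmbedding_cayley.injective.eq_iff]
    rfl

/-- The coordinates in `K`. -/
def coords {K : Finset (Fin k)} {T : Type} (ε : T ≃ K) (x : Torus k) : (T → Circle) × Circle :=
  (fun s => x.1 (ε s), x.2)

theorem restr_eq_iff {K : Finset (Fin k)} {T : Type} (ε : T ≃ K) {x y : Torus k} :
    restr K x = restr K y ↔ coords ε x = coords ε y := by
  constructor
  · intro h
    refine Prod.ext (funext fun s => ?_) (Prod.ext_iff.1 h).2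
    have h' : x.1 (ε s) = y.1 (ε s) := by
      simpa [restr] using congrFun (congrArg Prod.fst h) (ε s)
    exact h'
  · intro h
    refine Prod.ext (funext fun i => ?_) (Prod.ext_iff.1 h).2
    by_cases hi : i ∈ K
    · have := congrFun (congrArg Prod.fst h) (ε.symm ⟨i, hi⟩)
      simpa [restr, hi, coords] using this
    · simp [restr, hi]

theorem coords_surjective {K : Finset (Fin k)} {T : Type} (ε : T ≃ K) :
    Function.Surjective (coords ε) := by
  rintro ⟨y, w⟩
  refine ⟨(fun i => if h : i ∈ K then y (ε.symm ⟨i, h⟩) else 1, w), ?_⟩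
  refine Prod.ext (funext fun s => ?_) rfl
  simp [coords]

theorem continuous_coords {K : Finset (Fin k)} {T : Type} (ε : T ≃ K) :
    Continuous (coords ε) := by
  unfold coords
  fun_prop

/-- The points over the basepoint have all their coordinates in `K` equal to `1`, so for nonempty
`K` they add nothing. -/
theorem fat_restr_self {K : Finset (Fin k)} (hK : K.Nonempty) {x : Torus k} :
    Fat K (restr K x) ↔ ∃ i ∈ K, x.1 i = 1 := by
  constructor
  · rintro (⟨i, hi, h⟩ | ⟨h, -⟩)
    · exact ⟨i, hi, by simpa [restr, hi] using h⟩
    · obtain ⟨i, hi⟩ := hK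
      refine ⟨i, hi, ?_⟩
      have := congrFun h i
      simpa [restr, hi] using this
  · rintro ⟨i, hi, h⟩
    exact Or.inl ⟨i, hi, by simpa [restr, hi] using h⟩

/-- The open part of the torus on which all coordinates differ from `1`. -/
def cayleyCoords (T : Type) (p : (T → ℝ) × Circle) : (T → Circle) × Circle :=
  Prod.map (Pi.map fun _ => cayley) id p

theorem isOpenEmbedding_cayleyCoords (T : Type) [Finite T] :
    IsOpenEmbedding (cayleyCoords T) :=
  (IsOpenEmbedding.piMap fun _ => isOpenEmbedding_cayley).prodMap IsOpenEmbedding.id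

theorem coords_mem_range {K : Finset (Fin k)} (hK : K.Nonempty) {T : Type} (ε : T ≃ K)
    {x : Torus k} : coords ε x ∉ range (cayleyCoords T) ↔ Fat K (restr K x) := by
  rw [fat_restr_self hK, ← not_iff_not, not_not]
  push Not
  constructor
  · rintro ⟨p, hp⟩ i hi
    rw [← mem_range_cayley]
    have h : cayley (p.1 (ε.symm ⟨i, hi⟩)) = x.1 (ε (ε.symm ⟨i, hi⟩)) :=
      congrFun (congrArg Prod.fst hp) (ε.symm ⟨i, hi⟩)
    rw [Equiv.apply_symm_apply] at h
    exact ⟨_, h⟩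
  · intro h
    have : ∀ s, ∃ a, cayley a = x.1 (ε s) := fun s => mem_range_cayley.2 (h _ (ε s).2)
    choose a ha using this
    exact ⟨(a, x.2), Prod.ext (funext ha) rfl⟩

theorem Rel.fat {S : Finset (Fin k)} {x y : Torus k} (h : Rel S x y) (hx : Fat S x) : Fat S y := by
  rcases h with h | h | h
  · exact h.2
  · exact h ▸ hx
  · rw [← flip_flip y, ← h]
    exact hx.flip

/-- The quotient of the subtorus by the involution and all points with a coordinate equal to `1` is
a one-point compactification. -/
theorem quotient_full {K : Finset (Fin k)} (hK : K.Nonempty) {T : Type} [Finite T] (ε : T ≃ K)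
    {V : Type} [TopologicalSpace V] [T2Space V] [WeaklyLocallyCompactSpace V]
    {f : (T → ℝ) × Circle → V} (hf : IsProperMap f) (hfs : Function.Surjective f)
    (hfe : ∀ p q, f p = f q ↔ p = q ∨ p = -q) :
    PointedHomotopyEquivalent (quotient K K) (onePt V) := by
  refine .onePt_of_cover (C := Torus k) (isQuotientMap_mk _ _) (continuous_coords ε)
    (coords_surjective ε) (isOpenEmbedding_cayleyCoords T) hf hfs (c₀ := 1) (mk_one _ _) ?_ ?_ ?_
  · rw [coords_mem_range hK, restr_one]
    exact fat_one K
  · intro x y h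
    rw [coords_mem_range hK] at h ⊢
    rw [mk_eq_iff]
    exact ⟨fun h' => h'.fat h, fun h' => Or.inl ⟨h, h'⟩⟩
  · intro x y p q hp hq
    -- In the Cayley coordinates the involution is negation of all real coordinates and of the point
    -- on the circle.
    have hq' : coords ε (flip y) = cayleyCoords T (-q) := by
      have h1 := congrArg Prod.fst hq
      have h2 := congrArg Prod.snd hq
      refine Prod.ext (funext fun s => ?_) ?_
      · exact (congrArg (·⁻¹) (congrFun h1 s)).trans (cayley_neg (q.1 s)).symm
      · exact congrArg (- ·) h2
    have hx : ¬ Fat K (restr K x) := by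
      rw [← coords_mem_range hK ε, hp, not_not]
      exact mem_range_self p
    have he := (isOpenEmbedding_cayleyCoords T).injective
    rw [mk_eq_iff, hfe, Rel, flip_restr, restr_eq_iff ε, restr_eq_iff ε, hp, hq, hq',
      he.eq_iff, he.eq_iff]
    simp [hx]

end Torus

/-! ### The case of an even number of coordinates -/

/-- The half-smash product of the circle and `Y`. -/
def halfSmash (Y : PointedSpace) : PointedSpace :=
  collapse {p : Circle × Y | p.2 = Y.pt} (1, Y.pt)

section HalfSmash

variable (Y : PointedSpace)

/-- The quotient map. -/
def halfSmashMk : C(Circle × Y, halfSmash Y) := collapseMk _ _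

theorem isQuotientMap_halfSmashMk : IsQuotientMap (halfSmashMk Y) := isQuotientMap_collapseMk

variable {Y}

theorem halfSmashMk_eq_iff {p q : Circle × Y} :
    halfSmashMk Y p = halfSmashMk Y q ↔ p = q ∨ (p.2 = Y.pt ∧ q.2 = Y.pt) := collapseMk_eq_iff

theorem halfSmashMk_eq_pt {p : Circle × Y} (h : p.2 = Y.pt) :
    halfSmashMk Y p = (halfSmash Y).pt := halfSmashMk_eq_iff.2 (Or.inr ⟨h, rfl⟩)

variable (Y)

/-- The retraction of the half-smash product onto the fibre over `1`. -/
def halfSmashRetract : FibrewiseRetract (halfSmash Y) Y (Circle × Y) where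
  i := (halfSmashMk Y).comp ⟨fun y => (1, y), by fun_prop⟩
  r := descend (isQuotientMap_halfSmashMk Y) Prod.snd continuous_snd fun p q h => by
    rcases halfSmashMk_eq_iff.1 h with h | h
    · rw [h]
    · rw [h.1, h.2]
  h := descendProd (isQuotientMap_halfSmashMk Y)
    (fun p => halfSmashMk Y (circleShrink p.1 p.2.1, p.2.2))
    ((halfSmashMk Y).continuous.comp
      ((continuous_circleShrink (by fun_prop) (by fun_prop)).prodMk (by fun_prop)))
    fun p q h t => by
      rcases halfSmashMk_eq_iff.1 h with h | h
      · rw [h]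
      · exact (halfSmashMk_eq_pt (p := (circleShrink t p.1, p.2)) h.1).trans
          (halfSmashMk_eq_pt (p := (circleShrink t q.1, q.2)) h.2).symm
  π := halfSmashMk Y
  l := ⟨fun p => circleDist p.1, by fun_prop⟩
  i_pt := halfSmashMk_eq_pt rfl
  r_i y := descend_apply (isQuotientMap_halfSmashMk Y) _ _ _ (1, y)
  h_zero x := by
    obtain ⟨p, rfl⟩ := (isQuotientMap_halfSmashMk Y).surjective x
    rw [descendProd_apply, circleShrink_zero]
  h_i t y := (descendProd_apply (isQuotientMap_halfSmashMk Y) _ _ _ t (1, y)).trans <| by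
    rw [circleShrink_apply_one]
    rfl
  r_h t x := by
    obtain ⟨p, rfl⟩ := (isQuotientMap_halfSmashMk Y).surjective x
    rw [descendProd_apply, descend_apply, descend_apply]
  quot := isQuotientMap_halfSmashMk Y
  l_eq p q h := by
    rcases halfSmashMk_eq_iff.1 h with h | h
    · exact Or.inr (by rw [h])
    · exact Or.inl (halfSmashMk_eq_pt h.1)
  l_i p y h := by
    rcases halfSmashMk_eq_iff.1 h with h | h
    · exact Or.inr (by simp [h, circleDist_one])
    · exact Or.inl (halfSmashMk_eq_pt h.1)
  h_one p h := by
    rw [descendProd_apply, descend_apply, circleShrink_of_circleDist h]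
    rfl

theorem halfSmashMk_mem_range {p : Circle × Y} :
    halfSmashMk Y p ∈ range (halfSmashRetract Y).i ↔ p.1 = 1 ∨ p.2 = Y.pt := by
  constructor
  · rintro ⟨y, hy⟩
    rcases halfSmashMk_eq_iff.1 hy with h | h
    · left
      rw [← h]
      rfl
    · exact Or.inr h.2
  · rintro (h | h)
    · exact ⟨p.2, congrArg (halfSmashMk Y) (Prod.ext h.symm rfl)⟩
    · exact ⟨Y.pt, (halfSmashMk_eq_iff.2 (Or.inr ⟨rfl, h⟩))⟩

end HalfSmash

section HalfSmashOnePt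

open OnePoint

variable (V : Type) [TopologicalSpace V] [T2Space V] [LocallyCompactSpace V]

theorem halfSmash_onePt :
    PointedHomotopyEquivalent (halfSmash (onePt V)) (onePt (Circle × V)) := by
  let e : Circle × V → Circle × OnePoint V := Prod.map id (↑)
  have he : IsOpenEmbedding e := IsOpenEmbedding.id.prodMap isOpenEmbedding_coe
  have hr : ∀ c : Circle × OnePoint V, c ∉ range e ↔ c.2 = ∞ := by
    rintro ⟨z, y⟩
    rw [range_prodMap, mem_prod, ← compl_infty, mem_compl_singleton_iff]
    simp
  refine .onePt_of_cover (C := Circle × OnePoint V) (isQuotientMap_halfSmashMk (onePt V))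
    continuous_id Function.surjective_id he isProperMap_id Function.surjective_id
    (c₀ := (1, ∞)) rfl ?_ ?_ ?_
  · rw [id, hr]
  · intro c c' h
    rw [id, hr] at h ⊢
    refine halfSmashMk_eq_iff.trans ⟨?_, fun h' => Or.inr ⟨h, h'⟩⟩
    rintro (h' | h')
    · rwa [← h']
    · exact h'.2
  · intro c c' w w' hw hw'
    have h : ¬ c.2 = ∞ := by
      rw [← hr, not_not]
      exact ⟨w, hw.symm⟩
    refine halfSmashMk_eq_iff.trans ⟨?_, fun h => Or.inl ?_⟩
    · rintro (h' | h')
      · exact he.injective (hw.symm.trans (h'.trans hw'))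
      · exact absurd h'.1 h
    · exact hw.trans ((congrArg e h).trans hw'.symm)

theorem cof_halfSmash_onePt :
    PointedHomotopyEquivalent (halfSmashRetract (onePt V)).cof (onePt (ℝ × V)) := by
  let e : ℝ × V → Circle × OnePoint V := Prod.map cayley (↑)
  have he : IsOpenEmbedding e := isOpenEmbedding_cayley.prodMap isOpenEmbedding_coe
  have hr : ∀ c : Circle × OnePoint V, c ∉ range e ↔ c.1 = 1 ∨ c.2 = ∞ := by
    rintro ⟨z, y⟩
    rw [range_prodMap, mem_prod, ← compl_infty, mem_compl_singleton_iff, mem_range_cayley]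
    tauto
  have hk : ∀ c c' : Circle × OnePoint V,
      (halfSmashRetract (onePt V)).q (halfSmashMk (onePt V) c) =
        (halfSmashRetract (onePt V)).q (halfSmashMk (onePt V) c') ↔
      c = c' ∨ ((c.1 = 1 ∨ c.2 = ∞) ∧ (c'.1 = 1 ∨ c'.2 = ∞)) := by
    intro c c'
    have h1 : _ ↔ c = c' ∨ c.2 = ∞ ∧ c'.2 = ∞ := halfSmashMk_eq_iff (Y := onePt V)
    refine (collapseMk_eq_iff.trans (or_congr h1 (and_congr (halfSmashMk_mem_range (onePt V))
      (halfSmashMk_mem_range (onePt V))))).trans ?_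
    change (c = c' ∨ c.2 = ∞ ∧ c'.2 = ∞) ∨ ((c.1 = 1 ∨ c.2 = ∞) ∧ (c'.1 = 1 ∨ c'.2 = ∞)) ↔ _
    tauto
  refine .onePt_of_cover (C := Circle × OnePoint V) (halfSmashRetract (onePt V)).quot_cof
    continuous_id Function.surjective_id he isProperMap_id Function.surjective_id
    (c₀ := (1, ∞)) rfl ?_ ?_ ?_
  · rw [id, hr]
    simp
  · intro c c' h
    rw [id, hr] at h ⊢
    refine (hk c c').trans ⟨?_, fun h' => Or.inr ⟨h, h'⟩⟩
    rintro (h' | h')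
    · rwa [← h']
    · exact h'.2
  · intro c c' w w' hw hw'
    have h : ¬ (c.1 = 1 ∨ c.2 = ∞) := by
      rw [← hr, not_not]
      exact ⟨w, hw.symm⟩
    refine (hk c c').trans ⟨?_, fun h => Or.inl ?_⟩
    · rintro (h' | h')
      · exact he.injective (hw.symm.trans (h'.trans hw'))
      · exact absurd h'.1 h
    · exact hw.trans ((congrArg e h).trans hw'.symm)

/-- The half-smash product retracts onto its fibre over `1`, and the quotient is the
compactification of `(S¹ \ {1}) × V`. -/
theorem susp_onePt_circle_prod :
    PointedHomotopyEquivalent (reducedSuspension (onePt (Circle × V)))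
      (wedge (onePt (V × ℝ)) (onePt ((ℝ × V) × ℝ))) :=
  (halfSmash_onePt V).symm.susp.trans ((halfSmashRetract (onePt V)).equivalent.trans
    ((susp_onePt V).wedge ((cof_halfSmash_onePt V).susp.trans (susp_onePt _))))

end HalfSmashOnePt

/-- The map that squares the coordinate on the circle. -/
def squareFst (V : Type*) (p : Circle × V) : Circle × V := (p.1 ^ 2, p.2)

theorem isProperMap_squareFst (V : Type*) [TopologicalSpace V] : IsProperMap (squareFst V) :=
  IsProperMap.prodMap (f := fun z : Circle => z ^ 2) (g := (id : V → V))
    (Continuous.isProperMap (by fun_prop)) isProperMap_id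

namespace Torus

/-- The map that pairs real coordinates to complex ones and rotates them by the coordinate on the
circle. -/
def rotate (κ : Type) (p : (κ ⊕ κ → ℝ) × Circle) : Circle × (κ → ℂ) :=
  (p.2, fun j => p.2 * ⟨p.1 (Sum.inl j), p.1 (Sum.inr j)⟩)

theorem continuous_complex_mk {W : Type*} [TopologicalSpace W] {f g : W → ℝ} (hf : Continuous f)
    (hg : Continuous g) : Continuous fun w => (⟨f w, g w⟩ : ℂ) :=
  Complex.equivRealProdCLM.symm.continuous.comp (hf.prodMk hg)

/-- The inverse of `rotate`. -/
def unrotate (κ : Type) (p : Circle × (κ → ℂ)) : (κ ⊕ κ → ℝ) × Circle :=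
  (Sum.elim (fun j => ((p.1⁻¹ : Circle) * p.2 j : ℂ).re)
    (fun j => ((p.1⁻¹ : Circle) * p.2 j : ℂ).im), p.1)

theorem unrotate_rotate (κ : Type) (p : (κ ⊕ κ → ℝ) × Circle) : unrotate κ (rotate κ p) = p := by
  refine Prod.ext (funext ?_) rfl
  rintro (j | j) <;> simp [unrotate, rotate]

theorem rotate_unrotate (κ : Type) (p : Circle × (κ → ℂ)) : rotate κ (unrotate κ p) = p := by
  refine Prod.ext rfl (funext fun j => ?_)
  change (p.1 : ℂ) * ((p.1⁻¹ : Circle) * p.2 j) = p.2 j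
  rw [← mul_assoc, ← Circle.coe_mul, mul_inv_cancel, Circle.coe_one, one_mul]

theorem continuous_rotate (κ : Type) : Continuous (rotate κ) := by
  refine Continuous.prodMk continuous_snd (continuous_pi fun j => ?_)
  exact Continuous.mul (by fun_prop) (continuous_complex_mk (by fun_prop) (by fun_prop))

theorem continuous_unrotate (κ : Type) : Continuous (unrotate κ) := by
  refine Continuous.prodMk (continuous_pi ?_) continuous_fst
  rintro (j | j)
  · simp only [Sum.elim_inl]
    fun_prop
  · simp only [Sum.elim_inr]
    fun_prop

/-- The sign of the point on the circle cancels the sign of the complex coordinates. The antipodal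
map thus acts on the circle factor only, where squaring divides it out. -/
theorem rotate_neg (κ : Type) (p : (κ ⊕ κ → ℝ) × Circle) :
    rotate κ (-p) = (-(rotate κ p).1, (rotate κ p).2) := by
  refine Prod.ext rfl (funext fun j => ?_)
  apply Complex.ext <;> simp [rotate] <;> ring

theorem quotient_even {K : Finset (Fin k)} (hK : K.Nonempty) {b : ℕ} (hb : K.card = b + b) :
    PointedHomotopyEquivalent (quotient K K) (onePt (Circle × (Fin b → ℂ))) := by
  let ε : Fin b ⊕ Fin b ≃ K := Fintype.equivOfCardEq (by simp [hb])
  have hl := unrotate_rotate (Fin b)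
  have hp : IsProperMap (rotate (Fin b)) :=
    (Function.LeftInverse.isClosedEmbedding hl (continuous_unrotate _)
      (continuous_rotate _)).isProperMap
  refine quotient_full hK ε ((isProperMap_squareFst _).comp hp) ?_ ?_
  · rintro ⟨z, y⟩
    obtain ⟨w, rfl⟩ := circle_exists_sq z
    exact ⟨unrotate _ (w, y), by rw [Function.comp_apply, rotate_unrotate]; rfl⟩
  · intro p q
    have hi := Function.LeftInverse.injective hl
    rw [← hi.eq_iff (a := p) (b := q), ← hi.eq_iff (a := p) (b := -q), rotate_neg]
    simp only [Function.comp_apply, squareFst, Prod.ext_iff, circle_sq_eq_iff]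
    tauto

theorem susp_quotient_even {K : Finset (Fin k)} (hK : K.Nonempty) (hb : Even K.card) :
    PointedHomotopyEquivalent (reducedSuspension (quotient K K))
      (wedge (sphere (K.card + 1)) (sphere (K.card + 2))) := by
  obtain ⟨b, hb⟩ := hb
  refine (quotient_even hK hb).susp.trans ((susp_onePt_circle_prod _).trans (.wedge ?_ ?_))
  · exact onePt_sphere _ _ (by simp [Module.finrank_pi_fintype, hb, mul_two])
  · exact onePt_sphere _ _ (by simp [Module.finrank_pi_fintype, hb, mul_two]; omega)

theorem susp_quotient_empty :
    PointedHomotopyEquivalent (reducedSuspension (quotient (∅ : Finset (Fin k)) ∅)) (sphere 2) :=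
  quotient_empty.susp.trans ((susp_onePt ℝ).trans (onePt_sphere _ _ (by simp)))

end Torus

end Models

/-! ### The open Möbius strip -/

/-- The map `(w, a) ↦ (w², w a)`, which identifies antipodal points. -/
def moebiusFun (p : Circle × ℝ) : Circle × ℂ := squareFst ℂ (p.1, p.1 * p.2)

theorem moebiusFun_eq_iff {p q : Circle × ℝ} : moebiusFun p = moebiusFun q ↔ p = q ∨ p = -q := by
  obtain ⟨w, a⟩ := p
  obtain ⟨v, c⟩ := q
  have h : moebiusFun (w, a) = moebiusFun (v, c) ↔ w ^ 2 = v ^ 2 ∧ (w * a : ℂ) = v * c :=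
    Prod.mk_inj
  rw [h, circle_sq_eq_iff, Prod.neg_mk, Prod.mk.injEq, Prod.mk.injEq]
  constructor
  · rintro ⟨rfl | rfl, h⟩
    · left
      simpa using h
    · right
      refine ⟨rfl, ?_⟩
      rw [show ((-v : Circle) : ℂ) = -v from rfl, neg_mul, ← mul_neg] at h
      have h := mul_left_cancel₀ v.coe_ne_zero h
      rw [neg_eq_iff_eq_neg] at h
      exact_mod_cast h
  · rintro (⟨rfl, rfl⟩ | ⟨rfl, rfl⟩)
    · exact ⟨Or.inl rfl, rfl⟩
    · refine ⟨Or.inr rfl, ?_⟩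
      rw [show ((-v : Circle) : ℂ) = -v from rfl]
      simp

theorem isProperMap_moebiusFun : IsProperMap moebiusFun := by
  have hc : Continuous fun p : Circle × ℝ => ((p.1, p.1 * p.2) : Circle × ℂ) := by fun_prop
  -- The map `(w, a) ↦ (w, w a)` is a closed embedding, with left inverse given by `Re (w⁻¹ u)`.
  refine (isProperMap_squareFst ℂ).comp (Function.LeftInverse.isClosedEmbedding
    (f := fun p : Circle × ℂ => (p.1, ((p.1⁻¹ : Circle) * p.2 : ℂ).re)) ?_ ?_ hc).isProperMap
  · rintro ⟨w, a⟩
    refine Prod.ext rfl ?_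
    change (((w⁻¹ : Circle) : ℂ) * (w * a)).re = a
    rw [← mul_assoc, ← Circle.coe_mul, inv_mul_cancel, Circle.coe_one, one_mul, Complex.ofReal_re]
  · fun_prop

/-- The open Möbius strip. -/
def Moebius : Type := range moebiusFun

instance : TopologicalSpace Moebius := inferInstanceAs (TopologicalSpace (range moebiusFun))

instance : T2Space Moebius := inferInstanceAs (T2Space (range moebiusFun))

instance : LocallyCompactSpace Moebius :=
  isProperMap_moebiusFun.isClosedMap.isClosed_range.isClosedEmbedding_subtypeVal.locallyCompactSpace

/-- The double covering of the open Möbius strip. -/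
def moebius (p : Circle × ℝ) : Moebius := rangeFactorization moebiusFun p

theorem moebius_surjective : Function.Surjective moebius := rangeFactorization_surjective

theorem moebius_eq_iff {p q : Circle × ℝ} : moebius p = moebius q ↔ p = q ∨ p = -q :=
  Subtype.ext_iff.trans moebiusFun_eq_iff

theorem isProperMap_moebius : IsProperMap moebius :=
  isProperMap_of_comp_of_inj (g := (Subtype.val : range moebiusFun → Circle × ℂ))
    (isProperMap_moebiusFun.continuous.subtype_mk _) continuous_subtype_val
    isProperMap_moebiusFun Subtype.val_injective

/-- The upper half of the circle. -/
def halfCircle (c : Icc (-1 : ℝ) 1) : Circle :=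
  ⟨⟨c, √(1 - c ^ 2)⟩, by
    have h : (0 : ℝ) ≤ 1 - c ^ 2 := by nlinarith [c.2.1, c.2.2]
    refine mem_sphere_zero_iff_norm.2 ?_
    rw [← sq_eq_sq₀ (norm_nonneg _) zero_le_one, Complex.sq_norm, Complex.normSq_mk,
      Real.mul_self_sqrt h]
    ring⟩

theorem halfCircle_im (c : Icc (-1 : ℝ) 1) : (halfCircle c : ℂ).im = √(1 - c ^ 2) := rfl

theorem continuous_halfCircle : Continuous halfCircle :=
  (Torus.continuous_complex_mk (by fun_prop) (by fun_prop)).subtype_mk _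

theorem halfCircle_injective : Function.Injective halfCircle := fun _ _ h =>
  Subtype.ext (congrArg (fun z : Circle => (z : ℂ).re) h)

theorem exists_halfCircle_of_im_nonneg {z : Circle} (h : 0 ≤ (z : ℂ).im) :
    ∃ c, halfCircle c = z := by
  have h1 := circle_re_sq_add_im_sq z
  refine ⟨⟨(z : ℂ).re, by nlinarith [sq_nonneg (z : ℂ).im], by nlinarith [sq_nonneg (z : ℂ).im]⟩,
    circle_ext_re_im rfl ?_⟩
  rw [halfCircle_im]
  change √(1 - (z : ℂ).re ^ 2) = _
  rw [show 1 - (z : ℂ).re ^ 2 = (z : ℂ).im ^ 2 by linarith, Real.sqrt_sq h]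

/-- Two points of the closed upper half-circle are antipodal only if both have height zero, that is,
at the ends `±1`. -/
theorem halfCircle_eq_neg_iff {c c' : Icc (-1 : ℝ) 1} :
    halfCircle c = -halfCircle c' ↔ (c : ℝ) = -c' ∧ (c : ℝ) ^ 2 = 1 := by
  have h : (0 : ℝ) ≤ 1 - c ^ 2 := by nlinarith [c.2.1, c.2.2]
  constructor
  · intro hc
    have hr : (c : ℝ) = -c' := congrArg (fun z : Circle => (z : ℂ).re) hc
    have hi : √(1 - (c : ℝ) ^ 2) = -√(1 - (c' : ℝ) ^ 2) :=
      congrArg (fun z : Circle => (z : ℂ).im) hc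
    have h0 : √(1 - (c : ℝ) ^ 2) = 0 :=
      le_antisymm (hi ▸ neg_nonpos.2 (Real.sqrt_nonneg _)) (Real.sqrt_nonneg _)
    rw [Real.sqrt_eq_zero h] at h0
    exact ⟨hr, by linarith⟩
  · rintro ⟨hr, h1⟩
    refine circle_ext_re_im hr ?_
    change √(1 - (c : ℝ) ^ 2) = -√(1 - (c' : ℝ) ^ 2)
    rw [← neg_sq (c' : ℝ), ← hr, h1]
    simp

/-- The open Möbius strip as a strip with its ends glued. -/
def moebiusStrip (p : ℝ × Icc (-1 : ℝ) 1) : Moebius := moebius (halfCircle p.2, p.1)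

theorem isProperMap_moebiusStrip : IsProperMap moebiusStrip := by
  have h : IsProperMap (Prod.map (id : ℝ → ℝ) halfCircle) :=
    isProperMap_id.prodMap continuous_halfCircle.isProperMap
  exact isProperMap_moebius.comp ((Homeomorph.prodComm _ _).isProperMap.comp h)

/-- Every antipodal pair has a member over the closed upper half-circle. -/
theorem moebiusStrip_surjective : Function.Surjective moebiusStrip := by
  intro y
  obtain ⟨⟨w, a⟩, rfl⟩ := moebius_surjective y
  rcases le_total 0 (w : ℂ).im with h | h
  · obtain ⟨c, rfl⟩ := exists_halfCircle_of_im_nonneg h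
    exact ⟨(a, c), rfl⟩
  · obtain ⟨c, hc⟩ := exists_halfCircle_of_im_nonneg (z := -w) (by
      change 0 ≤ -(w : ℂ).im
      linarith)
    exact ⟨(-a, c), moebius_eq_iff.2 (Or.inr (Prod.ext hc rfl))⟩

theorem moebiusStrip_eq_iff {a a' : ℝ} {c c' : Icc (-1 : ℝ) 1} :
    moebiusStrip (a, c) = moebiusStrip (a', c') ↔
      (a = a' ∧ c = c') ∨ (a = -a' ∧ (c : ℝ) = -c' ∧ (c : ℝ) ^ 2 = 1) := by
  refine moebius_eq_iff.trans ?_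
  rw [Prod.neg_mk, Prod.mk.injEq, Prod.mk.injEq, halfCircle_injective.eq_iff,
    halfCircle_eq_neg_iff, and_comm, and_comm (b := a = -a')]

/-! ### The case of an odd number of coordinates -/

namespace Torus

variable {k : ℕ}

/-- The map `rotate` with one real coordinate left over. -/
def rotateOdd (κ : Type) (p : ((κ ⊕ κ) ⊕ Unit → ℝ) × Circle) : (κ → ℂ) × (Circle × ℝ) :=
  ((rotate κ (fun s => p.1 (Sum.inl s), p.2)).2, (p.2, p.1 (Sum.inr ())))

/-- The inverse of `rotateOdd`. -/
def unrotateOdd (κ : Type) (p : (κ → ℂ) × (Circle × ℝ)) : ((κ ⊕ κ) ⊕ Unit → ℝ) × Circle :=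
  (Sum.elim (unrotate κ (p.2.1, p.1)).1 (fun _ => p.2.2), p.2.1)

theorem unrotateOdd_rotateOdd (κ : Type) (p : ((κ ⊕ κ) ⊕ Unit → ℝ) × Circle) :
    unrotateOdd κ (rotateOdd κ p) = p := by
  refine Prod.ext (funext ?_) rfl
  rintro (s | s)
  · exact congrFun (congrArg Prod.fst (unrotate_rotate κ (fun s => p.1 (Sum.inl s), p.2))) s
  · rfl

theorem rotateOdd_unrotateOdd (κ : Type) (p : (κ → ℂ) × (Circle × ℝ)) :
    rotateOdd κ (unrotateOdd κ p) = p :=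
  Prod.ext (congrArg Prod.snd (rotate_unrotate κ (p.2.1, p.1))) rfl

theorem continuous_rotateOdd (κ : Type) : Continuous (rotateOdd κ) :=
  (continuous_snd.comp ((continuous_rotate κ).comp (by fun_prop))).prodMk (by fun_prop)

theorem continuous_unrotateOdd (κ : Type) : Continuous (unrotateOdd κ) := by
  refine Continuous.prodMk (continuous_pi ?_) (by fun_prop)
  have h : Continuous fun p : (κ → ℂ) × (Circle × ℝ) => (unrotate κ (p.2.1, p.1)).1 :=
    continuous_fst.comp ((continuous_unrotate κ).comp (by fun_prop))
  rintro (s | s)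
  · exact (continuous_apply s).comp h
  · exact continuous_snd.comp continuous_snd

theorem rotateOdd_neg (κ : Type) (p : ((κ ⊕ κ) ⊕ Unit → ℝ) × Circle) :
    rotateOdd κ (-p) = ((rotateOdd κ p).1, -(rotateOdd κ p).2) :=
  Prod.ext (Prod.ext_iff.1 (rotate_neg κ (fun s => p.1 (Sum.inl s), p.2))).2 rfl

/-- All but one of the real coordinates are paired and untwisted; the one left over keeps the twist
and forms the Möbius strip with the circle. -/
theorem quotient_odd {K : Finset (Fin k)} {b : ℕ} (hb : K.card = b + b + 1) :
    PointedHomotopyEquivalent (quotient K K) (onePt ((Fin b → ℂ) × Moebius)) := by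
  have hK : K.Nonempty := Finset.card_pos.1 (by omega)
  let ε : (Fin b ⊕ Fin b) ⊕ Unit ≃ K := Fintype.equivOfCardEq (by simp [hb])
  have hl := unrotateOdd_rotateOdd (Fin b)
  have hp : IsProperMap (rotateOdd (Fin b)) :=
    (Function.LeftInverse.isClosedEmbedding hl (continuous_unrotateOdd _)
      (continuous_rotateOdd _)).isProperMap
  refine quotient_full hK ε (f := Prod.map id moebius ∘ rotateOdd (Fin b))
    ((isProperMap_id.prodMap isProperMap_moebius).comp hp) ?_ ?_
  · rintro ⟨x, y⟩
    obtain ⟨c, rfl⟩ := moebius_surjective y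
    exact ⟨unrotateOdd _ (x, c), by rw [Function.comp_apply, rotateOdd_unrotateOdd]; rfl⟩
  · intro p q
    have hi := Function.LeftInverse.injective hl
    rw [← hi.eq_iff (a := p) (b := q), ← hi.eq_iff (a := p) (b := -q), rotateOdd_neg]
    simp only [Function.comp_apply, Prod.map, id, Prod.ext_iff (x := rotateOdd _ _),
      Prod.mk.injEq, moebius_eq_iff]
    tauto

end Torus

/-! ### The Moore space as a quotient of the ball -/

section Moore

variable {m : ℕ}

/-- The inclusion of the sphere. -/
def mooreSphere (m : ℕ) : C(sphere (m + 1), moore m) :=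
  ⟨fun x => Quot.mk _ (Sum.inl x), continuous_quot_mk.comp continuous_inl⟩

/-- The characteristic map of the top cell. -/
def mooreBall (m : ℕ) :
    C(Metric.closedBall (0 : EuclideanSpace ℝ (Fin (m + 2))) 1, moore m) :=
  ⟨fun v => Quot.mk _ (Sum.inr v), continuous_quot_mk.comp continuous_inr⟩

theorem mooreBall_of_sphere (x : sphere (m + 1)) :
    mooreBall m ⟨x.1, Metric.sphere_subset_closedBall x.2⟩ = mooreSphere m (degreeTwo m x) :=
  Quot.sound ⟨x, rfl, rfl⟩

open Classical in
/-- The set of normal forms of points of the Moore space. -/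
def mooreNormal (m : ℕ) :
    moore m → sphere (m + 1) ⊕ Metric.closedBall (0 : EuclideanSpace ℝ (Fin (m + 2))) 1 :=
  Quot.lift (Sum.elim Sum.inl fun v => if h : ‖v.1‖ = 1 then
    Sum.inl (degreeTwo m ⟨v.1, mem_sphere_zero_iff_norm.2 h⟩) else Sum.inr v) <| by
      rintro _ _ ⟨x, rfl, rfl⟩
      exact dif_pos (mem_sphere_zero_iff_norm.1 x.2)

theorem mooreNormal_sphere (x : sphere (m + 1)) : mooreNormal m (mooreSphere m x) = Sum.inl x := rfl

theorem mooreNormal_ball {v : Metric.closedBall (0 : EuclideanSpace ℝ (Fin (m + 2))) 1}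
    (h : ‖v.1‖ ≠ 1) : mooreNormal m (mooreBall m v) = Sum.inr v := dif_neg h

theorem mooreSphere_injective : Function.Injective (mooreSphere m) := fun _ _ h =>
  Sum.inl_injective (congrArg (mooreNormal m) h)

/-- The normal form moves boundary points of the ball into the sphere, so a point of the sphere can
only meet the boundary of the ball. -/
theorem mooreSphere_eq_ball_iff {x : sphere (m + 1)}
    {v : Metric.closedBall (0 : EuclideanSpace ℝ (Fin (m + 2))) 1} :
    mooreSphere m x = mooreBall m v ↔ ‖v.1‖ = 1 ∧ x.1 = angleDouble m v := by
  constructor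
  · intro h
    have hv : ‖v.1‖ = 1 := by
      by_contra hv
      have := congrArg (mooreNormal m) h
      rw [mooreNormal_sphere, mooreNormal_ball hv] at this
      cases this
    refine ⟨hv, ?_⟩
    have h' := h.trans (mooreBall_of_sphere ⟨v.1, mem_sphere_zero_iff_norm.2 hv⟩)
    exact congrArg Subtype.val (mooreSphere_injective h')
  · rintro ⟨hv, hx⟩
    have h := mooreBall_of_sphere (m := m) ⟨v.1, mem_sphere_zero_iff_norm.2 hv⟩
    refine Eq.trans ?_ h.symm
    exact congrArg (mooreSphere m) (Subtype.ext hx)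

theorem mooreBall_eq_iff {v w : Metric.closedBall (0 : EuclideanSpace ℝ (Fin (m + 2))) 1} :
    mooreBall m v = mooreBall m w ↔
      v = w ∨ (‖v.1‖ = 1 ∧ ‖w.1‖ = 1 ∧ angleDouble m v = angleDouble m w) := by
  constructor
  · intro h
    by_cases hv : ‖v.1‖ = 1
    · have hv' := mooreBall_of_sphere (m := m) ⟨v.1, mem_sphere_zero_iff_norm.2 hv⟩
      have hw := mooreSphere_eq_ball_iff.1 (hv'.symm.trans h)
      exact Or.inr ⟨hv, hw.1, hw.2⟩
    · left
      by_cases hw : ‖w.1‖ = 1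
      · have hw' := mooreBall_of_sphere (m := m) ⟨w.1, mem_sphere_zero_iff_norm.2 hw⟩
        exact absurd (mooreSphere_eq_ball_iff.1 (hw'.symm.trans h.symm)).1 hv
      · have := congrArg (mooreNormal m) h
        rw [mooreNormal_ball hv, mooreNormal_ball hw] at this
        exact Sum.inr_injective this
  · rintro (rfl | ⟨hv, hw, h⟩)
    · rfl
    · have hv' := mooreBall_of_sphere (m := m) ⟨v.1, mem_sphere_zero_iff_norm.2 hv⟩
      exact hv'.trans (mooreSphere_eq_ball_iff.2 ⟨hw, h⟩)

theorem angleDouble_zero (x : EuclideanSpace ℝ (Fin (m + 2))) :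
    angleDouble m x 0 = (x 0 ^ 2 - x 1 ^ 2) / √(x 0 ^ 2 + x 1 ^ 2) := rfl

theorem angleDouble_one (x : EuclideanSpace ℝ (Fin (m + 2))) :
    angleDouble m x 1 = 2 * x 0 * x 1 / √(x 0 ^ 2 + x 1 ^ 2) := rfl

theorem euclidean_ext {x y : EuclideanSpace ℝ (Fin (m + 2))} (h0 : x 0 = y 0) (h1 : x 1 = y 1)
    (h : ∀ j : Fin m, x j.succ.succ = y j.succ.succ) : x = y := by
  ext j
  refine Fin.cases h0 (fun j => Fin.cases h1 h j) j

theorem eq_zero_of_sq_add_sq {a b : ℝ} (h : a ^ 2 + b ^ 2 = 0) : a = 0 ∧ b = 0 := by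
  rw [add_eq_zero_iff_of_nonneg (sq_nonneg a) (sq_nonneg b)] at h
  simpa using h

/-- Angle doubling preserves the norm in the first plane, so equal images have equal denominators.
Comparing numerators compares complex squares. -/
theorem angleDouble_eq_iff {x y : EuclideanSpace ℝ (Fin (m + 2))} :
    angleDouble m x = angleDouble m y ↔ (∀ j : Fin m, x j.succ.succ = y j.succ.succ) ∧
      ((x 0 = y 0 ∧ x 1 = y 1) ∨ (x 0 = -y 0 ∧ x 1 = -y 1)) := by
  have key : ∀ x : EuclideanSpace ℝ (Fin (m + 2)),
      angleDouble m x 0 ^ 2 + angleDouble m x 1 ^ 2 = x 0 ^ 2 + x 1 ^ 2 := by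
    intro x
    rw [angleDouble_zero, angleDouble_one]
    have hr : 0 ≤ x 0 ^ 2 + x 1 ^ 2 := by positivity
    rw [div_pow, div_pow, Real.sq_sqrt hr]
    rcases hr.eq_or_lt with h | h
    · rw [← h]
      simp
    · field_simp
      ring
  constructor
  · intro h
    refine ⟨fun j => congrArg (fun v => v j.succ.succ) h, ?_⟩
    have hk := key x
    rw [h, key y] at hk
    have h0 : angleDouble m x 0 = angleDouble m y 0 := by rw [h]
    have h1 : angleDouble m x 1 = angleDouble m y 1 := by rw [h]
    rw [angleDouble_zero, angleDouble_zero, hk] at h0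
    rw [angleDouble_one, angleDouble_one, hk] at h1
    have hr : 0 ≤ x 0 ^ 2 + x 1 ^ 2 := by positivity
    rcases hr.eq_or_lt with hr | hr
    · obtain ⟨hx0, hx1⟩ := eq_zero_of_sq_add_sq hr.symm
      obtain ⟨hy0, hy1⟩ := eq_zero_of_sq_add_sq (hk.trans hr.symm)
      exact Or.inl ⟨hx0.trans hy0.symm, hx1.trans hy1.symm⟩
    · have hs : √(x 0 ^ 2 + x 1 ^ 2) ≠ 0 := (Real.sqrt_pos.2 hr).ne'
      rw [div_left_inj' hs] at h0 h1
      have hc : (⟨x 0, x 1⟩ : ℂ) ^ 2 = (⟨y 0, y 1⟩ : ℂ) ^ 2 := by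
        apply Complex.ext
        · simp [sq]
          linarith
        · simp [sq]
          linarith
      rcases sq_eq_sq_iff_eq_or_eq_neg.1 hc with hc | hc
      · exact Or.inl ⟨congrArg Complex.re hc, congrArg Complex.im hc⟩
      · exact Or.inr ⟨congrArg Complex.re hc, congrArg Complex.im hc⟩
  · rintro ⟨h, ⟨h0, h1⟩ | ⟨h0, h1⟩⟩
    · rw [euclidean_ext h0 h1 h]
    · refine euclidean_ext ?_ ?_ h
      · rw [angleDouble_zero, angleDouble_zero, h0, h1, neg_sq, neg_sq]
      · rw [angleDouble_one, angleDouble_one, h0, h1, neg_sq, neg_sq]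
        ring

theorem angleDouble_surjective : Function.Surjective (angleDouble m) := by
  intro y
  obtain ⟨ζ, hζ⟩ := IsAlgClosed.exists_pow_nat_eq (⟨y 0, y 1⟩ : ℂ) (n := 2) (by norm_num)
  have h0 : ζ.re ^ 2 - ζ.im ^ 2 = y 0 := by
    have := congrArg Complex.re hζ
    simp [sq] at this
    linarith
  have h1 : 2 * ζ.re * ζ.im = y 1 := by
    have := congrArg Complex.im hζ
    simp [sq] at this
    linarith
  set s := √(ζ.re ^ 2 + ζ.im ^ 2) with hs
  have hss : s ^ 2 = ζ.re ^ 2 + ζ.im ^ 2 := Real.sq_sqrt (by positivity)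
  have hr : √((ζ.re * s) ^ 2 + (ζ.im * s) ^ 2) = s ^ 2 := by
    rw [mul_pow, mul_pow, ← add_mul, ← hss, ← sq, Real.sqrt_sq (sq_nonneg s)]
  -- With `z = ζ * |ζ|` one gets `z ^ 2 / |z| = ζ ^ 2`, the prescribed point of the plane.
  refine ⟨WithLp.toLp 2 (Fin.cons (ζ.re * s) (Fin.cons (ζ.im * s) fun j => y j.succ.succ)),
    euclidean_ext ?_ ?_ fun j => rfl⟩
  · change ((ζ.re * s) ^ 2 - (ζ.im * s) ^ 2) / √((ζ.re * s) ^ 2 + (ζ.im * s) ^ 2) = _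
    rw [hr, mul_pow, mul_pow, ← sub_mul, h0]
    by_cases h : s = 0
    · have : ζ.re = 0 ∧ ζ.im = 0 := eq_zero_of_sq_add_sq (by rw [← hss, h, sq, mul_zero])
      rw [← h0, this.1, this.2]
      simp
    · exact mul_div_cancel_right₀ _ (pow_ne_zero 2 h)
  · change 2 * (ζ.re * s) * (ζ.im * s) / √((ζ.re * s) ^ 2 + (ζ.im * s) ^ 2) = _
    rw [hr, show 2 * (ζ.re * s) * (ζ.im * s) = 2 * ζ.re * ζ.im * s ^ 2 by ring, h1]
    by_cases h : s = 0
    · have : ζ.re = 0 ∧ ζ.im = 0 := eq_zero_of_sq_add_sq (by rw [← hss, h, sq, mul_zero])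
      rw [← h1, this.1, this.2]
      simp
    · exact mul_div_cancel_right₀ _ (pow_ne_zero 2 h)

theorem degreeTwo_surjective : Function.Surjective (degreeTwo m) := by
  intro y
  obtain ⟨x, hx⟩ := angleDouble_surjective (m := m) y.1
  have h : ‖x‖ = 1 := by
    rw [← norm_angleDouble, hx]
    exact mem_sphere_zero_iff_norm.1 y.2
  exact ⟨⟨x, mem_sphere_zero_iff_norm.2 h⟩, Subtype.ext hx⟩

instance (k : ℕ) : CompactSpace (sphere k) :=
  inferInstanceAs (CompactSpace (Metric.sphere (0 : EuclideanSpace ℝ (Fin (k + 1))) 1))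

instance (k : ℕ) : T2Space (sphere k) :=
  inferInstanceAs (T2Space (Metric.sphere (0 : EuclideanSpace ℝ (Fin (k + 1))) 1))

/-- The attaching map is onto, so the ball alone covers the Moore space. A set is closed in the
sphere if its preimage under the closed surjection `degreeTwo` is, and that preimage is seen on the
boundary of the ball. -/
theorem isQuotientMap_mooreBall : IsQuotientMap (mooreBall m) := by
  refine isQuotientMap_iff_isClosed.2 ⟨?_, fun s => ⟨fun h => h.preimage (mooreBall m).continuous,
    fun h => ?_⟩⟩
  · rintro ⟨x | v⟩
    · obtain ⟨y, rfl⟩ := degreeTwo_surjective x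
      exact ⟨_, mooreBall_of_sphere y⟩
    · exact ⟨v, rfl⟩
  · have hq : IsQuotientMap (degreeTwo m) :=
      (degreeTwo m).continuous.isClosedMap.isQuotientMap (degreeTwo m).continuous
        degreeTwo_surjective
    have hs : IsClosed (mooreSphere m ⁻¹' s) := by
      rw [← hq.isClosed_preimage]
      have hc : Continuous fun x : sphere (m + 1) =>
          (⟨x.1, Metric.sphere_subset_closedBall x.2⟩ :
            Metric.closedBall (0 : EuclideanSpace ℝ (Fin (m + 2))) 1) :=
        continuous_subtype_val.subtype_mk _
      convert h.preimage hc using 1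
      ext x
      exact iff_of_eq (congrArg (· ∈ s) (mooreBall_of_sphere x).symm)
    refine (isQuotientMap_quot_mk.isClosed_preimage).1 ?_
    exact isClosed_sum_iff.2 ⟨hs, h⟩

end Moore

/-! ### Collapsing a half-sphere in the Moore space -/

section MooreCollapse

variable {m : ℕ}

/-- The contraction of the sphere towards its basepoint. -/
def shrinkSphere (k : ℕ) (t : I) (x : sphere k) : sphere k :=
  ⟨shrink (sphere k).pt.1 t x.1, mem_sphere_zero_iff_norm.2
    (norm_shrink (mem_sphere_zero_iff_norm.1 (sphere k).pt.2) (mem_sphere_zero_iff_norm.1 x.2) t)⟩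

theorem continuous_shrinkSphere {k : ℕ} {W : Type*} [TopologicalSpace W] {t : W → I}
    {x : W → sphere k} (ht : Continuous t) (hx : Continuous x) :
    Continuous fun w => shrinkSphere k (t w) (x w) :=
  (continuous_shrink (mem_sphere_zero_iff_norm.1 (sphere k).pt.2) ht
    (continuous_subtype_val.comp hx)
    fun w => mem_sphere_zero_iff_norm.1 (x w).2).subtype_mk _

theorem shrinkSphere_zero {k : ℕ} (x : sphere k) : shrinkSphere k 0 x = x :=
  Subtype.ext (shrink_zero (mem_sphere_zero_iff_norm.1 x.2))

theorem shrinkSphere_pt {k : ℕ} (t : I) : shrinkSphere k t (sphere k).pt = (sphere k).pt :=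
  Subtype.ext (shrink_self (mem_sphere_zero_iff_norm.1 (sphere k).pt.2) t)

/-- Polar coordinates in the ball. -/
def polar (m : ℕ) (p : sphere (m + 1) × I) :
    Metric.closedBall (0 : EuclideanSpace ℝ (Fin (m + 2))) 1 :=
  ⟨(p.2 : ℝ) • p.1.1, by
    rw [mem_closedBall_zero_iff, norm_smul, mem_sphere_zero_iff_norm.1 p.1.2, mul_one,
      Real.norm_eq_abs, abs_of_nonneg p.2.2.1]
    exact p.2.2.2⟩

theorem norm_polar (p : sphere (m + 1) × I) : ‖(polar m p).1‖ = p.2 := by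
  change ‖(p.2 : ℝ) • p.1.1‖ = _
  rw [norm_smul, mem_sphere_zero_iff_norm.1 p.1.2, mul_one, Real.norm_eq_abs,
    abs_of_nonneg p.2.2.1]

theorem continuous_polar : Continuous (polar m) :=
  Continuous.subtype_mk ((continuous_subtype_val.comp continuous_snd).smul
    (continuous_subtype_val.comp continuous_fst)) _

theorem polar_one (x : sphere (m + 1)) :
    polar m (x, 1) = ⟨x.1, Metric.sphere_subset_closedBall x.2⟩ := Subtype.ext (one_smul ℝ x.1)

theorem polar_surjective : Function.Surjective (polar m) := by
  intro v
  by_cases hv : v.1 = 0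
  · exact ⟨((sphere (m + 1)).pt, 0), Subtype.ext ((zero_smul ℝ _).trans hv.symm)⟩
  · have hn := norm_ne_zero_iff.2 hv
    refine ⟨(⟨‖v.1‖⁻¹ • v.1, ?_⟩, ⟨‖v.1‖, norm_nonneg _, mem_closedBall_zero_iff.1 v.2⟩),
      Subtype.ext (smul_inv_smul₀ hn v.1)⟩
    rw [mem_sphere_zero_iff_norm, norm_smul, norm_inv, norm_norm, inv_mul_cancel₀ hn]

theorem isQuotientMap_moorePolar : IsQuotientMap fun p => mooreBall m (polar m p) := by
  refine isQuotientMap_mooreBall.comp ?_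
  exact continuous_polar.isClosedMap.isQuotientMap continuous_polar polar_surjective

theorem mooreBall_polar_one (x : sphere (m + 1)) :
    mooreBall m (polar m (x, 1)) = mooreSphere m (degreeTwo m x) :=
  (congrArg (mooreBall m) (polar_one x)).trans (mooreBall_of_sphere x)

/-- Stretches the ball over the sphere, and contracts the sphere towards its basepoint. -/
def mooreStretch (m : ℕ) (p : I × (sphere (m + 1) × I)) : moore m :=
  -- An explicit homotopy extension: radii are stretched by `1 + t`, and a point pushed beyond
  -- radius `1` follows the contraction of the sphere for the excess time.
  if (p.2.2 : ℝ) * (1 + p.1) ≤ 1 then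
    mooreBall m (polar m (p.2.1, projIcc 0 1 zero_le_one ((p.2.2 : ℝ) * (1 + p.1))))
  else mooreSphere m (shrinkSphere (m + 1)
    (projIcc 0 1 zero_le_one ((p.2.2 : ℝ) * (1 + p.1) - 1)) (degreeTwo m p.2.1))

theorem continuous_mooreStretch : Continuous (mooreStretch m) := by
  have hs : Continuous fun p : I × (sphere (m + 1) × I) => (p.2.2 : ℝ) * (1 + p.1) :=
    (continuous_subtype_val.comp (continuous_snd.comp continuous_snd)).mul
      (continuous_const.add (continuous_subtype_val.comp continuous_fst))
  have ht : Continuous fun p : I × (sphere (m + 1) × I) =>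
      (projIcc 0 1 zero_le_one ((p.2.2 : ℝ) * (1 + p.1) - 1) : I) :=
    continuous_projIcc.comp (hs.sub continuous_const)
  have hd : Continuous fun p : I × (sphere (m + 1) × I) => degreeTwo m p.2.1 :=
    (degreeTwo m).continuous.comp (continuous_fst.comp continuous_snd)
  refine Continuous.if_le ?_ ?_ hs continuous_const ?_
  · exact (mooreBall m).continuous.comp (continuous_polar.comp
      ((continuous_fst.comp continuous_snd).prodMk (continuous_projIcc.comp hs)))
  · exact (mooreSphere m).continuous.comp (continuous_shrinkSphere ht hd)
  · intro p hp
    rw [hp, sub_self, projIcc_of_right_le zero_le_one le_rfl, projIcc_of_le_left zero_le_one le_rfl]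
    refine (mooreBall_polar_one p.2.1).trans (congrArg (mooreSphere m) ?_)
    exact (shrinkSphere_zero _).symm

theorem mooreStretch_one (t : I) (x : sphere (m + 1)) :
    mooreStretch m (t, (x, 1)) = mooreSphere m (shrinkSphere (m + 1) t (degreeTwo m x)) := by
  by_cases h : ((1 : I) : ℝ) * (1 + t) ≤ 1
  -- On the boundary the first branch applies only at time zero, where no contraction has happened
  -- yet.
  · have ht : t = 0 := le_antisymm (by
      rw [Icc.coe_one, one_mul] at h
      exact Subtype.coe_le_coe.1 (by rw [Icc.coe_zero]; linarith)) t.2.1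
    rw [ht] at h ⊢
    refine (if_pos h).trans ?_
    rw [shrinkSphere_zero, projIcc_of_right_le zero_le_one (by simp)]
    exact mooreBall_polar_one x
  · refine (if_neg h).trans ?_
    change mooreSphere m
      (shrinkSphere (m + 1) (projIcc 0 1 zero_le_one ((1 : ℝ) * (1 + t) - 1)) _) = _
    rw [one_mul, add_sub_cancel_left, projIcc_val]

theorem mooreStretch_zero (p : sphere (m + 1) × I) :
    mooreStretch m (0, p) = mooreBall m (polar m p) := by
  have h : (p.2 : ℝ) * (1 + (0 : I)) = p.2 := by simp
  refine (if_pos ?_).trans ?_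
  · rw [h]
    exact p.2.2.2
  · rw [h, projIcc_val]

/-- Polar coordinates are ambiguous only at the centre, which stays fixed, and at radius `1`, where
the stretching depends on `x` only through `degreeTwo m x`. -/
theorem mooreStretch_compat {p q : sphere (m + 1) × I}
    (h : mooreBall m (polar m p) = mooreBall m (polar m q)) (t : I) :
    mooreStretch m (t, p) = mooreStretch m (t, q) := by
  obtain ⟨x, r⟩ := p
  obtain ⟨y, s⟩ := q
  rcases mooreBall_eq_iff.1 h with h' | ⟨hp, hq, h'⟩
  · have hn := congrArg (fun v => ‖v.1‖) h'
    simp only [norm_polar] at hn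
    obtain rfl : r = s := Subtype.ext hn
    by_cases hr : (r : ℝ) = 0
    · have h0 : r = 0 := Subtype.ext hr
      subst h0
      have hle : ((0 : I) : ℝ) * (1 + t) ≤ 1 := by simp
      refine (if_pos hle).trans (Eq.trans ?_ (if_pos hle).symm)
      rw [projIcc_of_le_left zero_le_one (by simp)]
      exact h
    · have hxy : (r : ℝ) • x.1 = (r : ℝ) • y.1 := congrArg Subtype.val h'
      rw [(Subtype.ext (smul_right_injective _ hr hxy) : x = y)]
  · rw [norm_polar] at hp hq
    obtain rfl : r = 1 := Subtype.ext hp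
    obtain rfl : s = 1 := Subtype.ext hq
    rw [polar_one, polar_one] at h'
    rw [mooreStretch_one, mooreStretch_one, (Subtype.ext h' : degreeTwo m x = degreeTwo m y)]

/-- A contractible subset of the sphere in the Moore space. -/
def mooreArc (m : ℕ) : Set (moore m) := mooreSphere m '' {x | 0 ≤ x.1 0 ∧ x.1 1 = 0}

theorem sphere_pt_inner (k : ℕ) (v : EuclideanSpace ℝ (Fin (k + 1))) :
    inner ℝ (sphere k).pt.1 v = v 0 :=
  (EuclideanSpace.inner_single_left 0 (1 : ℝ) v).trans (by simp)

theorem shrinkSphere_mem_arc {t : I} {x : sphere (m + 1)} (h : 0 ≤ x.1 0 ∧ x.1 1 = 0) :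
    0 ≤ (shrinkSphere (m + 1) t x).1 0 ∧ (shrinkSphere (m + 1) t x).1 1 = 0 := by
  have he0 : (sphere (m + 1)).pt.1 0 = 1 := by
    change (EuclideanSpace.single 0 1 : EuclideanSpace ℝ (Fin (m + 2))) 0 = 1
    simp
  have he1 : (sphere (m + 1)).pt.1 1 = 0 := by
    change (EuclideanSpace.single 0 1 : EuclideanSpace ℝ (Fin (m + 2))) 1 = 0
    simp
  have hx : |x.1 0| ≤ 1 := by
    have := PiLp.norm_apply_le x.1 0
    rwa [mem_sphere_zero_iff_norm.1 x.2] at this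
  rw [abs_of_nonneg h.1] at hx
  have hc : ∀ i, (shrinkSphere (m + 1) t x).1 i = ‖shrinkVec (sphere (m + 1)).pt.1 t x.1‖⁻¹ *
      ((x.1 0 + t * (1 - |x.1 0|)) * (sphere (m + 1)).pt.1 i +
        ((1 - t) + t * max 0 (-x.1 0)) * (x.1 i - x.1 0 * (sphere (m + 1)).pt.1 i)) := by
    intro i
    rw [← sphere_pt_inner (m + 1) x.1]
    rfl
  rw [hc, hc, he0, he1, h.2, abs_of_nonneg h.1]
  constructor
  · refine mul_nonneg (inv_nonneg.2 (norm_nonneg _)) ?_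
    rw [mul_one, mul_one, sub_self, mul_zero, add_zero]
    exact add_nonneg h.1 (mul_nonneg t.2.1 (by linarith))
  · simp

/-- The contraction of the bottom sphere preserves the half-sphere and ends by sending it to the
basepoint; stretching the ball extends it to the whole Moore space. -/
theorem moore_collapse :
    PointedHomotopyEquivalent (moore m) (collapse (mooreArc m) (moore m).pt) := by
  have hπ := isQuotientMap_moorePolar (m := m)
  let H := descendProd hπ (mooreStretch m) continuous_mooreStretch
    fun p q h t => mooreStretch_compat h t
  have hH : ∀ t p, H (t, mooreBall m (polar m p)) = mooreStretch m (t, p) := fun t p =>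
    descendProd_apply hπ _ _ _ t p
  have hS : ∀ t x, H (t, mooreSphere m x) = mooreSphere m (shrinkSphere (m + 1) t x) := by
    intro t x
    obtain ⟨y, rfl⟩ := degreeTwo_surjective x
    rw [← mooreBall_polar_one, hH, mooreStretch_one]
  refine .collapse_of_homotopy (moore m) (mooreArc m) H H.continuous ?_ ?_ ?_ ?_
  · intro x
    obtain ⟨p, rfl⟩ := hπ.surjective x
    rw [hH, mooreStretch_zero]
  · rintro t _ ⟨x, hx, rfl⟩
    rw [hS]
    exact ⟨_, shrinkSphere_mem_arc hx, rfl⟩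
  · rintro _ ⟨x, hx, rfl⟩
    rw [hS]
    refine congrArg (mooreSphere m) (Subtype.ext ?_)
    refine shrink_one (mem_sphere_zero_iff_norm.1 (sphere _).pt.2) ?_
    rw [sphere_pt_inner]
    exact hx.1
  · intro t
    exact (hS t (sphere (m + 1)).pt).trans (congrArg (mooreSphere m) (shrinkSphere_pt t))

/-- Doubling the angle folds the line `v 1 = 0` onto the nonnegative half-line, and no other point
of the plane goes there. So the preimage of the half-sphere is a whole great sphere of the boundary.
-/
theorem mooreBall_mem_arc {v : Metric.closedBall (0 : EuclideanSpace ℝ (Fin (m + 2))) 1} :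
    mooreBall m v ∈ mooreArc m ↔ ‖v.1‖ = 1 ∧ v.1 1 = 0 := by
  have key : 0 ≤ angleDouble m v.1 0 ∧ angleDouble m v.1 1 = 0 ↔ v.1 1 = 0 := by
    rw [angleDouble_zero, angleDouble_one]
    constructor
    · rintro ⟨h0, h1⟩
      by_contra hv
      have hp : 0 < v.1 1 ^ 2 := by positivity
      have hs : 0 < √(v.1 0 ^ 2 + v.1 1 ^ 2) := Real.sqrt_pos.2 (by positivity)
      rw [div_eq_zero_iff] at h1
      have h2 : v.1 0 = 0 := by simpa [hv, hs.ne'] using h1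
      rw [le_div_iff₀ hs, h2] at h0
      linarith
    · intro h
      rw [h]
      exact ⟨div_nonneg (by nlinarith [sq_nonneg (v.1 0)]) (Real.sqrt_nonneg _), by simp⟩
  constructor
  · rintro ⟨x, hx, h⟩
    obtain ⟨hv, hx'⟩ := mooreSphere_eq_ball_iff.1 h
    rw [mem_ofPred_eq, hx'] at hx
    exact ⟨hv, key.1 hx⟩
  · rintro ⟨hv, h⟩
    have h1 : ‖angleDouble m v.1‖ = 1 := by rw [norm_angleDouble, hv]
    exact ⟨⟨_, mem_sphere_zero_iff_norm.2 h1⟩, key.2 h, mooreSphere_eq_ball_iff.2 ⟨hv, rfl⟩⟩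

end MooreCollapse

/-! ### The Moore space as a one-point compactification -/

section MooreCompactification

variable {m : ℕ}

/-- The quadratic form `1 + a² + ∑ yⱼ²`. -/
def stripNorm (w : (Fin m → ℝ) × (ℝ × Icc (-1 : ℝ) 1)) : ℝ := 1 + (w.2.1 ^ 2 + ∑ j, w.1 j ^ 2)

theorem stripNorm_pos (w : (Fin m → ℝ) × (ℝ × Icc (-1 : ℝ) 1)) : 0 < stripNorm w := by
  unfold stripNorm
  positivity

theorem continuous_stripNorm : Continuous (stripNorm (m := m)) := by
  unfold stripNorm
  fun_prop

theorem norm_sq_euclidean (v : EuclideanSpace ℝ (Fin (m + 2))) :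
    ‖v‖ ^ 2 = v 1 ^ 2 + (v 0 ^ 2 + ∑ j : Fin m, v j.succ.succ ^ 2) := by
  rw [EuclideanSpace.real_norm_sq_eq, Fin.sum_univ_succ, Fin.sum_univ_succ]
  simp only [Fin.succ_zero_eq_one]
  ring

/-- The vector `(a, c, y) / √(1 + a² + ‖y‖²)`. -/
def stripVec (w : (Fin m → ℝ) × (ℝ × Icc (-1 : ℝ) 1)) : EuclideanSpace ℝ (Fin (m + 2)) :=
  WithLp.toLp 2 (Fin.cons (w.2.1 / √(stripNorm w)) (Fin.cons (w.2.2 / √(stripNorm w))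
    fun j => w.1 j / √(stripNorm w)))

theorem stripVec_zero (w : (Fin m → ℝ) × (ℝ × Icc (-1 : ℝ) 1)) :
    stripVec w 0 = w.2.1 / √(stripNorm w) := rfl

theorem stripVec_one (w : (Fin m → ℝ) × (ℝ × Icc (-1 : ℝ) 1)) :
    stripVec w 1 = w.2.2 / √(stripNorm w) := rfl

theorem stripVec_succ_succ (w : (Fin m → ℝ) × (ℝ × Icc (-1 : ℝ) 1)) (j : Fin m) :
    stripVec w j.succ.succ = w.1 j / √(stripNorm w) := rfl

theorem continuous_stripVec : Continuous (stripVec (m := m)) := by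
  have hs : Continuous fun w : (Fin m → ℝ) × (ℝ × Icc (-1 : ℝ) 1) => √(stripNorm w) :=
    continuous_stripNorm.sqrt
  have h0 : ∀ w : (Fin m → ℝ) × (ℝ × Icc (-1 : ℝ) 1), √(stripNorm w) ≠ 0 := fun w =>
    (Real.sqrt_pos.2 (stripNorm_pos w)).ne'
  refine (PiLp.continuous_toLp 2 _).comp (continuous_pi fun j => ?_)
  refine Fin.cases ?_ (fun j => Fin.cases ?_ (fun j => ?_) j) j
  · exact Continuous.div (by fun_prop) hs h0
  · exact Continuous.div (by fun_prop) hs h0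
  · exact Continuous.div (by fun_prop) hs h0

/-- The square of the norm of a vector without its second coordinate. -/
def cutNorm (v : EuclideanSpace ℝ (Fin (m + 2))) : ℝ := v 0 ^ 2 + ∑ j : Fin m, v j.succ.succ ^ 2

theorem one_sub_cutNorm_stripVec (w : (Fin m → ℝ) × (ℝ × Icc (-1 : ℝ) 1)) :
    1 - cutNorm (stripVec w) = (stripNorm w)⁻¹ := by
  have hp := stripNorm_pos w
  rw [cutNorm]
  simp only [stripVec_zero, stripVec_succ_succ, div_pow, Real.sq_sqrt hp.le]
  rw [← Finset.sum_div, ← add_div, show w.2.1 ^ 2 + ∑ j, w.1 j ^ 2 = stripNorm w - 1 by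
    rw [stripNorm]; ring]
  field_simp
  ring

/-- Hence the bound `|c| ≤ 1` places the vector in the unit ball, and the edges `c = ±1` of the
strip are exactly what meets the boundary sphere. -/
theorem norm_sq_stripVec (w : (Fin m → ℝ) × (ℝ × Icc (-1 : ℝ) 1)) :
    ‖stripVec w‖ ^ 2 = 1 - (1 - (w.2.2 : ℝ) ^ 2) / stripNorm w := by
  have hp := stripNorm_pos w
  have h := one_sub_cutNorm_stripVec w
  rw [cutNorm] at h
  rw [norm_sq_euclidean, stripVec_one, div_pow, Real.sq_sqrt hp.le, sub_div, ← inv_eq_one_div, ← h]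
  ring

theorem norm_stripVec_eq_one_iff (w : (Fin m → ℝ) × (ℝ × Icc (-1 : ℝ) 1)) :
    ‖stripVec w‖ = 1 ↔ (w.2.2 : ℝ) ^ 2 = 1 := by
  have hp := stripNorm_pos w
  rw [← sq_eq_sq₀ (norm_nonneg _) zero_le_one, norm_sq_stripVec, one_pow, sub_eq_self,
    div_eq_zero_iff, or_iff_left hp.ne', sub_eq_zero, eq_comm]

/-- The embedding of the strip in the ball. -/
def stripBall (w : (Fin m → ℝ) × (ℝ × Icc (-1 : ℝ) 1)) :
    Metric.closedBall (0 : EuclideanSpace ℝ (Fin (m + 2))) 1 :=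
  ⟨stripVec w, by
    have h : (0 : ℝ) ≤ 1 - (w.2.2 : ℝ) ^ 2 := by nlinarith [w.2.2.2.1, w.2.2.2.2]
    rw [mem_closedBall_zero_iff, ← sq_le_sq₀ (norm_nonneg _) zero_le_one, norm_sq_stripVec, one_pow]
    linarith [div_nonneg h (stripNorm_pos w).le]⟩

/-- The inverse of `stripBall`. -/
def ballStrip (v : EuclideanSpace ℝ (Fin (m + 2))) : (Fin m → ℝ) × (ℝ × Icc (-1 : ℝ) 1) :=
  (fun j => v j.succ.succ / √(1 - cutNorm v), (v 0 / √(1 - cutNorm v),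
    projIcc (-1) 1 (by norm_num) (v 1 / √(1 - cutNorm v))))

theorem ballStrip_stripVec (w : (Fin m → ℝ) × (ℝ × Icc (-1 : ℝ) 1)) :
    ballStrip (stripVec w) = w := by
  have h : √(stripNorm w) ≠ 0 := (Real.sqrt_pos.2 (stripNorm_pos w)).ne'
  have hd : ∀ a : ℝ, a / √(stripNorm w) / √(1 - cutNorm (stripVec w)) = a := fun a => by
    rw [one_sub_cutNorm_stripVec, Real.sqrt_inv]
    field_simp
  refine Prod.ext (funext fun j => hd _) (Prod.ext (hd _) ?_)
  refine (congrArg (projIcc (-1 : ℝ) 1 (by norm_num)) (hd _)).trans (projIcc_val _ _)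

theorem range_stripBall :
    range (stripBall (m := m)) = {v | cutNorm v.1 < 1} := by
  ext v
  constructor
  · rintro ⟨w, rfl⟩
    have := inv_pos.2 (stripNorm_pos w)
    rw [← one_sub_cutNorm_stripVec] at this
    exact sub_pos.1 this
  · intro hv
    have hp : 0 < 1 - cutNorm v.1 := sub_pos.2 hv
    have hs := Real.sqrt_pos.2 hp
    have hn : v.1 1 ^ 2 ≤ 1 - cutNorm v.1 := by
      have h1 : ‖v.1‖ ^ 2 ≤ 1 := by
        rw [sq_le_one_iff₀ (norm_nonneg _)]
        exact mem_closedBall_zero_iff.1 v.2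
      rw [norm_sq_euclidean] at h1
      rw [cutNorm]
      linarith
    -- The bound on `c` is the condition `‖v‖ ≤ 1` divided by `1 - cutNorm v`, so the projection in
    -- `ballStrip` changes nothing.
    have hc : v.1 1 / √(1 - cutNorm v.1) ∈ Icc (-1 : ℝ) 1 := by
      rw [mem_Icc, ← abs_le, ← sq_le_one_iff_abs_le_one, div_pow, Real.sq_sqrt hp.le]
      exact div_le_one_of_le₀ hn hp.le
    have hN : stripNorm (ballStrip v.1) = (1 - cutNorm v.1)⁻¹ := by
      rw [stripNorm]
      simp only [ballStrip, div_pow, Real.sq_sqrt hp.le]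
      rw [← Finset.sum_div, ← add_div]
      change 1 + cutNorm v.1 / _ = _
      field_simp
      ring
    have hd : ∀ a : ℝ, a / √(1 - cutNorm v.1) / √(stripNorm (ballStrip v.1)) = a := fun a => by
      rw [hN, Real.sqrt_inv]
      field_simp
    refine ⟨ballStrip v.1, Subtype.ext (euclidean_ext (hd _) ?_ fun j => hd _)⟩
    refine Eq.trans ?_ (hd _)
    change ((projIcc (-1 : ℝ) 1 (by norm_num) _ : Icc (-1 : ℝ) 1) : ℝ) / _ = _
    rw [projIcc_of_mem _ hc]

theorem continuous_cutNorm : Continuous (cutNorm (m := m)) := by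
  unfold cutNorm
  fun_prop

theorem isOpenEmbedding_stripBall : IsOpenEmbedding (stripBall (m := m)) := by
  refine IsOpenEmbedding.of_leftInverse (continuous_stripVec.subtype_mk _) ?_
    (fun v => ballStrip v.1) ?_ ballStrip_stripVec
  · rw [range_stripBall]
    exact isOpen_lt (continuous_cutNorm.comp continuous_subtype_val) continuous_const
  · rw [range_stripBall]
    have hs : Continuous fun v : Metric.closedBall (0 : EuclideanSpace ℝ (Fin (m + 2))) 1 =>
        √(1 - cutNorm v.1) :=
      (continuous_const.sub (continuous_cutNorm.comp continuous_subtype_val)).sqrt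
    have h0 : ∀ v ∈ {v : Metric.closedBall (0 : EuclideanSpace ℝ (Fin (m + 2))) 1 |
        cutNorm v.1 < 1}, √(1 - cutNorm v.1) ≠ 0 := fun v hv =>
      (Real.sqrt_pos.2 (sub_pos.2 hv)).ne'
    have hd : ∀ i : Fin (m + 2), ContinuousOn
        (fun v : Metric.closedBall (0 : EuclideanSpace ℝ (Fin (m + 2))) 1 =>
          v.1 i / √(1 - cutNorm v.1)) {v | cutNorm v.1 < 1} := fun i =>
      ContinuousOn.div (by fun_prop) hs.continuousOn h0
    exact (continuousOn_pi.2 fun j => hd _).prodMk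
      ((hd _).prodMk (continuous_projIcc.comp_continuousOn (hd _)))

/-- In the unit ball `cutNorm v ≥ 1` leaves no room for the second coordinate and forces `‖v‖ = 1`,
so the complement of the strip is the great sphere over the half-sphere. -/
theorem notMem_range_stripBall {v : Metric.closedBall (0 : EuclideanSpace ℝ (Fin (m + 2))) 1} :
    v ∉ range (stripBall (m := m)) ↔ mooreBall m v ∈ mooreArc m := by
  have h1 : ‖v.1‖ ^ 2 ≤ 1 := by
    rw [sq_le_one_iff₀ (norm_nonneg _)]
    exact mem_closedBall_zero_iff.1 v.2
  have hn : ‖v.1‖ ^ 2 = v.1 1 ^ 2 + cutNorm v.1 := norm_sq_euclidean v.1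
  rw [range_stripBall, mooreBall_mem_arc, ← sq_eq_sq₀ (norm_nonneg _) zero_le_one]
  change ¬ cutNorm v.1 < 1 ↔ _
  rw [not_lt, one_pow]
  constructor
  · intro h
    have h0 : v.1 1 ^ 2 = 0 := le_antisymm (by linarith) (sq_nonneg _)
    exact ⟨le_antisymm h1 (by linarith [sq_nonneg (v.1 1)]), by simpa using h0⟩
  · rintro ⟨h, h0⟩
    rw [hn, h0] at h
    linarith

/-- On the boundary, angle doubling identifies `(v 0, v 1)` with its negative. In strip coordinates
this glues the edge points `(a, c)` and `(-a, -c)` with `c = ±1`: the Möbius twist. -/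
theorem mooreBall_stripBall_eq_iff {y y' : Fin m → ℝ} {a a' : ℝ} {c c' : Icc (-1 : ℝ) 1} :
    mooreBall m (stripBall (y, (a, c))) = mooreBall m (stripBall (y', (a', c'))) ↔
      y = y' ∧ moebiusStrip (a, c) = moebiusStrip (a', c') := by
  rw [mooreBall_eq_iff, isOpenEmbedding_stripBall.injective.eq_iff, moebiusStrip_eq_iff]
  change _ ∨ (‖stripVec _‖ = 1 ∧ ‖stripVec _‖ = 1 ∧ angleDouble m (stripVec _) =
    angleDouble m (stripVec _)) ↔ _
  rw [norm_stripVec_eq_one_iff, norm_stripVec_eq_one_iff, angleDouble_eq_iff]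
  simp only [stripVec_zero, stripVec_one, stripVec_succ_succ]
  constructor
  · rintro (h | ⟨hc, hc', h, h'⟩)
    · simp only [Prod.mk.injEq] at h
      exact ⟨h.1, Or.inl h.2⟩
    -- The normalising factor is determined by `cutNorm`, which is insensitive to the sign of `v 0`;
    -- it can then be cancelled.
    · have hN : stripNorm (y, (a, c)) = stripNorm (y', (a', c')) := by
        rw [← inv_inj, ← one_sub_cutNorm_stripVec, ← one_sub_cutNorm_stripVec, cutNorm, cutNorm]
        simp only [stripVec_zero, stripVec_succ_succ, h]
        congr 2
        rcases h' with h' | h'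
        · rw [h'.1]
        · rw [h'.1, neg_sq]
      have h0 : √(stripNorm (y', (a', c'))) ≠ 0 := (Real.sqrt_pos.2 (stripNorm_pos _)).ne'
      rw [hN] at h h'
      simp only [← neg_div, div_left_inj' h0] at h h'
      refine ⟨funext h, ?_⟩
      rcases h' with h' | h'
      · exact Or.inl ⟨h'.1, Subtype.ext h'.2⟩
      · exact Or.inr ⟨h'.1, h'.2, hc⟩
  · rintro ⟨rfl, ⟨rfl, rfl⟩ | ⟨rfl, hcc, hc⟩⟩
    · exact Or.inl rfl
    · have hN : stripNorm (y, (-a', c)) = stripNorm (y, (a', c')) := by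
        simp [stripNorm]
      refine Or.inr ⟨hc, ?_, fun j => by rw [hN], Or.inr ⟨?_, ?_⟩⟩
      · rwa [hcc, neg_sq] at hc
      · rw [hN, neg_div]
      · rw [hN, hcc, neg_div]

/-- After the collapse only the strip survives, glued to `ℝ^m × Möbius`. The oddness of `m` serves
to rewrite `ℝ^m` as `ℂ^b × ℝ`, the form that arises from the Klein bottle. -/
theorem moore_onePt {b : ℕ} (hm : m = b + b + 1) :
    PointedHomotopyEquivalent (moore m) (onePt (((Fin b → ℂ) × ℝ) × Moebius)) := by
  have hf : Module.finrank ℝ (Fin m → ℝ) = Module.finrank ℝ ((Fin b → ℂ) × ℝ) := by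
    simp [Module.finrank_pi_fintype, hm, mul_two]
  obtain ⟨L⟩ := FiniteDimensional.nonempty_continuousLinearEquiv_of_finrank_eq hf
  obtain ⟨c₀, hc₀⟩ := isQuotientMap_mooreBall.surjective (moore m).pt
  have hpt : (moore m).pt ∈ mooreArc m := by
    refine ⟨(sphere (m + 1)).pt, ⟨?_, ?_⟩, rfl⟩
    · change 0 ≤ (EuclideanSpace.single 0 1 : EuclideanSpace ℝ (Fin (m + 2))) 0
      simp
    · change (EuclideanSpace.single 0 1 : EuclideanSpace ℝ (Fin (m + 2))) 1 = 0
      simp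
  refine moore_collapse.trans ?_
  refine .onePt_of_cover (C := Metric.closedBall (0 : EuclideanSpace ℝ (Fin (m + 2))) 1)
    (π := collapseMk (mooreArc m) (moore m).pt ∘ mooreBall m)
    (isQuotientMap_collapseMk.comp isQuotientMap_mooreBall) continuous_id Function.surjective_id
    isOpenEmbedding_stripBall (f := Prod.map L moebiusStrip)
    (L.toHomeomorph.isProperMap.prodMap isProperMap_moebiusStrip)
    (L.surjective.prodMap moebiusStrip_surjective) (c₀ := c₀) (congrArg _ hc₀) ?_ ?_ ?_
  · rw [id, notMem_range_stripBall, hc₀]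
    exact hpt
  · intro v v' h
    rw [id, notMem_range_stripBall] at h ⊢
    refine collapseMk_eq_iff.trans ⟨?_, fun h' => Or.inr ⟨h, h'⟩⟩
    rintro (h' | h')
    · rwa [← h']
    · exact h'.2
  · rintro v v' ⟨y, a, c⟩ ⟨y', a', c'⟩ hv hv'
    obtain rfl : v = _ := hv
    obtain rfl : v' = _ := hv'
    have h0 : mooreBall m (stripBall (y, (a, c))) ∉ mooreArc m := by
      rw [← notMem_range_stripBall, not_not]
      exact mem_range_self _
    refine collapseMk_eq_iff.trans ?_
    rw [or_iff_left fun h => h0 h.1, mooreBall_stripBall_eq_iff, Prod.map, Prod.map, Prod.mk.injEq,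
      L.injective.eq_iff]

/-- Both sides compactify the product of `ℂ^b`, `ℝ` and the Möbius strip; the factor `ℝ` is the
suspension coordinate on the left and the last coordinate of `ℝ^m` on the right. -/
theorem Torus.susp_quotient_odd {k : ℕ} {K : Finset (Fin k)} (hK : Odd K.card) :
    PointedHomotopyEquivalent (reducedSuspension (Torus.quotient K K)) (moore K.card) := by
  obtain ⟨b, hb⟩ := hK
  rw [two_mul] at hb
  refine (Torus.quotient_odd hb).susp.trans ((susp_onePt _).trans ?_)
  refine (onePt_congr ?_).trans (moore_onePt hb).symm
  exact (Homeomorph.prodAssoc _ _ _).trans (((Homeomorph.refl _).prodCongr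
    (Homeomorph.prodComm _ _)).trans (Homeomorph.prodAssoc _ _ _).symm)

end MooreCompactification

/-! ### Sorting the sets of coordinates by cardinality -/

/-- The finite sets with `i` elements. -/
def finsetCardEquiv (k i : ℕ) : {K : Finset (Fin k) // K.card = i} ≃ Fin (k.choose i) :=
  Fintype.equivFinOfCardEq (by simp)

theorem finsetCardEquiv_heq {k i : ℕ} {K : Finset (Fin k)} (h : K.card = i) :
    finsetCardEquiv k i ⟨K, h⟩ ≍ finsetCardEquiv k K.card ⟨K, rfl⟩ := by
  subst h
  rfl

/-- The finite sets, sorted by cardinality. -/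
def finsetEquiv (k : ℕ) : Unit ⊕ ((Σ i : {i : ℕ // Even i ∧ 0 < i}, Fin (k.choose i)) ⊕
    (Σ i : {i : ℕ // Odd i}, Fin (k.choose i))) ≃ Finset (Fin k) where
  toFun := Sum.elim (fun _ => ∅) (Sum.elim (fun p => ((finsetCardEquiv k p.1).symm p.2).1)
    (fun p => ((finsetCardEquiv k p.1).symm p.2).1))
  invFun K := if h0 : K.card = 0 then Sum.inl () else Sum.inr <|
    if h : Even K.card then
      Sum.inl ⟨⟨K.card, h, Nat.pos_of_ne_zero h0⟩, finsetCardEquiv k _ ⟨K, rfl⟩⟩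
    else Sum.inr ⟨⟨K.card, Nat.not_even_iff_odd.1 h⟩, finsetCardEquiv k _ ⟨K, rfl⟩⟩
  left_inv := by
    rintro (_ | ⟨⟨i, hi, hi0⟩, j⟩ | ⟨⟨i, hi⟩, j⟩)
    · simp
    · obtain ⟨⟨K, rfl⟩, rfl⟩ := (finsetCardEquiv k i).surjective j
      simp [hi, hi0.ne']
      exact finsetCardEquiv_heq _
    · obtain ⟨⟨K, rfl⟩, rfl⟩ := (finsetCardEquiv k i).surjective j
      have h0 : K.card ≠ 0 := fun h => by simp [h] at hi
      simp [Nat.not_even_iff_odd.2 hi, h0]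
      exact finsetCardEquiv_heq _
  right_inv K := by
    by_cases h0 : K.card = 0
    · simp [Finset.card_eq_zero.1 h0]
    · by_cases h : Even K.card <;> simp [h0, h]

theorem card_finsetCardEquiv_symm {k i : ℕ} (j : Fin (k.choose i)) :
    ((finsetCardEquiv k i).symm j).1.card = i := ((finsetCardEquiv k i).symm j).2

end HigherKlein
end

/-! ### The splitting of the suspended Klein bottle -/

open HigherKlein
theorem mainTheorem1 (n : ℕ) (hn : 1 ≤ n) (x₀ : Klein n) :
    PointedHomotopyEquivalent
      (reducedSuspension { carrier := Klein n, pt := x₀ })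
      (wedge (sphere 2)
        (wedge
          (bigWedge fun p : (Σ i : {i : ℕ // Even i ∧ 0 < i}, Fin ((n - 1).choose i)) =>
            wedge (sphere (p.1 + 1)) (sphere (p.1 + 2)))
          (bigWedge fun p : (Σ i : {i : ℕ // Odd i}, Fin ((n - 1).choose i)) =>
            moore p.1))) := by
  obtain ⟨k, rfl⟩ := Nat.exists_eq_add_of_le' hn
  -- The wedge over all sets of coordinates is regrouped into the empty set, the nonempty sets of
  -- even size and the sets of odd size.
  refine (susp_klein x₀).trans (
    (PointedHomotopyEquivalent.bigWedge_reindex (finsetEquiv k)).symm.trans (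
      (PointedHomotopyEquivalent.bigWedge_sum _).trans (.wedge ?_
      ((PointedHomotopyEquivalent.bigWedge_sum _).trans (.wedge ?_ ?_)))))
  · exact PointedHomotopyEquivalent.bigWedge_unique.trans Torus.susp_quotient_empty
  · refine .bigWedge_congr fun p => ?_
    have hc := card_finsetCardEquiv_symm p.2
    have h := Torus.susp_quotient_even (K := ((finsetCardEquiv k p.1).symm p.2).1)
      (Finset.card_pos.1 (hc.symm ▸ p.1.2.2)) (hc.symm ▸ p.1.2.1)
    rw [hc] at h
    exact h
  · refine .bigWedge_congr fun p => ?_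
    have hc := card_finsetCardEquiv_symm p.2
    have h := Torus.susp_quotient_odd (K := ((finsetCardEquiv k p.1).symm p.2).1)
      (hc.symm ▸ p.1.2)
    rw [hc] at h
    exact h
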